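/- Let $\mathbb{F}$ be a field of characteristic $0$. The Heisenberg--Virasoro Lie conformal algebra $\mathcal{W}(0)=\mathbb{F}[\partial]L\oplus\mathbb{F}[\partial]H$ is the free $\mathbb{F}[\partial]$-module on $L,H$ with $\lambda$-brackets $$[L_\lambda L]=(\partial+2\lambda)L,\quad [L_\lambda H]=(\partial+\lambda)H,\quad [H_\lambda L]=\lambda H,\quad [H_\lambda H]=0.$$ Write $\mathcal{A}=\mathcal{W}(0)$. For $q\ge 0$, let $\widetilde{C}^q$ be the space of $\mathbb{F}$-linear maps $f:\mathcal{A}^{\otimes q}\to \mathcal{A}[\lambda_1,\dots,\lambda_q]$ (with $\widetilde{C}^0=\mathcal{A}$) satisfying $f_{\lambda_1,\dots,\lambda_q}(\dots,\partial a_i,\dots)=-\lambda_i f_{\lambda_1,\dots,\lambda_q}(\dots,a_i,\dots)$ and skew-symmetric under simultaneous permutations of the $a_i$ and $\lambda_i$. The differential $\mathbf{d}:\widetilde{C}^q\to\widetilde{C}^{q+1}$ is $$(\mathbf{d}f)_{\lambda_1,\dots,\lambda_{q+1}}(a_1,\dots,a_{q+1})=\sum_{k}(-1)^{k+1}[a_{k\,\lambda_k}f_{\dots,\hat\lambda_k,\dots}(\dots,\hat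 a_k,\dots)]+\sum_{k<l}(-1)^{k+l}f_{\lambda_k+\lambda_l,\dots,\hat\lambda_k,\dots,\hat\lambda_l,\dots}([a_{k\,\lambda_k}a_l],\dots,\hat a_k,\dots,\hat a_l,\dots),$$ and $(\partial f)_{\lambda_1,\dots,\lambda_q}=(\partial+\lambda_1+\dots+\lambda_q)f_{\lambda_1,\dots,\lambda_q}$. The basic cohomology $\widetilde{\mathrm{H}}^q$ is the cohomology of $\widetilde{C}^\bullet$, and the reduced cohomology $\mathrm{H}^q$ is that of $C^\bullet=\widetilde{C}^\bullet/\partial\widetilde{C}^\bullet$ (both with coefficients in the adjoint module). Then $$\dim\widetilde{\mathrm{H}}^q(\mathcal{W}(0),\mathcal{W}(0))=\begin{cases}1,& q=1,3,\\ 2,& q=2,\\ 0,&\text{otherwise},\end{cases}\qquad \dim\mathrm{H}^q(\mathcal{W}(0),\mathcal{W}(0))=\begin{cases}3,& q=1,2,\\ 1,& q=0,3,\\ 0,&\text{otherwise}.\end{cases}$$ Moreover, bases are given as follows. Each cochain below is the unique one which takes the displayed value on the displayed tensor of generators and vanishes on all other tensors $L\otimes\dots\otimes L\otimes H\otimes\dots\otimes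 H$ of the same degree: $$f_{01}=H\in\widetilde{C}^0;\qquad f_{11}:L\mapsto H,\quad f_{12}:H\mapsto H,\quad f_{13}:L\mapsto\partial H;$$ $$f_{21}:L\otimes H\mapsto H,\quad f_{22}:L\otimes L\mapsto(\lambda_1-\lambda_2)H,\quad f_{23}:L\otimes H\mapsto(\partial+\lambda_2)H;\qquad f_{31}:L\otimes L\otimes H\mapsto(\lambda_1-\lambda_2)H.$$ The classes of $f_{11}$; of $f_{21},f_{22}$; and of $f_{31}$ form bases of $\widetilde{\mathrm{H}}^1,\widetilde{\mathrm{H}}^2,\widetilde{\mathrm{H}}^3$, respectively. The classes of the images $\bar f_{01}$; $\bar f_{11},\bar f_{12},\bar f_{13}$; $\bar f_{21},\bar f_{22},\bar f_{23}$; and $\bar f_{31}$ in $C^\bullet$ form bases of $\mathrm{H}^0,\mathrm{H}^1,\mathrm{H}^2,\mathrm{H}^3$, respectively. -/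

import Mathlib

open scoped TensorProduct

namespace LieConformal

noncomputable section

universe u v w

/-! ### Polynomials with coefficients in a vector space -/

section ChangeOfVariables

variable {F : Type u} [Field F] {M : Type v} [AddCommGroup M] [Module F M]

/-- Substitution of variables: the map `R ⊗ M → S ⊗ M` induced by an algebra homomorphism `R → S`. -/
def chg {R S : Type*} [CommRing R] [Algebra F R] [CommRing S] [Algebra F S] (M : Type v)
    [AddCommGroup M] [Module F M] (φ : R →ₐ[F] S) : R ⊗[F] M →ₗ[F] S ⊗[F] M :=
  LinearMap.rTensor M φ.toLinearMap

variable {R S T : Type*} [CommRing R] [Algebra F R] [CommRing S] [Algebra F S] [CommRing T]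
  [Algebra F T]

@[simp]
theorem chg_tmul (φ : R →ₐ[F] S) (r : R) (m : M) : chg M φ (r ⊗ₜ m) = φ r ⊗ₜ m := rfl

theorem chg_smul (φ : R →ₐ[F] S) (r : R) (v : R ⊗[F] M) : chg M φ (r • v) = φ r • chg M φ v := by
  induction v with
  | zero => simp
  | tmul x y => simp [TensorProduct.smul_tmul']
  | add x y hx hy => simp [hx, hy]

theorem chg_chg (φ : R →ₐ[F] S) (ψ : S →ₐ[F] T) (v : R ⊗[F] M) :
    chg M ψ (chg M φ v) = chg M (ψ.comp φ) v := by
  induction v with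
  | zero => simp
  | tmul x y => simp
  | add x y hx hy => simp [hx, hy]

theorem chg_baseChange (φ : R →ₐ[F] S) (D : M →ₗ[F] M) (v : R ⊗[F] M) :
    chg M φ (D.baseChange R v) = D.baseChange S (chg M φ v) := by
  induction v with
  | zero => simp
  | tmul x y => simp
  | add x y hx hy => simp [hx, hy]

/-- The substitution `λ ↦ -λ - ∂` on `M[λ] = F[λ] ⊗ M`, where `D` is the action of `∂` on `M`:
it sends `λⁿ m` to `(-λ - ∂)ⁿ m`. -/
def skewSubst (D : M →ₗ[F] M) :
    Polynomial F ⊗[F] M →ₗ[F] Polynomial F ⊗[F] M :=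
  TensorProduct.lift (LinearMap.mk₂ F
    (fun (p : Polynomial F) (m : M) =>
      Polynomial.aeval (-((Polynomial.X : Polynomial F) •
        (1 : Module.End (Polynomial F) (Polynomial F ⊗[F] M))) - D.baseChange (Polynomial F)) p
        ((1 : Polynomial F) ⊗ₜ[F] m))
    (by intros; simp) (by intros; simp) (by intros; simp [TensorProduct.tmul_add])
    (by intros; simp [TensorProduct.tmul_smul]))

end ChangeOfVariables

/-! ### Lie conformal algebras and their modules -/

section LambdaAction

variable {F : Type u} [Field F] {A : Type v} [AddCommGroup A] [Module F A]
  {M : Type w} [AddCommGroup M] [Module F M]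

/-- Given a `λ`-product `β : A ⊗ M → M[λ]`, a commutative `F`-algebra `R` of parameters and
`t ∈ R`, this is `(v, a) ↦ a_t v`, extended `R`-linearly to `v ∈ R ⊗ M`. -/
def act (β : A →ₗ[F] M →ₗ[F] Polynomial F ⊗[F] M) {R : Type*} [CommRing R] [Algebra F R]
    (t : R) (a : A) : R ⊗[F] M →ₗ[R] R ⊗[F] M :=
  (chg M (Polynomial.aeval t) ∘ₗ β a).liftBaseChange R

/-- The same with the roles of the arguments exchanged: `(m, u) ↦ u_t m`, extended `R`-linearly
to `u ∈ R ⊗ A`. -/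
def actLeft (β : A →ₗ[F] M →ₗ[F] Polynomial F ⊗[F] M) {R : Type*} [CommRing R] [Algebra F R]
    (t : R) (m : M) : R ⊗[F] A →ₗ[R] R ⊗[F] M :=
  (chg M (Polynomial.aeval t) ∘ₗ β.flip m).liftBaseChange R

theorem act_add (β : A →ₗ[F] M →ₗ[F] Polynomial F ⊗[F] M) {R : Type*} [CommRing R] [Algebra F R]
    (t : R) (a b : A) (v : R ⊗[F] M) : act β t (a + b) v = act β t a v + act β t b v := by
  induction v with
  | zero => simp
  | tmul x y => simp [act]
  | add x y hx hy => rw [map_add, hx, hy, map_add, map_add]; abel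

theorem act_smul (β : A →ₗ[F] M →ₗ[F] Polynomial F ⊗[F] M) {R : Type*} [CommRing R] [Algebra F R]
    (t : R) (c : F) (a : A) (v : R ⊗[F] M) : act β t (c • a) v = c • act β t a v := by
  induction v with
  | zero => simp
  | tmul x y => simp [act, smul_comm c x]
  | add x y hx hy => rw [map_add, hx, hy, map_add, smul_add]

end LambdaAction

/-- A Lie conformal algebra structure on a vector space `A`; the `F[∂]`-module structure is given
by the endomorphism `der = ∂`, and the `λ`-bracket takes values in `A[λ] = F[λ] ⊗ A`. -/
structure LieConformalAlgebra (F : Type u) [Field F] (A : Type v) [AddCommGroup A]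
    [Module F A] where
  der : A →ₗ[F] A
  bracket : A →ₗ[F] A →ₗ[F] Polynomial F ⊗[F] A
  bracket_der_left : ∀ a b, bracket (der a) b = -((Polynomial.X : Polynomial F) • bracket a b)
  bracket_der_right : ∀ a b, bracket a (der b) =
    der.baseChange (Polynomial F) (bracket a b) + (Polynomial.X : Polynomial F) • bracket a b
  bracket_skew : ∀ a b, bracket a b = -skewSubst der (bracket b a)
  /-- `[a_λ [b_μ c]] = [[a_λ b]_{λ+μ} c] + [b_μ [a_λ c]]` in `F[λ, μ] ⊗ A`,
  with `λ = X 0`, `μ = X 1`. -/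
  jacobi : ∀ a b c,
    act bracket (MvPolynomial.X 0 : MvPolynomial (Fin 2) F) a
        (chg A (Polynomial.aeval (MvPolynomial.X 1)) (bracket b c)) =
      actLeft bracket (MvPolynomial.X 0 + MvPolynomial.X 1 : MvPolynomial (Fin 2) F) c
        (chg A (Polynomial.aeval (MvPolynomial.X 0)) (bracket a b)) +
      act bracket (MvPolynomial.X 1 : MvPolynomial (Fin 2) F) b
        (chg A (Polynomial.aeval (MvPolynomial.X 0)) (bracket a c))

/-- A module over a Lie conformal algebra. -/
structure LieConformalModule {F : Type u} [Field F] {A : Type v} [AddCommGroup A]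
    [Module F A] (𝒜 : LieConformalAlgebra F A) (M : Type w) [AddCommGroup M] [Module F M] where
  der : M →ₗ[F] M
  action : A →ₗ[F] M →ₗ[F] Polynomial F ⊗[F] M
  action_der_left : ∀ a m, action (𝒜.der a) m = -((Polynomial.X : Polynomial F) • action a m)
  action_der_right : ∀ a m, action a (der m) =
    der.baseChange (Polynomial F) (action a m) + (Polynomial.X : Polynomial F) • action a m
  /-- `a_λ (b_μ m) - b_μ (a_λ m) = [a_λ b]_{λ+μ} m` in `F[λ, μ] ⊗ M`. -/
  action_bracket : ∀ a b m,
    act action (MvPolynomial.X 0 : MvPolynomial (Fin 2) F) a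
        (chg M (Polynomial.aeval (MvPolynomial.X 1)) (action b m)) -
      act action (MvPolynomial.X 1 : MvPolynomial (Fin 2) F) b
        (chg M (Polynomial.aeval (MvPolynomial.X 0)) (action a m)) =
      actLeft action (MvPolynomial.X 0 + MvPolynomial.X 1 : MvPolynomial (Fin 2) F) m
        (chg A (Polynomial.aeval (MvPolynomial.X 0)) (𝒜.bracket a b))

/-- The adjoint module. -/
def LieConformalAlgebra.adjoint {F : Type u} [Field F] {A : Type v} [AddCommGroup A]
    [Module F A] (𝒜 : LieConformalAlgebra F A) : LieConformalModule 𝒜 A where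
  der := 𝒜.der
  action := 𝒜.bracket
  action_der_left := 𝒜.bracket_der_left
  action_der_right := 𝒜.bracket_der_right
  action_bracket a b m := by rw [𝒜.jacobi a b m]; abel

/-! ### Cochains -/

section Cochains

variable {F : Type u} [Field F] {A : Type v} [AddCommGroup A] [Module F A]
  {M : Type w} [AddCommGroup M] [Module F M]

/-- All `F`-multilinear maps `A^q → M[λ_1, …, λ_q]`. -/
abbrev RawCochain (F : Type u) [Field F] (A : Type v) [AddCommGroup A] [Module F A]
    (M : Type w) [AddCommGroup M] [Module F M] (q : ℕ) :=
  MultilinearMap F (fun _ : Fin q => A) (MvPolynomial (Fin q) F ⊗[F] M)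

instance instAddCommGroupRawCochain (q : ℕ) : AddCommGroup (RawCochain F A M q) := inferInstance

/-- The basic `q`-cochains: conformally antilinear and skew-symmetric maps. -/
def basicCochain {𝒜 : LieConformalAlgebra F A} (_ℳ : LieConformalModule 𝒜 M) (q : ℕ) :
    Submodule F (RawCochain F A M q) where
  carrier := {f |
    (∀ (a : Fin q → A) (i : Fin q),
      f (Function.update a i (𝒜.der (a i))) = -((MvPolynomial.X i : MvPolynomial (Fin q) F) • f a)) ∧
    (∀ (σ : Equiv.Perm (Fin q)) (a : Fin q → A),
      chg M (MvPolynomial.rename σ) (f (a ∘ σ)) = ((Equiv.Perm.sign σ : ℤ) : F) • f a)}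
  add_mem' := by
    rintro f g ⟨hf, hf'⟩ ⟨hg, hg'⟩
    exact ⟨fun a i => by simp [hf, hg]; abel, fun σ a => by simp [hf', hg']⟩
  zero_mem' := ⟨fun a i => by simp, fun σ a => by simp⟩
  smul_mem' := by
    rintro c f ⟨hf, hf'⟩
    exact ⟨fun a i => by simp [hf, smul_comm c], fun σ a => by simp [hf', smul_comm c]⟩

/-- `∂ + λ_1 + … + λ_q` on `M[λ_1, …, λ_q]`. -/
def totalDer (D : M →ₗ[F] M) (q : ℕ) :
    MvPolynomial (Fin q) F ⊗[F] M →ₗ[MvPolynomial (Fin q) F] MvPolynomial (Fin q) F ⊗[F] M :=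
  D.baseChange (MvPolynomial (Fin q) F) + (∑ k, MvPolynomial.X k : MvPolynomial (Fin q) F) • 1

/-- `(∂ f)(a) = (∂ + λ_1 + … + λ_q) f(a)`. -/
def rawDer (D : M →ₗ[F] M) (q : ℕ) : RawCochain F A M q →ₗ[F] RawCochain F A M q where
  toFun f := ((totalDer D q).restrictScalars F).compMultilinearMap f
  map_add' f g := by ext; simp
  map_smul' c f := by ext; simp

/-- The map `(a_1, …, a_{q+1}) ↦ a_{k λ_k} f_{λ_1, …, λ̂_k, …, λ_{q+1}}(a_1, …, â_k, …, a_{q+1})`. -/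
def rawD₁Term (β : A →ₗ[F] M →ₗ[F] Polynomial F ⊗[F] M) (q : ℕ) (k : Fin (q + 1)) :
    RawCochain F A M q →ₗ[F] RawCochain F A M (q + 1) where
  toFun f := LinearMap.uncurryMid k
    { toFun := fun a =>
        (((act β (MvPolynomial.X k : MvPolynomial (Fin (q + 1)) F) a).restrictScalars F) ∘ₗ
          chg M (MvPolynomial.rename k.succAbove)).compMultilinearMap f
      map_add' := fun a b => by ext; simp [act_add]
      map_smul' := fun c a => by ext; simp [act_smul] }
  map_add' f g := by ext; simp
  map_smul' c f := by ext; simp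

/-- The first sum of the differential:
`∑_k (-1)^{k+1} a_{k λ_k} f_{λ_1, …, λ̂_k, …, λ_{q+1}}(a_1, …, â_k, …, a_{q+1})`
(see `rawD₁_apply`; indices are counted from `0` in the code). -/
def rawD₁ (β : A →ₗ[F] M →ₗ[F] Polynomial F ⊗[F] M) (q : ℕ) :
    RawCochain F A M q →ₗ[F] RawCochain F A M (q + 1) :=
  ∑ k : Fin (q + 1), (-1 : F) ^ (k : ℕ) • rawD₁Term β q k

theorem rawD₁_apply (β : A →ₗ[F] M →ₗ[F] Polynomial F ⊗[F] M) (q : ℕ) (f : RawCochain F A M q)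
    (a : Fin (q + 1) → A) :
    rawD₁ β q f a = ∑ k : Fin (q + 1), (-1 : F) ^ (k : ℕ) •
      act β (MvPolynomial.X k : MvPolynomial (Fin (q + 1)) F) (a k)
        (chg M (MvPolynomial.rename k.succAbove) (f (fun i => a (k.succAbove i)))) := by
  simp only [rawD₁, LinearMap.sum_apply, sum_apply]
  rfl

/-- For `c ∈ A` and the pair of positions `k`, `l = k.succAbove j`, the value
`f_{λ_k + λ_l, λ_1, …, λ̂_k, …, λ̂_l, …}(c, a)`, where `a` is the tuple without its entries at
`k` and `l`. -/
def insertFirst (q : ℕ) (k : Fin (q + 2)) (j : Fin (q + 1)) (f : RawCochain F A M (q + 1))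
    (a : Fin q → A) : A →ₗ[F] MvPolynomial (Fin (q + 2)) F ⊗[F] M :=
  chg M (MvPolynomial.aeval (Fin.cons (MvPolynomial.X k + MvPolynomial.X (k.succAbove j))
      (fun i => MvPolynomial.X (k.succAbove (j.succAbove i))) :
        Fin (q + 1) → MvPolynomial (Fin (q + 2)) F)) ∘ₗ
    { toFun := fun c => f (Fin.cons c a)
      map_add' := fun c d => f.cons_add a c d
      map_smul' := fun r c => f.cons_smul a r c }

/-- `f_{λ_k + λ_l, λ_1, …, λ̂_k, …, λ̂_l, …}(u, a)`, extended `F[λ_1, …, λ_{q+2}]`-linearly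
to `u ∈ A[λ_1, …, λ_{q+2}]`. -/
def insertBracket (q : ℕ) (k : Fin (q + 2)) (j : Fin (q + 1)) (f : RawCochain F A M (q + 1))
    (u : MvPolynomial (Fin (q + 2)) F ⊗[F] A) :
    MultilinearMap F (fun _ : Fin q => A) (MvPolynomial (Fin (q + 2)) F ⊗[F] M) where
  toFun a := (insertFirst q k j f a).liftBaseChange (MvPolynomial (Fin (q + 2)) F) u
  map_update_add' := by
    intro inst a t x y
    obtain rfl := Subsingleton.elim inst (instDecidableEqFin q)
    have h (c z : A) : (Fin.cons c (Function.update a t z) : Fin (q + 1) → A) =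
      Function.update (Fin.cons c a) t.succ z := Fin.cons_update (α := fun _ => A) c a t z
    induction u with
    | zero => simp
    | tmul p c => simp [insertFirst, h]
    | add u v hu hv => rw [map_add, hu, hv, map_add, map_add]; abel
  map_update_smul' := by
    intro inst a t r x
    obtain rfl := Subsingleton.elim inst (instDecidableEqFin q)
    have h (c z : A) : (Fin.cons c (Function.update a t z) : Fin (q + 1) → A) =
      Function.update (Fin.cons c a) t.succ z := Fin.cons_update (α := fun _ => A) c a t z
    induction u with
    | zero => simp
    | tmul p c => simp [insertFirst, h, smul_comm r]
    | add u v hu hv => rw [map_add, hu, hv, map_add, smul_add]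

theorem insertBracket_apply (q : ℕ) (k : Fin (q + 2)) (j : Fin (q + 1))
    (f : RawCochain F A M (q + 1)) (u : MvPolynomial (Fin (q + 2)) F ⊗[F] A) (a : Fin q → A) :
    insertBracket q k j f u a =
      (insertFirst q k j f a).liftBaseChange (MvPolynomial (Fin (q + 2)) F) u := rfl

/-- The map
`(a_1, …, a_{q+2}) ↦ f_{λ_k + λ_l, λ_1, …, λ̂_k, …, λ̂_l, …}([a_{k λ_k} a_l], a_1, …, â_k, …, â_l, …)`
for `l = k.succAbove j`. -/
def rawD₂Term (γ : A →ₗ[F] A →ₗ[F] Polynomial F ⊗[F] A) (q : ℕ) (k : Fin (q + 2))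
    (j : Fin (q + 1)) : RawCochain F A M (q + 1) →ₗ[F] RawCochain F A M (q + 2) where
  toFun f := LinearMap.uncurryMid k
    { toFun := fun a => LinearMap.uncurryMid j
        { toFun := fun b => insertBracket q k j f
            (chg A (Polynomial.aeval (MvPolynomial.X k)) (γ a b))
          map_add' := fun b c => by ext; simp [insertBracket_apply]
          map_smul' := fun r b => by
            ext; simp [insertBracket_apply, LinearMap.map_smul_of_tower] }
      map_add' := fun b c => by ext; simp [insertBracket_apply]
      map_smul' := fun r b => by ext; simp [insertBracket_apply, LinearMap.map_smul_of_tower] }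
  map_add' f g := by
    ext a
    simp only [LinearMap.uncurryMid_apply, LinearMap.coe_mk, AddHom.coe_mk,
      add_apply, insertBracket_apply]
    generalize chg A (Polynomial.aeval (MvPolynomial.X k : MvPolynomial (Fin (q + 2)) F)) (γ (a k) (k.removeNth a j)) = u
    induction u with
    | zero => simp
    | tmul p c => simp [insertFirst]
    | add u v hu hv => rw [map_add, hu, hv, map_add, map_add]; abel
  map_smul' r f := by
    ext a
    simp only [LinearMap.uncurryMid_apply, LinearMap.coe_mk, AddHom.coe_mk,
      smul_apply, insertBracket_apply, RingHom.id_apply]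
    generalize chg A (Polynomial.aeval (MvPolynomial.X k : MvPolynomial (Fin (q + 2)) F)) (γ (a k) (k.removeNth a j)) = u
    induction u with
    | zero => simp
    | tmul p c => simp [insertFirst, smul_comm r]
    | add u v hu hv => rw [map_add, hu, hv, map_add, smul_add]

theorem rawD₂Term_apply (γ : A →ₗ[F] A →ₗ[F] Polynomial F ⊗[F] A) (q : ℕ) (k : Fin (q + 2))
    (j : Fin (q + 1)) (f : RawCochain F A M (q + 1)) (a : Fin (q + 2) → A) :
    rawD₂Term γ q k j f a =
      (insertFirst q k j f (fun t => a (k.succAbove (j.succAbove t)))).liftBaseChange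
        (MvPolynomial (Fin (q + 2)) F)
        (chg A (Polynomial.aeval (MvPolynomial.X k)) (γ (a k) (a (k.succAbove j)))) := rfl

/-- The second sum of the differential:
`∑_{k<l} (-1)^{k+l} f_{λ_k + λ_l, λ_1, …, λ̂_k, …, λ̂_l, …}([a_{k λ_k} a_l], a_1, …, â_k, …, â_l, …)`
(see `rawD₂Term_apply`). The pairs `k < l` are parametrized by `i ≤ j` through `k = i.castSucc`,
`l = j.succ = k.succAbove j`. -/
def rawD₂ (γ : A →ₗ[F] A →ₗ[F] Polynomial F ⊗[F] A) (q : ℕ) :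
    RawCochain F A M (q + 1) →ₗ[F] RawCochain F A M (q + 2) :=
  ∑ i : Fin (q + 1), ∑ j ∈ Finset.Ici i,
    (-1 : F) ^ ((i.castSucc : ℕ) + (j.succ : ℕ)) • rawD₂Term γ q i.castSucc j

/-- The differential on all multilinear maps. -/
def rawD {𝒜 : LieConformalAlgebra F A} (ℳ : LieConformalModule 𝒜 M) :
    (q : ℕ) → RawCochain F A M q →ₗ[F] RawCochain F A M (q + 1)
  | 0 => rawD₁ ℳ.action 0
  | q + 1 => rawD₁ ℳ.action (q + 1) + rawD₂ 𝒜.bracket q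

/-! ### The differential preserves cochains and commutes with `∂` -/

section Sesquilinearity

variable {R S : Type*} [CommRing R] [Algebra F R] [CommRing S] [Algebra F S]

theorem chg_act (β : A →ₗ[F] M →ₗ[F] Polynomial F ⊗[F] M) (φ : R →ₐ[F] S) (t : R) (a : A)
    (v : R ⊗[F] M) : chg M φ (act β t a v) = act β (φ t) a (chg M φ v) := by
  induction v with
  | zero => simp
  | tmul x y =>
    have : (Polynomial.aeval (φ t) : Polynomial F →ₐ[F] S) = φ.comp (Polynomial.aeval t) := by
      ext; simp
    simp [act, chg_smul, chg_chg, this]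
  | add x y hx hy => simp [hx, hy]

theorem act_baseChange {β : A →ₗ[F] M →ₗ[F] Polynomial F ⊗[F] M} {D : M →ₗ[F] M}
    (hβ : ∀ a m, β a (D m) =
      D.baseChange (Polynomial F) (β a m) + (Polynomial.X : Polynomial F) • β a m)
    (t : R) (a : A) (v : R ⊗[F] M) :
    act β t a (D.baseChange R v) = D.baseChange R (act β t a v) + t • act β t a v := by
  induction v with
  | zero => simp
  | tmul x y => simp [act, hβ, chg_smul, chg_baseChange, smul_comm x]
  | add x y hx hy => simp only [map_add, hx, hy, smul_add]; abel

theorem act_der_left {β : A →ₗ[F] M →ₗ[F] Polynomial F ⊗[F] M} {D : A →ₗ[F] A}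
    (hβ : ∀ a m, β (D a) m = -((Polynomial.X : Polynomial F) • β a m))
    (t : R) (a : A) (v : R ⊗[F] M) : act β t (D a) v = -(t • act β t a v) := by
  induction v with
  | zero => simp
  | tmul x y => simp [act, hβ, chg_smul, smul_comm x]
  | add x y hx hy => rw [map_add, hx, hy, map_add, smul_add]; abel

theorem liftBaseChange_baseChange {N : Type*} [AddCommGroup N] [Module F N] [Module R N]
    [IsScalarTower F R N] (g : A →ₗ[F] N) (D : A →ₗ[F] A) (s : R)
    (hg : ∀ c, g (D c) = -(s • g c)) (u : R ⊗[F] A) :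
    g.liftBaseChange R (D.baseChange R u) = -(s • g.liftBaseChange R u) := by
  induction u with
  | zero => simp
  | tmul x y => simp [hg, smul_comm x]
  | add x y hx hy => rw [map_add, map_add, hx, hy, map_add, smul_add]; abel

/-- Substituting `λ = t` after `λ ↦ -λ - ∂`, when `∂` acts as `-s`, is substituting `λ = s - t`. -/
theorem liftBaseChange_skewSubst {N : Type*} [AddCommGroup N] [Module F N] [Module R N]
    [IsScalarTower F R N] (g : A →ₗ[F] N) (D : A →ₗ[F] A) (s t : R)
    (hg : ∀ c, g (D c) = -(s • g c)) (v : Polynomial F ⊗[F] A) :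
    g.liftBaseChange R (chg A (Polynomial.aeval t) (skewSubst D v)) =
      g.liftBaseChange R (chg A (Polynomial.aeval (s - t)) v) := by
  induction v with
  | zero => simp
  | add x y hx hy => simp only [map_add, hx, hy]
  | tmul p a =>
    simp only [skewSubst, TensorProduct.lift.tmul, LinearMap.mk₂_apply, chg_tmul,
      LinearMap.liftBaseChange_tmul]
    set T : Module.End (Polynomial F) (Polynomial F ⊗[F] A) :=
      -((Polynomial.X : Polynomial F) • 1) - D.baseChange (Polynomial F) with hT
    have key (w : Polynomial F ⊗[F] A) : g.liftBaseChange R (chg A (Polynomial.aeval t) (T w)) =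
        (s - t) • g.liftBaseChange R (chg A (Polynomial.aeval t) w) := by
      simp only [hT, LinearMap.sub_apply, LinearMap.neg_apply, LinearMap.smul_apply, map_sub,
        map_neg, chg_smul, chg_baseChange, map_smul, Polynomial.aeval_X, Module.End.one_apply,
        liftBaseChange_baseChange g D s hg, sub_smul]
      abel
    induction p using Polynomial.induction_on' with
    | add p q hp hq => simp only [map_add, LinearMap.add_apply, hp, hq, add_smul]
    | monomial n r =>
      have : ∀ n : ℕ, g.liftBaseChange R (chg A (Polynomial.aeval t) ((T ^ n) (1 ⊗ₜ[F] a))) =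
          (s - t) ^ n • g a := by
        intro n
        induction n with
        | zero => simp
        | succ n ih => rw [pow_succ', Module.End.mul_apply, key, ih, pow_succ', mul_smul]
      rw [Polynomial.aeval_monomial, Polynomial.aeval_monomial, Module.End.mul_apply,
        Module.algebraMap_end_apply, map_smul, LinearMap.map_smul_of_tower, this, mul_smul,
        algebraMap_smul]

end Sesquilinearity

theorem rawDer_apply (D : M →ₗ[F] M) (q : ℕ) (f : RawCochain F A M q) (a : Fin q → A) :
    rawDer D q f a = totalDer D q (f a) := rfl

theorem totalDer_apply (D : M →ₗ[F] M) (q : ℕ) (v : MvPolynomial (Fin q) F ⊗[F] M) :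
    totalDer D q v = D.baseChange (MvPolynomial (Fin q) F) v +
      (∑ k, MvPolynomial.X k : MvPolynomial (Fin q) F) • v := rfl

theorem rawD₁_rawDer {β : A →ₗ[F] M →ₗ[F] Polynomial F ⊗[F] M} {D : M →ₗ[F] M}
    (hβ : ∀ a m, β a (D m) =
      D.baseChange (Polynomial F) (β a m) + (Polynomial.X : Polynomial F) • β a m)
    (q : ℕ) (f : RawCochain F A M q) :
    rawD₁ β q (rawDer D q f) = rawDer D (q + 1) (rawD₁ β q f) := by
  ext a
  rw [rawDer_apply, rawD₁_apply, rawD₁_apply, map_sum]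
  refine Finset.sum_congr rfl fun k _ => ?_
  rw [LinearMap.map_smul_of_tower, rawDer_apply, totalDer_apply, totalDer_apply, map_add,
    chg_baseChange, chg_smul, map_add, act_baseChange hβ, map_smul, map_sum,
    Fin.sum_univ_succAbove _ k]
  simp only [MvPolynomial.rename_X, add_smul, add_assoc]

theorem rawD₂_rawDer (γ : A →ₗ[F] A →ₗ[F] Polynomial F ⊗[F] A) (D : M →ₗ[F] M)
    (q : ℕ) (f : RawCochain F A M (q + 1)) :
    rawD₂ γ q (rawDer D (q + 1) f) = rawDer D (q + 2) (rawD₂ γ q f) := by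
  simp only [rawD₂, LinearMap.sum_apply, map_sum, LinearMap.smul_apply, map_smul]
  refine Finset.sum_congr rfl fun i _ => Finset.sum_congr rfl fun j _ => ?_
  congr 1
  ext a
  rw [rawDer_apply, rawD₂Term_apply, rawD₂Term_apply]
  generalize chg A (Polynomial.aeval (MvPolynomial.X i.castSucc : MvPolynomial (Fin (q + 2)) F))
    (γ (a i.castSucc) (a (i.castSucc.succAbove j))) = u
  induction u with
  | zero => simp
  | add x y hx hy => simp only [map_add, hx, hy]
  | tmul p c =>
    simp only [LinearMap.liftBaseChange_tmul, map_smul]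
    congr 1
    simp only [insertFirst, LinearMap.comp_apply, LinearMap.coe_mk, AddHom.coe_mk, rawDer_apply,
      totalDer_apply, map_add, chg_baseChange, chg_smul, map_sum, MvPolynomial.aeval_X]
    rw [Fin.sum_univ_succ, Fin.sum_univ_succAbove _ i.castSucc, Fin.sum_univ_succAbove _ j]
    simp only [Fin.cons_zero, Fin.cons_succ, add_assoc]

theorem rawD_rawDer {𝒜 : LieConformalAlgebra F A} (ℳ : LieConformalModule 𝒜 M) (q : ℕ)
    (f : RawCochain F A M q) : rawD ℳ q (rawDer ℳ.der q f) = rawDer ℳ.der (q + 1) (rawD ℳ q f) := by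
  cases q with
  | zero => exact rawD₁_rawDer ℳ.action_der_right 0 f
  | succ q =>
    simp only [rawD, LinearMap.add_apply, map_add]
    rw [rawD₁_rawDer ℳ.action_der_right, rawD₂_rawDer]

/-! Conformal antilinearity. -/

theorem rawD₁_antilinear {β : A →ₗ[F] M →ₗ[F] Polynomial F ⊗[F] M} {D : A →ₗ[F] A}
    (hβ : ∀ a m, β (D a) m = -((Polynomial.X : Polynomial F) • β a m))
    (q : ℕ) (f : RawCochain F A M q)
    (hf : ∀ (a : Fin q → A) (i : Fin q), f (Function.update a i (D (a i))) =
      -((MvPolynomial.X i : MvPolynomial (Fin q) F) • f a))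
    (a : Fin (q + 1) → A) (i : Fin (q + 1)) :
    rawD₁ β q f (Function.update a i (D (a i))) =
      -((MvPolynomial.X i : MvPolynomial (Fin (q + 1)) F) • rawD₁ β q f a) := by
  rw [rawD₁_apply, rawD₁_apply, Finset.smul_sum, ← Finset.sum_neg_distrib]
  refine Finset.sum_congr rfl fun k _ => ?_
  rw [smul_comm (MvPolynomial.X i : MvPolynomial (Fin (q + 1)) F)]
  refine Eq.trans ?_ (smul_neg _ _)
  congr 1
  rcases Fin.eq_self_or_eq_succAbove k i with rfl | ⟨j, rfl⟩
  · rw [Function.update_self, act_der_left hβ]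
    simp [Function.update_of_ne, Fin.succAbove_ne]
  · have h : (fun t => Function.update a (k.succAbove j) (D (a (k.succAbove j))) (k.succAbove t)) =
        Function.update (fun t => a (k.succAbove t)) j (D (a (k.succAbove j))) := by
      ext t
      by_cases ht : t = j
      · subst ht; simp
      · rw [Function.update_of_ne ht, Function.update_of_ne]
        exact fun h => ht (Fin.succAbove_right_injective h)
    rw [h, Function.update_of_ne (Fin.succAbove_ne k j).symm,
      hf (fun t => a (k.succAbove t)) j, map_neg, chg_smul, map_neg, map_smul, MvPolynomial.rename_X]

theorem insertFirst_apply (q : ℕ) (k : Fin (q + 2)) (j : Fin (q + 1)) (f : RawCochain F A M (q + 1))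
    (a : Fin q → A) (c : A) : insertFirst q k j f a c =
      chg M (MvPolynomial.aeval (Fin.cons (MvPolynomial.X k + MvPolynomial.X (k.succAbove j))
        (fun i => MvPolynomial.X (k.succAbove (j.succAbove i))) :
          Fin (q + 1) → MvPolynomial (Fin (q + 2)) F)) (f (Fin.cons c a)) := rfl

theorem insertFirst_der {D : A →ₗ[F] A} (q : ℕ) (k : Fin (q + 2)) (j : Fin (q + 1))
    (f : RawCochain F A M (q + 1))
    (hf : ∀ (a : Fin (q + 1) → A) (i : Fin (q + 1)), f (Function.update a i (D (a i))) =
      -((MvPolynomial.X i : MvPolynomial (Fin (q + 1)) F) • f a)) (a : Fin q → A) (c : A) :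
    insertFirst q k j f a (D c) =
      -((MvPolynomial.X k + MvPolynomial.X (k.succAbove j) : MvPolynomial (Fin (q + 2)) F) •
        insertFirst q k j f a c) := by
  have := hf (Fin.cons c a) 0
  rw [Fin.cons_zero, Fin.update_cons_zero] at this
  rw [insertFirst_apply, this, map_neg, chg_smul, MvPolynomial.aeval_X, Fin.cons_zero]
  rfl

theorem rawD₂Term_antilinear (𝒜 : LieConformalAlgebra F A) (q : ℕ) (f : RawCochain F A M (q + 1))
    (hf : ∀ (a : Fin (q + 1) → A) (i : Fin (q + 1)), f (Function.update a i (𝒜.der (a i))) =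
      -((MvPolynomial.X i : MvPolynomial (Fin (q + 1)) F) • f a))
    (k : Fin (q + 2)) (j : Fin (q + 1)) (a : Fin (q + 2) → A) (i : Fin (q + 2)) :
    rawD₂Term 𝒜.bracket q k j f (Function.update a i (𝒜.der (a i))) =
      -((MvPolynomial.X i : MvPolynomial (Fin (q + 2)) F) • rawD₂Term 𝒜.bracket q k j f a) := by
  rw [rawD₂Term_apply, rawD₂Term_apply]
  rcases Fin.eq_self_or_eq_succAbove k i with rfl | ⟨i, rfl⟩
  · have h (t : Fin (q + 1)) : Function.update a i (𝒜.der (a i)) (i.succAbove t) =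
        a (i.succAbove t) := Function.update_of_ne (Fin.succAbove_ne i t) _ _
    simp only [h, Function.update_self, 𝒜.bracket_der_left, map_neg, chg_smul, map_smul,
      Polynomial.aeval_X]
  · have h0 : Function.update a (k.succAbove i) (𝒜.der (a (k.succAbove i))) k = a k :=
      Function.update_of_ne (Fin.succAbove_ne k i).symm _ _
    have h (t : Fin (q + 1)) : Function.update a (k.succAbove i) (𝒜.der (a (k.succAbove i)))
        (k.succAbove t) = Function.update (fun t => a (k.succAbove t)) i
          (𝒜.der (a (k.succAbove i))) t := by
      by_cases ht : t = i
      · subst ht; simp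
      · rw [Function.update_of_ne ht, Function.update_of_ne]
        exact fun h => ht (Fin.succAbove_right_injective h)
    simp only [h0, h]
    rcases Fin.eq_self_or_eq_succAbove j i with rfl | ⟨i, rfl⟩
    · have h' (t : Fin q) : Function.update (fun t => a (k.succAbove t)) i
          (𝒜.der (a (k.succAbove i))) (i.succAbove t) =
          a (k.succAbove (i.succAbove t)) := Function.update_of_ne (Fin.succAbove_ne i t) _ _
      simp only [h', Function.update_self, 𝒜.bracket_der_right, map_add, chg_smul, chg_baseChange,
        map_smul, Polynomial.aeval_X]
      rw [liftBaseChange_baseChange _ _ _ (insertFirst_der q k i f hf _), add_smul]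
      abel
    · have h0' : Function.update (fun t => a (k.succAbove t)) (j.succAbove i)
          (𝒜.der (a (k.succAbove (j.succAbove i)))) j = a (k.succAbove j) :=
        Function.update_of_ne (Fin.succAbove_ne j i).symm _ _
      have h' : (fun t => Function.update (fun t => a (k.succAbove t)) (j.succAbove i)
          (𝒜.der (a (k.succAbove (j.succAbove i)))) (j.succAbove t)) =
          Function.update (fun t => a (k.succAbove (j.succAbove t))) i
            (𝒜.der (a (k.succAbove (j.succAbove i)))) := by
        ext t
        by_cases ht : t = i
        · subst ht; simp
        · rw [Function.update_of_ne ht, Function.update_of_ne]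
          exact fun h => ht (Fin.succAbove_right_injective h)
      simp only [h0', h']
      generalize chg A (Polynomial.aeval (MvPolynomial.X k : MvPolynomial (Fin (q + 2)) F))
        (𝒜.bracket (a k) (a (k.succAbove j))) = u
      induction u with
      | zero => simp
      | add x y hx hy => rw [map_add, hx, hy, map_add, smul_add]; abel
      | tmul p c =>
        simp only [LinearMap.liftBaseChange_tmul, insertFirst_apply]
        have := hf (Fin.cons c (fun t => a (k.succAbove (j.succAbove t)))) i.succ
        rw [Fin.cons_succ, ← Fin.cons_update] at this
        rw [this, map_neg, chg_smul, MvPolynomial.aeval_X, Fin.cons_succ, smul_neg, smul_comm p]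

/-! Skew-symmetry. -/

/-- The action of a permutation on functions of `(λ_1, a_1), …, (λ_n, a_n)`. -/
def permAct (F : Type u) [Field F] (A : Type v) (M : Type w) [AddCommGroup M] [Module F M] (n : ℕ) :
    Equiv.Perm (Fin n) →* Module.End F ((Fin n → A) → MvPolynomial (Fin n) F ⊗[F] M) where
  toFun σ :=
    { toFun := fun g a => chg M (MvPolynomial.rename σ) (g (a ∘ σ))
      map_add' := fun g h => by ext; simp
      map_smul' := fun c g => by ext; simp }
  map_one' := by
    ext g a
    have : (MvPolynomial.rename (id : Fin n → Fin n) :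
        MvPolynomial (Fin n) F →ₐ[F] MvPolynomial (Fin n) F) = AlgHom.id F _ := by
      ext; simp
    simp [chg, this]
  map_mul' σ τ := by
    ext g a
    have : (MvPolynomial.rename (⇑σ ∘ ⇑τ) :
        MvPolynomial (Fin n) F →ₐ[F] MvPolynomial (Fin n) F) =
        (MvPolynomial.rename σ).comp (MvPolynomial.rename τ) := by
      ext; simp
    simp [chg_chg, this, Function.comp_assoc]

set_option linter.unusedSectionVars false in
theorem permAct_apply (n : ℕ) (σ : Equiv.Perm (Fin n))
    (g : (Fin n → A) → MvPolynomial (Fin n) F ⊗[F] M) (a : Fin n → A) :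
    permAct F A M n σ g a = chg M (MvPolynomial.rename σ) (g (a ∘ σ)) := rfl

/-- The permutations of `Fin (n + 1)` fixing `0`. -/
def succPerm (n : ℕ) : Equiv.Perm (Fin n) →* Equiv.Perm (Fin (n + 1)) where
  toFun ρ := Equiv.Perm.decomposeFin.symm (0, ρ)
  map_one' := Equiv.ext fun i => by cases i using Fin.cases <;> simp
  map_mul' σ τ := by
    ext i
    cases i using Fin.cases <;> simp

theorem succPerm_zero {n : ℕ} (ρ : Equiv.Perm (Fin n)) : succPerm n ρ 0 = 0 := by
  simp [succPerm]

theorem succPerm_succ {n : ℕ} (ρ : Equiv.Perm (Fin n)) (i : Fin n) :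
    succPerm n ρ i.succ = (ρ i).succ := by
  simp [succPerm]

theorem sign_succPerm {n : ℕ} (ρ : Equiv.Perm (Fin n)) :
    Equiv.Perm.sign (succPerm n ρ) = Equiv.Perm.sign ρ := by
  simp [succPerm]

theorem exists_succPerm {n : ℕ} (σ : Equiv.Perm (Fin (n + 1))) (h : σ 0 = 0) :
    ∃ ρ, σ = succPerm n ρ := by
  obtain ⟨⟨p, ρ⟩, rfl⟩ := Equiv.Perm.decomposeFin.symm.surjective σ
  rw [Equiv.Perm.decomposeFin_symm_apply_zero] at h
  subst h
  exact ⟨ρ, rfl⟩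

/-- Antisymmetrization over coset representatives. -/
theorem sum_cycleRange_skew {X : Type*} [AddCommGroup X] [Module F X] {n : ℕ}
    (φ : Equiv.Perm (Fin (n + 1)) →* Module.End F X) (x : X)
    (hx : ∀ ρ : Equiv.Perm (Fin n), φ (succPerm n ρ) x = ((Equiv.Perm.sign ρ : ℤ) : F) • x)
    (σ : Equiv.Perm (Fin (n + 1))) :
    φ σ (∑ k : Fin (n + 1), (-1 : F) ^ (k : ℕ) • φ k.cycleRange⁻¹ x) =
      ((Equiv.Perm.sign σ : ℤ) : F) •
        ∑ k : Fin (n + 1), (-1 : F) ^ (k : ℕ) • φ k.cycleRange⁻¹ x := by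
  rw [map_sum, Finset.smul_sum,
    ← Equiv.sum_comp σ (fun k => ((Equiv.Perm.sign σ : ℤ) : F) • (-1 : F) ^ (k : ℕ) • _)]
  refine Finset.sum_congr rfl fun k _ => ?_
  have hs (k : Fin (n + 1)) : (-1 : F) ^ (k : ℕ) = ((Equiv.Perm.sign k.cycleRange : ℤ) : F) := by
    simp [Fin.sign_cycleRange]
  obtain ⟨ρ, hρ⟩ := exists_succPerm ((σ k).cycleRange * σ * k.cycleRange⁻¹)
    (by simp [Equiv.Perm.mul_apply, Equiv.Perm.inv_def])
  have h1 : σ * k.cycleRange⁻¹ = (σ k).cycleRange⁻¹ * succPerm n ρ := by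
    rw [← hρ]; group
  have h2 : (Equiv.Perm.sign k.cycleRange : ℤ) * (Equiv.Perm.sign ρ : ℤ) =
      (Equiv.Perm.sign σ : ℤ) * (Equiv.Perm.sign (σ k).cycleRange : ℤ) := by
    rw [← sign_succPerm ρ, ← hρ, ← Units.val_mul, ← Units.val_mul]
    congr 1
    simp only [map_mul, map_inv]
    rcases Int.units_eq_one_or (Equiv.Perm.sign k.cycleRange) with h | h <;>
    rcases Int.units_eq_one_or (Equiv.Perm.sign σ) with h' | h' <;>
    rcases Int.units_eq_one_or (Equiv.Perm.sign (σ k).cycleRange) with h'' | h'' <;>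
    simp [h, h', h'']
  rw [map_smul, ← Module.End.mul_apply, ← map_mul, h1, map_mul, Module.End.mul_apply, hx, map_smul,
    smul_smul, smul_smul, hs, hs, ← Int.cast_mul, ← Int.cast_mul, h2]

/-- One summand of the first sum of the differential, for an index `x` and a tuple `r` of indices. -/
def singleTerm (β : A →ₗ[F] M →ₗ[F] Polynomial F ⊗[F] M) {q : ℕ} (f : RawCochain F A M q)
    {n : ℕ} (x : Fin n) (r : Fin q → Fin n) (a : Fin n → A) : MvPolynomial (Fin n) F ⊗[F] M :=
  act β (MvPolynomial.X x : MvPolynomial (Fin n) F) (a x) (chg M (MvPolynomial.rename r) (f (a ∘ r)))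

theorem permAct_singleTerm (β : A →ₗ[F] M →ₗ[F] Polynomial F ⊗[F] M) {q : ℕ} (f : RawCochain F A M q)
    {n : ℕ} (x : Fin n) (r : Fin q → Fin n) (σ : Equiv.Perm (Fin n)) :
    permAct F A M n σ (singleTerm β f x r) = singleTerm β f (σ x) (σ ∘ r) := by
  ext a
  have : (MvPolynomial.rename (⇑σ ∘ r) : MvPolynomial (Fin q) F →ₐ[F] MvPolynomial (Fin n) F) =
      (MvPolynomial.rename σ).comp (MvPolynomial.rename r) := by
    ext; simp
  simp [permAct_apply, singleTerm, chg_act, chg_chg, this, Function.comp_assoc]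

theorem rawD₁_skew (β : A →ₗ[F] M →ₗ[F] Polynomial F ⊗[F] M) {q : ℕ} (f : RawCochain F A M q)
    (hf : ∀ (σ : Equiv.Perm (Fin q)) (a : Fin q → A),
      chg M (MvPolynomial.rename σ) (f (a ∘ σ)) = ((Equiv.Perm.sign σ : ℤ) : F) • f a)
    (σ : Equiv.Perm (Fin (q + 1))) (a : Fin (q + 1) → A) :
    chg M (MvPolynomial.rename σ) (rawD₁ β q f (a ∘ σ)) =
      ((Equiv.Perm.sign σ : ℤ) : F) • rawD₁ β q f a := by
  have key := sum_cycleRange_skew (permAct F A M (q + 1)) (singleTerm β f 0 Fin.succ) (by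
    intro ρ
    ext a
    have : ⇑(succPerm q ρ) ∘ Fin.succ = Fin.succ ∘ ρ := by
      ext i; simp [succPerm_succ]
    have h2 : (MvPolynomial.rename (Fin.succ ∘ ρ) :
        MvPolynomial (Fin q) F →ₐ[F] MvPolynomial (Fin (q + 1)) F) =
        (MvPolynomial.rename Fin.succ).comp (MvPolynomial.rename ρ) := by
      ext; simp
    rw [permAct_singleTerm, succPerm_zero, this, Pi.smul_apply, singleTerm, h2, ← chg_chg,
      ← Function.comp_assoc, hf, map_smul, LinearMap.map_smul_of_tower]
    rfl) σ
  have h1 (b : Fin (q + 1) → A) : rawD₁ β q f b = (∑ k : Fin (q + 1), (-1 : F) ^ (k : ℕ) •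
      permAct F A M (q + 1) k.cycleRange⁻¹ (singleTerm β f 0 Fin.succ)) b := by
    rw [rawD₁_apply, Finset.sum_apply]
    refine Finset.sum_congr rfl fun k _ => ?_
    have : ⇑(k.cycleRange⁻¹) ∘ Fin.succ = k.succAbove := by
      ext i; simp [Equiv.Perm.inv_def]
    have h0 : k.cycleRange⁻¹ 0 = k := by simp [Equiv.Perm.inv_def]
    rw [permAct_singleTerm, this, h0]
    rfl
  rw [h1, h1]
  exact congrFun key a

/-- One summand of the second sum of the differential, for indices `x`, `y` and a tuple `r` of
indices. -/
def pairTerm (γ : A →ₗ[F] A →ₗ[F] Polynomial F ⊗[F] A) {q : ℕ} (f : RawCochain F A M (q + 1))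
    {n : ℕ} (x y : Fin n) (r : Fin q → Fin n) (a : Fin n → A) : MvPolynomial (Fin n) F ⊗[F] M :=
  LinearMap.liftBaseChange (MvPolynomial (Fin n) F)
    (chg M (MvPolynomial.aeval (Fin.cons (MvPolynomial.X x + MvPolynomial.X y)
      (fun i => MvPolynomial.X (r i)) : Fin (q + 1) → MvPolynomial (Fin n) F)) ∘ₗ
    { toFun := fun c => f (Fin.cons c (a ∘ r))
      map_add' := fun c d => f.cons_add _ c d
      map_smul' := fun s c => f.cons_smul _ s c })
    (chg A (Polynomial.aeval (MvPolynomial.X x)) (γ (a x) (a y)))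

theorem permAct_pairTerm (γ : A →ₗ[F] A →ₗ[F] Polynomial F ⊗[F] A) {q : ℕ}
    (f : RawCochain F A M (q + 1)) {n : ℕ} (x y : Fin n) (r : Fin q → Fin n)
    (σ : Equiv.Perm (Fin n)) :
    permAct F A M n σ (pairTerm γ f x y r) = pairTerm γ f (σ x) (σ y) (σ ∘ r) := by
  ext a
  have h1 : (MvPolynomial.aeval (Fin.cons (MvPolynomial.X (σ x) + MvPolynomial.X (σ y))
      (fun i => MvPolynomial.X (σ (r i))) : Fin (q + 1) → MvPolynomial (Fin n) F)) =
      (MvPolynomial.rename σ).comp (MvPolynomial.aeval (Fin.cons (MvPolynomial.X x +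
        MvPolynomial.X y) (fun i => MvPolynomial.X (r i)) :
          Fin (q + 1) → MvPolynomial (Fin n) F)) := by
    ext1 i
    cases i using Fin.cases <;> simp
  have h2 : (Polynomial.aeval (MvPolynomial.X (σ x) : MvPolynomial (Fin n) F)) =
      (MvPolynomial.rename σ).comp (Polynomial.aeval (MvPolynomial.X x)) := by
    ext1; simp
  simp only [permAct_apply, pairTerm, Function.comp_apply, h1, h2, ← chg_chg]
  generalize chg A (Polynomial.aeval (MvPolynomial.X x : MvPolynomial (Fin n) F))
    (γ (a (σ x)) (a (σ y))) = u
  induction u with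
  | zero => simp
  | add x y hx hy => simp only [map_add, hx, hy]
  | tmul p c => simp [chg_smul, chg_chg, Function.comp_assoc]

theorem pairTerm_swap (𝒜 : LieConformalAlgebra F A) {q : ℕ} (f : RawCochain F A M (q + 1))
    (hf : ∀ (a : Fin (q + 1) → A) (i : Fin (q + 1)), f (Function.update a i (𝒜.der (a i))) =
      -((MvPolynomial.X i : MvPolynomial (Fin (q + 1)) F) • f a))
    {n : ℕ} (x y : Fin n) (r : Fin q → Fin n) (a : Fin n → A) :
    pairTerm 𝒜.bracket f y x r a = -pairTerm 𝒜.bracket f x y r a := by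
  rw [pairTerm, 𝒜.bracket_skew, map_neg, map_neg, liftBaseChange_skewSubst _ 𝒜.der
    (MvPolynomial.X y + MvPolynomial.X x), add_sub_cancel_left, pairTerm,
    add_comm (MvPolynomial.X y : MvPolynomial (Fin n) F)]
  intro c
  have := hf (Fin.cons c (a ∘ r)) 0
  rw [Fin.cons_zero, Fin.update_cons_zero] at this
  simp only [LinearMap.comp_apply, LinearMap.coe_mk, AddHom.coe_mk, this, map_neg, chg_smul,
    MvPolynomial.aeval_X, Fin.cons_zero]

theorem pairTerm_perm (γ : A →ₗ[F] A →ₗ[F] Polynomial F ⊗[F] A) {q : ℕ}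
    (f : RawCochain F A M (q + 1))
    (hf : ∀ (σ : Equiv.Perm (Fin (q + 1))) (a : Fin (q + 1) → A),
      chg M (MvPolynomial.rename σ) (f (a ∘ σ)) = ((Equiv.Perm.sign σ : ℤ) : F) • f a)
    {n : ℕ} (x y : Fin n) (r : Fin q → Fin n) (ρ : Equiv.Perm (Fin q)) (a : Fin n → A) :
    pairTerm γ f x y (r ∘ ρ) a = ((Equiv.Perm.sign ρ : ℤ) : F) • pairTerm γ f x y r a := by
  have h1 : (MvPolynomial.aeval (Fin.cons (MvPolynomial.X x + MvPolynomial.X y)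
      (fun i => MvPolynomial.X ((r ∘ ρ) i)) : Fin (q + 1) → MvPolynomial (Fin n) F)) =
      (MvPolynomial.aeval (Fin.cons (MvPolynomial.X x +
        MvPolynomial.X y) (fun i => MvPolynomial.X (r i)) :
          Fin (q + 1) → MvPolynomial (Fin n) F)).comp (MvPolynomial.rename (succPerm q ρ) :
          MvPolynomial (Fin (q + 1)) F →ₐ[F] MvPolynomial (Fin (q + 1)) F) := by
    ext1 i
    cases i using Fin.cases <;> simp [succPerm_zero, succPerm_succ]
  have h2 (c : A) : (Fin.cons c (a ∘ (r ∘ ρ)) : Fin (q + 1) → A) =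
      (Fin.cons c (a ∘ r) : Fin (q + 1) → A) ∘ succPerm q ρ := by
    ext i
    cases i using Fin.cases <;> simp [succPerm_zero, succPerm_succ]
  rw [pairTerm, pairTerm, h1]
  generalize chg A (Polynomial.aeval (MvPolynomial.X x : MvPolynomial (Fin n) F))
    (γ (a x) (a y)) = u
  induction u with
  | zero => simp
  | add x y hx hy => simp only [map_add, hx, hy, smul_add]
  | tmul p c =>
    simp only [LinearMap.liftBaseChange_tmul, LinearMap.comp_apply, LinearMap.coe_mk,
      AddHom.coe_mk, h2, ← chg_chg]
    rw [hf, sign_succPerm, map_smul, smul_comm p]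

theorem rawD₂_skew [CharZero F] (𝒜 : LieConformalAlgebra F A) (q : ℕ)
    (f : RawCochain F A M (q + 1))
    (hf : ∀ (a : Fin (q + 1) → A) (i : Fin (q + 1)), f (Function.update a i (𝒜.der (a i))) =
      -((MvPolynomial.X i : MvPolynomial (Fin (q + 1)) F) • f a))
    (hf' : ∀ (σ : Equiv.Perm (Fin (q + 1))) (a : Fin (q + 1) → A),
      chg M (MvPolynomial.rename σ) (f (a ∘ σ)) = ((Equiv.Perm.sign σ : ℤ) : F) • f a)
    (σ : Equiv.Perm (Fin (q + 2))) (a : Fin (q + 2) → A) :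
    chg M (MvPolynomial.rename σ) (rawD₂ 𝒜.bracket q f (a ∘ σ)) =
      ((Equiv.Perm.sign σ : ℤ) : F) • rawD₂ 𝒜.bracket q f a := by
  set P := permAct F A M (q + 2) with hP
  set U := pairTerm 𝒜.bracket f (0 : Fin (q + 2)) 1 (fun t : Fin q => t.succ.succ) with hU
  set W := ∑ j : Fin (q + 1), (-1 : F) ^ (j : ℕ) • (P.comp (succPerm (q + 1))) j.cycleRange⁻¹ U
    with hW
  have hW1 (ρ : Equiv.Perm (Fin (q + 1))) :
      P (succPerm (q + 1) ρ) W = ((Equiv.Perm.sign ρ : ℤ) : F) • W := by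
    refine sum_cycleRange_skew (P.comp (succPerm (q + 1))) U (fun ρ => ?_) ρ
    ext a
    rw [MonoidHom.comp_apply, hP, hU, permAct_pairTerm, Pi.smul_apply, ← pairTerm_perm _ f hf']
    congr 1
  have key := sum_cycleRange_skew P W hW1 σ
  have hS : ∑ k : Fin (q + 2), (-1 : F) ^ (k : ℕ) • P k.cycleRange⁻¹ W =
      fun a => (-2 : F) • rawD₂ 𝒜.bracket q f a := by
    ext a
    have h1 (k : Fin (q + 2)) (j : Fin (q + 1)) :
        P k.cycleRange⁻¹ (P (succPerm (q + 1) j.cycleRange⁻¹) U) =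
          pairTerm 𝒜.bracket f k (k.succAbove j) (fun t => k.succAbove (j.succAbove t)) := by
      have e1 : succPerm (q + 1) j.cycleRange⁻¹ 1 = j.succ := by
        rw [← Fin.succ_zero_eq_one, succPerm_succ]; simp [Equiv.Perm.inv_def]
      rw [hP, hU, permAct_pairTerm, permAct_pairTerm, succPerm_zero, e1]
      congr 1
      · simp [Equiv.Perm.inv_def]
      · simp [Equiv.Perm.inv_def]
      · ext t; simp [Equiv.Perm.inv_def, succPerm_succ]
    simp only [hW, map_sum, map_smul, MonoidHom.comp_apply, h1, Finset.smul_sum, smul_smul,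
      Finset.sum_apply, Pi.smul_apply]
    rw [Fin.sum_sum_eq_sum_triangle_add]
    simp only [rawD₂, LinearMap.sum_apply, sum_apply, Finset.smul_sum]
    refine Finset.sum_congr rfl fun i _ => Finset.sum_congr rfl fun j hj => ?_
    have hij : i ≤ j := by simpa using hj
    have e1 : i.castSucc.succAbove j = j.succ :=
      Fin.succAbove_of_le_castSucc _ _ (by simpa using hij)
    have e2 : j.succ.succAbove i = i.castSucc :=
      Fin.succAbove_of_castSucc_lt _ _ (by simpa [Fin.lt_def, Nat.lt_succ_iff] using hij)
    have e3 (t : Fin q) : j.succ.succAbove (i.succAbove t) =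
        i.castSucc.succAbove (j.succAbove t) := by
      have := Fin.succAbove_succAbove_succAbove_predAbove i.castSucc j t
      rw [e1, Fin.predAbove_of_le_castSucc _ _ (by simpa using hij)] at this
      simpa using this
    have e4 : rawD₂Term 𝒜.bracket q i.castSucc j f a = pairTerm 𝒜.bracket f i.castSucc
      (i.castSucc.succAbove j) (fun t => i.castSucc.succAbove (j.succAbove t)) a := rfl
    simp only [LinearMap.smul_apply, smul_apply, e4, e1, e2, e3]
    rw [pairTerm_swap 𝒜 f hf i.castSucc j.succ, smul_neg, ← sub_eq_add_neg, ← sub_smul, smul_smul]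
    congr 1
    simp [pow_succ, pow_add]
    ring
  rw [hS] at key
  have key' := congrFun key a
  rw [hP, permAct_apply, map_smul, Pi.smul_apply, smul_comm] at key'
  exact smul_right_injective _ (by norm_num : (-2 : F) ≠ 0) key'

theorem rawD_mem [CharZero F] {𝒜 : LieConformalAlgebra F A} (ℳ : LieConformalModule 𝒜 M) (q : ℕ)
    (f : RawCochain F A M q) (hf : f ∈ basicCochain ℳ q) :
    rawD ℳ q f ∈ basicCochain ℳ (q + 1) := by
  obtain ⟨h1, h2⟩ := hf
  cases q with
  | zero =>
    refine ⟨fun a i => rawD₁_antilinear ℳ.action_der_left 0 f h1 a i, fun σ a => ?_⟩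
    exact rawD₁_skew ℳ.action f h2 σ a
  | succ q =>
    refine ⟨fun a i => ?_, fun σ a => ?_⟩
    · simp only [rawD, LinearMap.add_apply, add_apply, smul_add, neg_add]
      rw [rawD₁_antilinear ℳ.action_der_left _ f h1 a i]
      congr 1
      simp only [rawD₂, LinearMap.sum_apply, sum_apply, LinearMap.smul_apply, smul_apply,
        rawD₂Term_antilinear 𝒜 q f h1 _ _ a i, Finset.smul_sum, ← Finset.sum_neg_distrib, smul_neg,
        smul_comm (MvPolynomial.X i : MvPolynomial (Fin (q + 2)) F)]
    · simp only [rawD, LinearMap.add_apply, add_apply, map_add, smul_add]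
      rw [rawD₁_skew ℳ.action f h2 σ a, rawD₂_skew 𝒜 q f h1 h2 σ a]

theorem rawDer_mem {𝒜 : LieConformalAlgebra F A} (ℳ : LieConformalModule 𝒜 M) (q : ℕ)
    (f : RawCochain F A M q) (hf : f ∈ basicCochain ℳ q) :
    rawDer ℳ.der q f ∈ basicCochain ℳ q := by
  refine ⟨fun a i => ?_, fun σ a => ?_⟩
  · rw [rawDer_apply, hf.1 a i, map_neg, map_smul, rawDer_apply]
  · have : (MvPolynomial.rename σ : MvPolynomial (Fin q) F →ₐ[F] MvPolynomial (Fin q) F)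
        (∑ k, MvPolynomial.X k) = ∑ k, MvPolynomial.X k := by
      rw [map_sum, ← Equiv.sum_comp σ (fun k => (MvPolynomial.X k : MvPolynomial (Fin q) F))]
      simp
    rw [rawDer_apply, totalDer_apply, map_add, chg_baseChange, chg_smul, this, hf.2, rawDer_apply,
      ← totalDer_apply, LinearMap.map_smul_of_tower]

/-! ### Basic and reduced complexes and their cohomology -/

/-- The differential `d : C̃^q → C̃^{q+1}` of the basic complex. -/
def basicD [CharZero F] {𝒜 : LieConformalAlgebra F A} (ℳ : LieConformalModule 𝒜 M) (q : ℕ) :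
    basicCochain ℳ q →ₗ[F] basicCochain ℳ (q + 1) :=
  (rawD ℳ q).restrict (rawD_mem ℳ q)

/-- The operator `∂` on the basic complex. -/
def basicDer {𝒜 : LieConformalAlgebra F A} (ℳ : LieConformalModule 𝒜 M) (q : ℕ) :
    basicCochain ℳ q →ₗ[F] basicCochain ℳ q :=
  (rawDer ℳ.der q).restrict (rawDer_mem ℳ q)

theorem basicD_basicDer [CharZero F] {𝒜 : LieConformalAlgebra F A} (ℳ : LieConformalModule 𝒜 M)
    (q : ℕ) (f : basicCochain ℳ q) :
    basicD ℳ q (basicDer ℳ q f) = basicDer ℳ (q + 1) (basicD ℳ q f) :=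
  Subtype.ext (rawD_rawDer ℳ q f.1)

/-- The reduced cochains `C^q = C̃^q / ∂ C̃^q`. -/
abbrev ReducedCochain {𝒜 : LieConformalAlgebra F A} (ℳ : LieConformalModule 𝒜 M) (q : ℕ) :=
  basicCochain ℳ q ⧸ LinearMap.range (basicDer ℳ q)

/-- The projection `C̃^q → C^q`, `f ↦ f̄`. -/
def toReduced {𝒜 : LieConformalAlgebra F A} (ℳ : LieConformalModule 𝒜 M) (q : ℕ) :
    basicCochain ℳ q →ₗ[F] ReducedCochain ℳ q :=
  (LinearMap.range (basicDer ℳ q)).mkQ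

/-- The differential of the reduced complex. -/
def reducedD [CharZero F] {𝒜 : LieConformalAlgebra F A} (ℳ : LieConformalModule 𝒜 M) (q : ℕ) :
    ReducedCochain ℳ q →ₗ[F] ReducedCochain ℳ (q + 1) :=
  Submodule.mapQ _ _ (basicD ℳ q) (by
    rintro _ ⟨f, rfl⟩
    exact ⟨basicD ℳ q f, (basicD_basicDer ℳ q f).symm⟩)

end Cochains

section Cohomology

variable {F : Type u} [Field F] {C : ℕ → Type v} [∀ q, AddCommGroup (C q)] [∀ q, Module F (C q)]

/-- The coboundaries in degree `q` (zero in degree `0`). -/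
def coboundaries (d : ∀ q, C q →ₗ[F] C (q + 1)) : ∀ q, Submodule F (C q)
  | 0 => ⊥
  | q + 1 => LinearMap.range (d q)

/-- Cocycles modulo coboundaries. -/
abbrev Cohomology (d : ∀ q, C q →ₗ[F] C (q + 1)) (q : ℕ) :=
  LinearMap.ker (d q) ⧸ (coboundaries d q).submoduleOf (LinearMap.ker (d q))

/-- The family `f` consists of cocycles whose classes form a basis of the `q`-th cohomology. -/
def IsCohomologyBasis (d : ∀ q, C q →ₗ[F] C (q + 1)) (q : ℕ) {n : ℕ} (f : Fin n → C q) : Prop :=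
  ∃ (h : ∀ i, f i ∈ LinearMap.ker (d q)) (b : Module.Basis (Fin n) F (Cohomology d q)),
    ∀ i, b i = Submodule.Quotient.mk ⟨f i, h i⟩

end Cohomology

section

variable {F : Type u} [Field F] [CharZero F] {A : Type v} [AddCommGroup A] [Module F A]
  {M : Type w} [AddCommGroup M] [Module F M]

/-- The basic cohomology `H̃^q(𝒜, ℳ)`. -/
abbrev BasicCohomology {𝒜 : LieConformalAlgebra F A} (ℳ : LieConformalModule 𝒜 M) (q : ℕ) :=
  Cohomology (C := fun q => basicCochain ℳ q) (basicD ℳ) q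

/-- The reduced cohomology `H^q(𝒜, ℳ)`. -/
abbrev ReducedCohomology {𝒜 : LieConformalAlgebra F A} (ℳ : LieConformalModule 𝒜 M) (q : ℕ) :=
  Cohomology (C := ReducedCochain ℳ) (reducedD ℳ) q

end

/-! ### The Lie conformal algebra `W(b)` -/

section W

variable {F : Type u} [Field F]

/-- The free `F[∂]`-module with basis `L = (1, 0)`, `H = (0, 1)`. -/
abbrev WModule (F : Type u) [Field F] := Polynomial F × Polynomial F

section Formula

variable {R S : Type*} [CommRing R] [Algebra F R] [CommRing S] [Algebra F S]

/-- The element `∂` of `R[∂] = R ⊗ F[∂]`. -/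
def wDel (F : Type u) [Field F] (R : Type*) [CommRing R] [Algebra F R] : R ⊗[F] Polynomial F :=
  1 ⊗ₜ Polynomial.X

/-- The element `t ∈ R` of `R[∂] = R ⊗ F[∂]`. -/
def wPar (F : Type u) [Field F] {R : Type*} [CommRing R] [Algebra F R] (t : R) :
    R ⊗[F] Polynomial F := t ⊗ₜ 1

/-- The element `u L + v H` of `R ⊗ W(b)`, for `u, v ∈ R[∂]`. -/
def wPair (u v : R ⊗[F] Polynomial F) : R ⊗[F] WModule F :=
  LinearMap.lTensor R (LinearMap.inl F (Polynomial F) (Polynomial F)) u +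
    LinearMap.lTensor R (LinearMap.inr F (Polynomial F) (Polynomial F)) v

/-- The bracket with parameter `t`:
`[L_t L] = (∂ + 2t) L`, `[L_t H] = (∂ + (1 - b) t) H`, `[H_t L] = (-b ∂ + (1 - b) t) H`,
`[H_t H] = 0`, extended by `[p(∂) x_t q(∂) y] = p(-t) q(∂ + t) [x_t y]`. -/
def wBracketAt (b : F) (t : R) (x y : WModule F) : R ⊗[F] WModule F :=
  wPair
    (Polynomial.aeval (-wPar F t) x.1 * Polynomial.aeval (wDel F R + wPar F t) y.1 *
      (wDel F R + 2 * wPar F t))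
    (Polynomial.aeval (-wPar F t) x.1 * Polynomial.aeval (wDel F R + wPar F t) y.2 *
      (wDel F R + algebraMap F _ (1 - b) * wPar F t) +
    Polynomial.aeval (-wPar F t) x.2 * Polynomial.aeval (wDel F R + wPar F t) y.1 *
      (-algebraMap F _ b * wDel F R + algebraMap F _ (1 - b) * wPar F t))

theorem wPair_add (u v u' v' : R ⊗[F] Polynomial F) :
    wPair u v + wPair u' v' = wPair (u + u') (v + v') := by
  simp only [wPair, map_add]; abel

theorem wPair_neg (u v : R ⊗[F] Polynomial F) : -wPair u v = wPair (-u) (-v) := by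
  simp only [wPair, map_neg]; abel

theorem wPair_smul_field (c : F) (u v : R ⊗[F] Polynomial F) :
    c • wPair u v = wPair (c • u) (c • v) := by
  simp only [wPair, map_smul, smul_add]

theorem wPair_surj (w : R ⊗[F] WModule F) : ∃ u v, w = wPair u v := by
  induction w with
  | zero => exact ⟨0, 0, by simp [wPair]⟩
  | tmul r x => exact ⟨r ⊗ₜ x.1, r ⊗ₜ x.2, by simp [wPair, ← TensorProduct.tmul_add]⟩
  | add x y hx hy =>
    obtain ⟨u, v, rfl⟩ := hx
    obtain ⟨u', v', rfl⟩ := hy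
    exact ⟨_, _, wPair_add u v u' v'⟩

theorem wPair_smul (r : R) (u v : R ⊗[F] Polynomial F) :
    r • wPair u v = wPair (wPar F r * u) (wPar F r * v) := by
  have h (D : Polynomial F →ₗ[F] WModule F) (u : R ⊗[F] Polynomial F) :
      r • LinearMap.lTensor R D u = LinearMap.lTensor R D (wPar F r * u) := by
    induction u with
    | zero => simp
    | tmul x y => simp [wPar, TensorProduct.smul_tmul']
    | add x y hx hy => simp only [map_add, smul_add, mul_add, hx, hy]
  simp only [wPair, smul_add, h]

/-- The action of `∂`. -/
def wDer (F : Type u) [Field F] : WModule F →ₗ[F] WModule F :=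
  Module.toModuleEnd F (WModule F) (Polynomial.X : Polynomial F)

theorem wDer_apply (x : WModule F) : wDer F x = (Polynomial.X : Polynomial F) • x := rfl

theorem wPair_baseChange (u v : R ⊗[F] Polynomial F) :
    (wDer F).baseChange R (wPair u v) = wPair (wDel F R * u) (wDel F R * v) := by
  have h1 (u : R ⊗[F] Polynomial F) : (wDer F).baseChange R
      (LinearMap.lTensor R (LinearMap.inl F (Polynomial F) (Polynomial F)) u) =
      LinearMap.lTensor R (LinearMap.inl F (Polynomial F) (Polynomial F)) (wDel F R * u) := by
    induction u with
    | zero => simp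
    | tmul x y => simp [wDel, wDer_apply]
    | add x y hx hy => simp only [map_add, mul_add, hx, hy]
  have h2 (u : R ⊗[F] Polynomial F) : (wDer F).baseChange R
      (LinearMap.lTensor R (LinearMap.inr F (Polynomial F) (Polynomial F)) u) =
      LinearMap.lTensor R (LinearMap.inr F (Polynomial F) (Polynomial F)) (wDel F R * u) := by
    induction u with
    | zero => simp
    | tmul x y => simp [wDel, wDer_apply]
    | add x y hx hy => simp only [map_add, mul_add, hx, hy]
  simp only [wPair, map_add, h1, h2]

theorem chg_wPair (φ : R →ₐ[F] S) (u v : R ⊗[F] Polynomial F) :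
    chg (WModule F) φ (wPair u v) =
      wPair (Algebra.TensorProduct.map φ (AlgHom.id F (Polynomial F)) u)
        (Algebra.TensorProduct.map φ (AlgHom.id F (Polynomial F)) v) := by
  have h (D : Polynomial F →ₗ[F] WModule F) (u : R ⊗[F] Polynomial F) :
      chg (WModule F) φ (LinearMap.lTensor R D u) =
        LinearMap.lTensor S D (Algebra.TensorProduct.map φ (AlgHom.id F (Polynomial F)) u) := by
    induction u with
    | zero => simp
    | tmul x y => simp
    | add x y hx hy => simp only [map_add, hx, hy]
  simp only [wPair, map_add, h]

end Formula

/-- The `λ`-bracket of `W(b)`. -/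
def wBracket (b : F) : WModule F →ₗ[F] WModule F →ₗ[F] Polynomial F ⊗[F] WModule F :=
  LinearMap.mk₂ F (wBracketAt b (Polynomial.X : Polynomial F))
    (fun x y z => by
      simp only [wBracketAt, wPair_add, Prod.fst_add, Prod.snd_add, map_add]
      congr 1 <;> ring)
    (fun c x y => by
      simp only [wBracketAt, wPair_smul_field, Prod.smul_fst, Prod.smul_snd, map_smul,
        smul_mul_assoc, smul_add])
    (fun x y z => by
      simp only [wBracketAt, wPair_add, Prod.fst_add, Prod.snd_add, map_add]
      congr 1 <;> ring)
    (fun c x y => by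
      simp only [wBracketAt, wPair_smul_field, Prod.smul_fst, Prod.smul_snd, map_smul,
        smul_mul_assoc, mul_smul_comm, smul_add])

section Formula

variable {R : Type*} [CommRing R] [Algebra F R]

theorem chg_wBracket (b : F) (t : R) (x y : WModule F) :
    chg (WModule F) (Polynomial.aeval t) (wBracket b x y) = wBracketAt b t x y := by
  have h1 : Algebra.TensorProduct.map (Polynomial.aeval t) (AlgHom.id F (Polynomial F))
      (wPar F (Polynomial.X : Polynomial F)) = wPar F t := by simp [wPar]
  have h2 : Algebra.TensorProduct.map (Polynomial.aeval t) (AlgHom.id F (Polynomial F))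
      (wDel F (Polynomial F)) = wDel F R := by simp [wDel]
  simp only [wBracket, LinearMap.mk₂_apply, wBracketAt, chg_wPair, map_mul, map_add, map_neg,
    ← Polynomial.aeval_algHom_apply, h1, h2, AlgHom.commutes, map_ofNat]

/-- The substitution `∂ ↦ s` of `R[∂]`. -/
def wSubst (s : R ⊗[F] Polynomial F) : R ⊗[F] Polynomial F →ₐ[R] R ⊗[F] Polynomial F :=
  Algebra.TensorProduct.lift (Algebra.ofId R _) (Polynomial.aeval s) (fun _ _ => Commute.all _ _)

theorem wSubst_tmul (s : R ⊗[F] Polynomial F) (r : R) (p : Polynomial F) :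
    wSubst s (r ⊗ₜ p) = wPar F r * Polynomial.aeval s p := by
  simp [wSubst, wPar, Algebra.ofId_apply]

theorem wSubst_wDel (s : R ⊗[F] Polynomial F) : wSubst s (wDel F R) = s := by
  simp [wDel, wSubst_tmul, wPar, ← Algebra.TensorProduct.one_def]

theorem wSubst_wPar (s : R ⊗[F] Polynomial F) (r : R) : wSubst s (wPar F r) = wPar F r := by
  simp [wPar, wSubst_tmul]

theorem wPair_tmul (r : R) (x : WModule F) : r ⊗ₜ[F] x = wPair (r ⊗ₜ x.1) (r ⊗ₜ x.2) := by
  simp [wPair, ← TensorProduct.tmul_add]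

theorem wPair_induction {P : (R ⊗[F] Polynomial F) → (R ⊗[F] Polynomial F) → Prop}
    (h0 : P 0 0) (h : ∀ (r : R) (x : WModule F), P (r ⊗ₜ x.1) (r ⊗ₜ x.2))
    (hadd : ∀ u v u' v', P u v → P u' v' → P (u + u') (v + v')) (u v : R ⊗[F] Polynomial F) :
    P u v := by
  have h1 (u : R ⊗[F] Polynomial F) : P u 0 := by
    induction u with
    | zero => exact h0
    | tmul r p => simpa using h r (p, 0)
    | add x y hx hy => simpa using hadd _ _ _ _ hx hy
  have h2 (v : R ⊗[F] Polynomial F) : P 0 v := by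
    induction v with
    | zero => exact h0
    | tmul r p => simpa using h r (0, p)
    | add x y hx hy => simpa using hadd _ _ _ _ hx hy
  simpa using hadd _ _ _ _ (h1 u) (h2 v)

theorem act_wPair (b : F) (t : R) (x : WModule F) (u v : R ⊗[F] Polynomial F) :
    act (wBracket b) t x (wPair u v) = wPair
      (Polynomial.aeval (-wPar F t) x.1 * wSubst (wDel F R + wPar F t) u *
        (wDel F R + 2 * wPar F t))
      (Polynomial.aeval (-wPar F t) x.1 * wSubst (wDel F R + wPar F t) v *
        (wDel F R + algebraMap F _ (1 - b) * wPar F t) +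
      Polynomial.aeval (-wPar F t) x.2 * wSubst (wDel F R + wPar F t) u *
        (-algebraMap F _ b * wDel F R + algebraMap F _ (1 - b) * wPar F t)) := by
  induction u, v using wPair_induction with
  | h0 => simp [wPair]
  | h r y =>
    rw [← wPair_tmul, act, LinearMap.liftBaseChange_tmul, LinearMap.comp_apply, chg_wBracket,
      wBracketAt, wPair_smul, wSubst_tmul, wSubst_tmul]
    congr 1 <;> ring
  | hadd u v u' v' h h' =>
    rw [← wPair_add, map_add, h, h', wPair_add, map_add, map_add]
    congr 1 <;> ring

theorem actLeft_wPair (b : F) (t : R) (y : WModule F) (u v : R ⊗[F] Polynomial F) :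
    actLeft (wBracket b) t y (wPair u v) = wPair
      (wSubst (-wPar F t) u * Polynomial.aeval (wDel F R + wPar F t) y.1 *
        (wDel F R + 2 * wPar F t))
      (wSubst (-wPar F t) u * Polynomial.aeval (wDel F R + wPar F t) y.2 *
        (wDel F R + algebraMap F _ (1 - b) * wPar F t) +
      wSubst (-wPar F t) v * Polynomial.aeval (wDel F R + wPar F t) y.1 *
        (-algebraMap F _ b * wDel F R + algebraMap F _ (1 - b) * wPar F t)) := by
  induction u, v using wPair_induction with
  | h0 => simp [wPair]
  | h r x =>
    rw [← wPair_tmul, actLeft, LinearMap.liftBaseChange_tmul, LinearMap.comp_apply,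
      LinearMap.flip_apply, chg_wBracket,
      wBracketAt, wPair_smul, wSubst_tmul, wSubst_tmul]
    congr 1 <;> ring
  | hadd u v u' v' h h' =>
    rw [← wPair_add, map_add, h, h', wPair_add, map_add, map_add]
    congr 1 <;> ring

end Formula

/-- The substitution `λ ↦ -λ - ∂`, `∂ ↦ ∂` of `F[λ] ⊗ F[∂]`. -/
def wSkew (F : Type u) [Field F] :
    Polynomial F ⊗[F] Polynomial F →ₐ[F] Polynomial F ⊗[F] Polynomial F :=
  Algebra.TensorProduct.lift (Polynomial.aeval (-wPar F Polynomial.X - wDel F (Polynomial F)))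
    (Polynomial.aeval (wDel F (Polynomial F))) (fun _ _ => Commute.all _ _)

theorem wSkew_wDel : wSkew F (wDel F (Polynomial F)) = wDel F (Polynomial F) := by
  simp [wSkew, wDel]

theorem wSkew_wPar : wSkew F (wPar F Polynomial.X) =
    -wPar F Polynomial.X - wDel F (Polynomial F) := by
  simp [wSkew, wPar]

theorem aeval_wDel {R : Type*} [CommRing R] [Algebra F R] (p : Polynomial F) :
    Polynomial.aeval (wDel F R) p = 1 ⊗ₜ p := by
  have : Polynomial.aeval (wDel F R) =
      (Algebra.TensorProduct.includeRight : Polynomial F →ₐ[F] R ⊗[F] Polynomial F) := by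
    ext; simp [wDel]
  rw [this]; rfl

theorem skewSubst_wPair (u v : Polynomial F ⊗[F] Polynomial F) :
    skewSubst (wDer F) (wPair u v) = wPair (wSkew F u) (wSkew F v) := by
  induction u, v using wPair_induction with
  | h0 => simp [wPair]
  | hadd u v u' v' h h' => rw [← wPair_add, map_add, h, h', wPair_add, map_add, map_add]
  | h p x =>
    rw [← wPair_tmul]
    simp only [skewSubst, TensorProduct.lift.tmul, LinearMap.mk₂_apply]
    set T : Module.End (Polynomial F) (Polynomial F ⊗[F] WModule F) :=
      -((Polynomial.X : Polynomial F) • 1) - (wDer F).baseChange (Polynomial F) with hT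
    have key (u v : Polynomial F ⊗[F] Polynomial F) : T (wPair u v) =
        wPair ((-wPar F Polynomial.X - wDel F (Polynomial F)) * u)
          ((-wPar F Polynomial.X - wDel F (Polynomial F)) * v) := by
      simp only [hT, LinearMap.sub_apply, LinearMap.neg_apply, LinearMap.smul_apply,
        Module.End.one_apply, wPair_smul, wPair_baseChange, wPair_neg, sub_eq_add_neg, wPair_add]
      congr 1 <;> ring
    have hpow (n : ℕ) : (T ^ n) (1 ⊗ₜ[F] x) =
        wPair ((-wPar F Polynomial.X - wDel F (Polynomial F)) ^ n * (1 ⊗ₜ x.1))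
          ((-wPar F Polynomial.X - wDel F (Polynomial F)) ^ n * (1 ⊗ₜ x.2)) := by
      induction n with
      | zero => simp [← wPair_tmul]
      | succ n ih => rw [pow_succ', Module.End.mul_apply, ih, key]; congr 1 <;> ring
    have h1 (y : Polynomial F) : wSkew F (p ⊗ₜ y) =
        Polynomial.aeval (-wPar F Polynomial.X - wDel F (Polynomial F)) p * (1 ⊗ₜ y) := by
      simp [wSkew, aeval_wDel]
    rw [h1, h1]
    clear h1
    induction p using Polynomial.induction_on' with
    | add p q hp hq =>
      simp only [map_add, LinearMap.add_apply, hp, hq, wPair_add, add_mul]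
    | monomial n c =>
      rw [Polynomial.aeval_monomial, Polynomial.aeval_monomial, Module.End.mul_apply,
        Module.algebraMap_end_apply, hpow, wPair_smul_field, ← Algebra.smul_def, smul_mul_assoc,
        smul_mul_assoc]

/-- The Lie conformal algebra `W(b)`, which for `b = 0` is the Heisenberg–Virasoro Lie conformal
algebra. -/
def WAlgebra (b : F) : LieConformalAlgebra F (WModule F) where
  der := wDer F
  bracket := wBracket b
  bracket_der_left x y := by
    simp only [wBracket, LinearMap.mk₂_apply, wBracketAt, wPair_smul, wPair_neg, wDer_apply,
      Prod.smul_fst, Prod.smul_snd, smul_eq_mul, map_mul, Polynomial.aeval_X]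
    congr 1 <;> ring
  bracket_der_right x y := by
    simp only [wBracket, LinearMap.mk₂_apply, wBracketAt, wPair_smul, wPair_baseChange, wPair_add,
      wDer_apply, Prod.smul_fst, Prod.smul_snd, smul_eq_mul, map_mul, Polynomial.aeval_X]
    congr 1 <;> ring
  bracket_skew x y := by
    have h1 : -(-wPar F (Polynomial.X : Polynomial F) - wDel F (Polynomial F)) =
        wDel F (Polynomial F) + wPar F Polynomial.X := by ring
    have h2 : wDel F (Polynomial F) + (-wPar F (Polynomial.X : Polynomial F) -
        wDel F (Polynomial F)) = -wPar F Polynomial.X := by ring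
    simp only [wBracket, LinearMap.mk₂_apply, wBracketAt, skewSubst_wPair, wPair_neg, map_mul,
      map_add, map_neg, map_sub, map_one, ← Polynomial.aeval_algHom_apply, wSkew_wDel, wSkew_wPar,
      AlgHom.commutes, map_ofNat, h1, h2]
    congr 1 <;> ring
  jacobi x y z := by
    have e (s : MvPolynomial (Fin 2) F ⊗[F] Polynomial F) (c : F) :
        wSubst s (algebraMap F _ c) = algebraMap F _ c :=
      AlgHom.commutes ((wSubst s).restrictScalars F) c
    have e' (s t : MvPolynomial (Fin 2) F ⊗[F] Polynomial F) (p : Polynomial F) :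
        wSubst s (Polynomial.aeval t p) = Polynomial.aeval (wSubst s t) p :=
      (Polynomial.aeval_algHom_apply ((wSubst s).restrictScalars F) t p).symm
    have a1 (s t : MvPolynomial (Fin 2) F) : wPar F (s + t) = wPar F s + wPar F t :=
      TensorProduct.add_tmul _ _ _
    simp only [chg_wBracket, wBracketAt, act_wPair, actLeft_wPair, wPair_add, map_mul, map_add,
      map_neg, map_ofNat, e, e', wSubst_wDel, wSubst_wPar, a1, map_sub, map_one]
    have f1 (s t : MvPolynomial (Fin 2) F ⊗[F] Polynomial F) : -(s + t) + s = -t := by ring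
    have f2 (s t d : MvPolynomial (Fin 2) F ⊗[F] Polynomial F) : d + t + s = d + s + t := by ring
    have f3 (s t d : MvPolynomial (Fin 2) F ⊗[F] Polynomial F) : d + (s + t) = d + s + t := by ring
    rw [f2 (wPar F (MvPolynomial.X 0)) (wPar F (MvPolynomial.X 1))]
    simp only [f1, f3]
    congr 1 <;> ring

/-- The generator `L`. -/
def genL (F : Type u) [Field F] : WModule F := (1, 0)

/-- The generator `H`. -/
def genH (F : Type u) [Field F] : WModule F := (0, 1)

theorem WAlgebra_bracket_LL (b : F) : (WAlgebra b).bracket (genL F) (genL F) =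
    1 ⊗ₜ (WAlgebra b).der (genL F) + (2 * Polynomial.X) ⊗ₜ genL F := by
  simp [WAlgebra, wBracket, wBracketAt, genL, wDer_apply, wPair_tmul, wPair_add, wDel, wPar,
    two_mul, TensorProduct.add_tmul]

theorem WAlgebra_bracket_LH (b : F) : (WAlgebra b).bracket (genL F) (genH F) =
    1 ⊗ₜ (WAlgebra b).der (genH F) + ((1 - b) • Polynomial.X) ⊗ₜ genH F := by
  simp [WAlgebra, wBracket, wBracketAt, genL, genH, wDer_apply, wPair_tmul, wPair_add, wDel, wPar,
    Algebra.TensorProduct.algebraMap_apply, Polynomial.smul_eq_C_mul]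

theorem neg_algebraMap_mul {S : Type*} [CommRing S] [Algebra F S] (b : F) (d : S) :
    -algebraMap F S b * d = -(b • d) := by
  rw [Algebra.smul_def]; ring

theorem WAlgebra_bracket_HL (b : F) : (WAlgebra b).bracket (genH F) (genL F) =
    -(b • 1 ⊗ₜ (WAlgebra b).der (genH F)) + ((1 - b) • Polynomial.X) ⊗ₜ genH F := by
  have h : (-algebraMap F (Polynomial F ⊗[F] Polynomial F) b) * wDel F (Polynomial F) =
      -(b • wDel F (Polynomial F)) := by
    exact neg_algebraMap_mul b (wDel F (Polynomial F))
  have h' : algebraMap F (Polynomial F ⊗[F] Polynomial F) (1 - b) * wPar F Polynomial.X =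
      wPar F ((1 - b) • Polynomial.X) := by
    rw [← Algebra.smul_def]; rfl
  simp only [WAlgebra, wBracket, LinearMap.mk₂_apply, wBracketAt, h, h']
  simp [genL, genH, wDer_apply, wPair_tmul, wPair_add, wPair_smul_field, wPair_neg, wDel, wPar]

theorem WAlgebra_bracket_HH (b : F) : (WAlgebra b).bracket (genH F) (genH F) = 0 := by
  simp [WAlgebra, wBracket, wBracketAt, genH, wPair]

end W

/-- `W(b)` as a module over itself. -/
abbrev wAdjoint {F : Type*} [Field F] (b : F) : LieConformalModule (WAlgebra b) (WModule F) :=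
  (WAlgebra b).adjoint

end

end LieConformal

open LieConformal

/-! The basic complex is contracted onto a small subcomplex by an Euler operator. Inserting `L` with
parameter `μ` as first argument and taking the coefficient of `μⁿ` gives a map `ιₙ` lowering the
degree by one (`contractL`). By Cartan's formula, `d ιₙ + ιₙ d` is the coefficient of `μⁿ` in the
Lie derivative along `L_μ` (`cartan_zero`, `cartan_succ`).

For `n = 1` this operator `K` is diagonal on monomial values. Its eigenvalue is the degree in the
`λ`'s, plus the power of `∂`, plus `1` or `2` for an output in `H` or `L`, minus the number of
arguments `L` (`cochainCoeff_eulerOp`). Only finitely many weights occur in a cochain, so in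
characteristic `0` the basic cohomology is that of `ker K`. Skew-symmetry makes the exponents at
equal generators distinct. With `a` arguments `L` and `c` arguments `H`, weight zero then forces
`(a-1)(a-2) + c(c-1) ≤ 0`, no `∂`, and output in `H` (`weight_zero_constraints`). Thus `a ∈ {1, 2}`
and `c ∈ {0, 1}`, which leaves exactly four cochains up to scalars, in degrees 1, 2, 2, 3. The
differential vanishes on all of them (`basicD_eq_zero_of_eulerOp_eq_zero`), so they form bases of
the basic cohomology (`SemisimpleHomotopy.IsKerBasis.isCohomologyBasis`).

For `n = 0` the operator is `∂` itself. Hence `∂` acts by zero on basic cohomology; it is also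
injective on cochains (`basicDer_injective`). The long exact sequence of `0 → C̃ → C̃ → C → 0`
therefore splits into short pieces, and `H^q` is `H̃^q` plus a copy of `H̃^{q+1}` embedded by `ι₀`
(`SemisimpleHomotopy.IsKerBasis.isCohomologyBasis_reduced`). This gives the dimensions `0+1`, `1+2`,
`2+1`, `1+0`, and the remaining representatives are `ι₀` of the basic ones, corrected by elements of
`∂C̃`.

To reach Cartan's formula, a cochain is evaluated on elements `L_t`, `H_t` with `t` in an arbitrary
commutative algebra. These span a Lie algebra in which a bracket of two letters is a multiple of a
letter, and the conformal differential becomes the Chevalley–Eilenberg differential (`evalAt_rawD`).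
-/

namespace LieConformal

noncomputable section

universe u v

/-! ### Cartan calculus on functions of letters -/

/-- A Lie algebra over `R` with basis `I`, the bracket of two basis elements being a multiple
`coef x y` of a basis element `mul x y`, together with a representation on `N`. -/
structure LetterAlgebra (R I N : Type*) [CommRing R] [AddCommGroup N] [Module R N] where
  mul : I → I → I
  coef : I → I → R
  act : I → N →ₗ[R] N
  assoc : ∀ x y z, mul x (mul y z) = mul (mul x y) z
  left_comm : ∀ x y z, mul x (mul y z) = mul y (mul x z)
  jacobi : ∀ x y z, coef y z * coef x (mul y z) =
    coef x y * coef (mul x y) z + coef x z * coef y (mul x z)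
  act_act : ∀ x y n, act x (act y n) = act y (act x n) + coef x y • act (mul x y) n

namespace LetterAlgebra

section Calculus

variable {R I N : Type*} [CommRing R] [AddCommGroup N] [Module R N]

/-- Insertion of `x` as first argument. -/
def contract {q : ℕ} (x : I) : ((Fin (q + 1) → I) → N) →ₗ[R] ((Fin q → I) → N) :=
  LinearMap.funLeft R N fun y => (Fin.cons x y : Fin (q + 1) → I)

theorem contract_apply {q : ℕ} (x : I) (c : (Fin (q + 1) → I) → N) (y : Fin q → I) :
    contract (R := R) x c y = c (Fin.cons x y) := rfl

theorem ext_contract {q : ℕ} {c c' : (Fin (q + 1) → I) → N}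
    (h : ∀ x, contract (R := R) x c = contract (R := R) x c') : c = c' := by
  funext y
  have := congrFun (h (y 0)) (Fin.tail y)
  rwa [contract_apply, contract_apply, Fin.cons_self_tail] at this

variable (G : LetterAlgebra R I N)

/-- The Lie derivative. -/
def lieDer (x : I) : ∀ q, ((Fin q → I) → N) →ₗ[R] ((Fin q → I) → N)
  | 0 => (G.act x).compLeft _
  | q + 1 => LinearMap.pi fun y =>
      LinearMap.proj (Fin.tail y) ∘ₗ
        (lieDer x q ∘ₗ contract (y 0) - G.coef x (y 0) • contract (G.mul x (y 0)))

/-- The Chevalley–Eilenberg differential, defined by recursion through Cartan's formula. -/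
def diff : ∀ q, ((Fin q → I) → N) →ₗ[R] ((Fin (q + 1) → I) → N)
  | 0 => LinearMap.pi fun y => G.act (y 0) ∘ₗ LinearMap.proj (Fin.tail y)
  | q + 1 => LinearMap.pi fun y =>
      LinearMap.proj (Fin.tail y) ∘ₗ (G.lieDer (y 0) (q + 1) - diff q ∘ₗ contract (y 0))

theorem lieDer_zero (x : I) (c : (Fin 0 → I) → N) (y : Fin 0 → I) :
    G.lieDer x 0 c y = G.act x (c y) := rfl

/-- The Cartan relation `[L_x, ι_y] = ι_{[x,y]}` is the recursion defining `lieDer`, so it holds by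
`rfl`; likewise `L_x = dι_x + ι_x d` in `contract_diff`. -/
theorem contract_lieDer (x y : I) (q : ℕ) (c : (Fin (q + 1) → I) → N) :
    contract (R := R) y (G.lieDer x (q + 1) c) =
      G.lieDer x q (contract (R := R) y c) -
        G.coef x y • contract (R := R) (G.mul x y) c := rfl

theorem contract_diff_zero (x : I) (c : (Fin 0 → I) → N) :
    contract (R := R) x (G.diff 0 c) = G.lieDer x 0 c := rfl

theorem contract_diff (x : I) (q : ℕ) (c : (Fin (q + 1) → I) → N) :
    contract (R := R) x (G.diff (q + 1) c) =
      G.lieDer x (q + 1) c - G.diff q (contract (R := R) x c) := rfl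

/-- Induction on the degree: after contraction with `z`, the discrepancy is the Jacobi identity for
`x`, `y`, `z`. -/
theorem lieDer_lieDer (x y : I) (q : ℕ) (c : (Fin q → I) → N) :
    G.lieDer x q (G.lieDer y q c) =
      G.lieDer y q (G.lieDer x q c) + G.coef x y • G.lieDer (G.mul x y) q c := by
  induction q with
  | zero => funext z; exact G.act_act x y _
  | succ q ih =>
    refine ext_contract (R := R) fun z => ?_
    -- By `assoc` and `left_comm` the three iterated brackets are multiples of one and the same
    -- letter, so Jacobi is an identity between coefficients.
    have e : (G.coef y z * G.coef x (G.mul y z)) • contract (R := R) (G.mul x (G.mul y z)) c =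
        (G.coef x y * G.coef (G.mul x y) z) • contract (R := R) (G.mul (G.mul x y) z) c +
        (G.coef x z * G.coef y (G.mul x z)) • contract (R := R) (G.mul y (G.mul x z)) c := by
      rw [G.jacobi, add_smul, ← G.assoc, G.left_comm y x z]
    simp only [contract_lieDer, map_add, map_sub, map_smul, ih, smul_sub, smul_smul, e]
    abel

theorem lieDer_diff (x : I) (q : ℕ) (c : (Fin q → I) → N) :
    G.lieDer x (q + 1) (G.diff q c) = G.diff q (G.lieDer x q c) := by
  induction q with
  | zero =>
    refine ext_contract (R := R) fun y => ?_
    rw [contract_lieDer, contract_diff_zero, contract_diff_zero, contract_diff_zero, lieDer_lieDer]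
    abel
  | succ q ih =>
    refine ext_contract (R := R) fun y => ?_
    simp only [contract_lieDer, contract_diff, map_sub, map_smul, ih, smul_sub,
      G.lieDer_lieDer x y]
    abel

/-- `ι_x d d c = L_x d c - d(L_x c - d ι_x c) = d d ι_x c`, because `L_x` commutes with `d`; induct
on the degree. Skew-symmetry plays no role. -/
theorem diff_diff (q : ℕ) (c : (Fin q → I) → N) : G.diff (q + 1) (G.diff q c) = 0 := by
  induction q with
  | zero =>
    refine ext_contract (R := R) fun y => ?_
    rw [contract_diff, contract_diff_zero, lieDer_diff, sub_self, map_zero]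
  | succ q ih =>
    refine ext_contract (R := R) fun y => ?_
    rw [contract_diff, contract_diff, lieDer_diff, map_sub, ih, sub_zero, sub_self, map_zero]

theorem lieDer_apply (x : I) (q : ℕ) (c : (Fin q → I) → N) (y : Fin q → I) :
    G.lieDer x q c y = G.act x (c y) -
      ∑ l, G.coef x (y l) • c (Function.update y l (G.mul x (y l))) := by
  induction q with
  | zero => simp [lieDer_zero]
  | succ q ih =>
    obtain ⟨z, y, rfl⟩ : ∃ z y', y = Fin.cons z y' := ⟨y 0, Fin.tail y, (Fin.cons_self_tail y).symm⟩
    have := congrFun (G.contract_lieDer x z q c) y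
    rw [contract_apply] at this
    rw [this, Pi.sub_apply, ih, Fin.sum_univ_succ]
    simp only [contract_apply, Pi.smul_apply, Fin.cons_zero, Fin.cons_succ, Fin.update_cons_zero,
      Fin.cons_update]
    abel

/-- Skew-symmetry in all pairs of neighbouring arguments. -/
def IsSkew : ∀ {q : ℕ}, ((Fin q → I) → N) → Prop
  | 0, _ => True
  | 1, _ => True
  | q + 2, c => (∀ x y z, c (Fin.cons x (Fin.cons y z)) = -c (Fin.cons y (Fin.cons x z))) ∧
      ∀ x, IsSkew (q := q + 1) fun z => c (Fin.cons x z)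

theorem IsSkew.contract {q : ℕ} {c : (Fin (q + 1) → I) → N} (h : IsSkew c) (x : I) :
    IsSkew (contract (R := R) x c) := by
  cases q with
  | zero => trivial
  | succ q => exact h.2 x

/-- The recursive notion only asks for the transposition of the first two places and for
permutations fixing the first place. -/
theorem isSkew_of_perm {q : ℕ} {c : (Fin q → I) → N}
    (h : ∀ (σ : Equiv.Perm (Fin q)) (y : Fin q → I), c (y ∘ σ) = (Equiv.Perm.sign σ : ℤ) • c y) :
    IsSkew c := by
  induction q with
  | zero => trivial
  | succ q ih =>
    cases q with
    | zero => trivial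
    | succ q =>
      refine ⟨fun x y z => ?_, fun x => ih fun σ y => ?_⟩
      · have e : (Fin.cons x (Fin.cons y z) : Fin (q + 2) → I) =
            (Fin.cons y (Fin.cons x z) : Fin (q + 2) → I) ∘ Equiv.swap 0 1 := by
          funext i
          refine Fin.cases ?_ (fun i => Fin.cases ?_ (fun i => ?_) i) i
          · simp
          · have : (Fin.succ 0 : Fin (q + 2)) = 1 := rfl
            simp [this]
          · rw [Function.comp_apply, Equiv.swap_apply_of_ne_of_ne]
            · simp
            · exact Fin.succ_ne_zero _
            · intro h
              exact Fin.succ_ne_zero i (Fin.succ_injective _ (h.trans Fin.succ_zero_eq_one.symm))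
        rw [e, h, Equiv.Perm.sign_swap (by simp)]
        simp
      · have e : (Fin.cons x (y ∘ σ) : Fin (q + 2) → I) =
            (Fin.cons x y : Fin (q + 2) → I) ∘ succPerm (q + 1) σ := by
          funext i
          cases i using Fin.cases <;> simp [succPerm_zero, succPerm_succ]
        rw [e, h, sign_succPerm]

/-- The Lie derivative on skew functions. -/
theorem lieDer_eq_sum_cons (x : I) (q : ℕ) {c : (Fin (q + 1) → I) → N} (hc : IsSkew c)
    (y : Fin (q + 1) → I) :
    G.lieDer x (q + 1) c y = G.act x (c y) -
      ∑ l : Fin (q + 1), (-1 : R) ^ (l : ℕ) • G.coef x (y l) •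
        c (Fin.cons (G.mul x (y l)) fun t => y (l.succAbove t)) := by
  induction q with
  | zero =>
    obtain ⟨z, y, rfl⟩ : ∃ z y', y = Fin.cons z y' := ⟨y 0, Fin.tail y, (Fin.cons_self_tail y).symm⟩
    have := congrFun (G.contract_lieDer x z 0 c) y
    rw [contract_apply] at this
    rw [this]
    simp [lieDer_zero, contract_apply, Subsingleton.elim _ y]
  | succ q ih =>
    obtain ⟨z, y, rfl⟩ : ∃ z y', y = Fin.cons z y' := ⟨y 0, Fin.tail y, (Fin.cons_self_tail y).symm⟩
    have := congrFun (G.contract_lieDer x z (q + 1) c) y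
    rw [contract_apply] at this
    rw [this, Pi.sub_apply, ih (hc.contract z)]
    conv_rhs => rw [Fin.sum_univ_succ]
    have e (l : Fin (q + 1)) : (fun t => (Fin.cons z y : Fin (q + 2) → I) (l.succ.succAbove t)) =
        Fin.cons z fun t => y (l.succAbove t) := by
      funext t; cases t using Fin.cases <;> simp
    simp only [contract_apply, Pi.smul_apply, Fin.cons_zero, Fin.cons_succ, e, Fin.val_zero,
      pow_zero, one_smul, Fin.succAbove_zero, hc.1 _ z, Fin.val_succ, pow_succ, smul_neg, mul_neg,
      mul_one, neg_smul, neg_neg]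
    abel

/-- The usual formula for the differential. -/
def diffSum : ∀ q, ((Fin q → I) → N) → (Fin (q + 1) → I) → N
  | 0, c, y => G.act (y 0) (c fun i => y i.succ)
  | q + 1, c, y => ∑ k : Fin (q + 2), (-1 : R) ^ (k : ℕ) • G.act (y k) (c fun i => y (k.succAbove i)) +
      ∑ i : Fin (q + 1), ∑ j ∈ Finset.Ici i, (-1 : R) ^ ((i.castSucc : ℕ) + (j.succ : ℕ)) •
        G.coef (y i.castSucc) (y j.succ) • c (Fin.cons (G.mul (y i.castSucc) (y j.succ))
          fun t => y (i.castSucc.succAbove (j.succAbove t)))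

/-- Split off the first argument `x`. The summand `k = 0` and the pairs containing position `0` make
up `L_x c`; everything else is `-d(ι_x c)`. Skew-symmetry is what allows a bracket placed in front
to be exchanged with `x`. -/
theorem diffSum_eq_diff (q : ℕ) {c : (Fin q → I) → N} (hc : IsSkew c) :
    G.diffSum q c = G.diff q c := by
  induction q with
  | zero => rfl
  | succ q ih =>
    funext y
    obtain ⟨x, y, rfl⟩ : ∃ z y', y = Fin.cons z y' := ⟨y 0, Fin.tail y, (Fin.cons_self_tail y).symm⟩
    have := congrFun (G.contract_diff x q c) y
    rw [contract_apply] at this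
    rw [this, Pi.sub_apply, ← ih (hc.contract x), lieDer_eq_sum_cons _ _ _ hc, diffSum]
    have e (l : Fin (q + 1)) : (fun t => (Fin.cons x y : Fin (q + 2) → I) (l.succ.succAbove t)) =
        Fin.cons x fun t => y (l.succAbove t) := by
      funext t; cases t using Fin.cases <;> simp
    -- The pairs `k < l` with `k = 0`, which are the sum occurring in `lieDer_eq_sum_cons`.
    have e0 : (∑ j ∈ Finset.Ici (0 : Fin (q + 1)),
        (-1 : R) ^ (((0 : Fin (q + 1)).castSucc : ℕ) + (j.succ : ℕ)) •
        G.coef ((Fin.cons x y : Fin (q + 2) → I) (0 : Fin (q + 1)).castSucc)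
          ((Fin.cons x y : Fin (q + 2) → I) j.succ) •
        c (Fin.cons (G.mul ((Fin.cons x y : Fin (q + 2) → I) (0 : Fin (q + 1)).castSucc)
          ((Fin.cons x y : Fin (q + 2) → I) j.succ))
          fun t => (Fin.cons x y : Fin (q + 2) → I)
            ((0 : Fin (q + 1)).castSucc.succAbove (j.succAbove t)))) =
      -∑ l : Fin (q + 1), (-1 : R) ^ (l : ℕ) • G.coef x (y l) •
        c (Fin.cons (G.mul x (y l)) fun t => y (l.succAbove t)) := by
      rw [← Finset.sum_neg_distrib]
      refine Finset.sum_congr (by ext; simp) fun j _ => ?_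
      simp [pow_succ]
    rw [Fin.sum_univ_succ, Fin.sum_univ_succ (fun i : Fin (q + 1) => Finset.sum (Finset.Ici i) _), e0]
    cases q with
    | zero =>
      have e2 : (fun i : Fin 1 => (Fin.cons x y : Fin 2 → I) (Fin.succAbove 1 i)) =
          Fin.cons x fun t => y t.succ := e 0
      simp [diffSum, contract_apply, e2]
      abel
    | succ q =>
      -- The pairs not involving `x`. Both positions move by one, which leaves the sign unchanged,
      -- and swapping the bracket with `x` contributes the minus.
      have e1 : (∑ i : Fin (q + 1), ∑ j ∈ Finset.Ici i.succ,
          (-1 : R) ^ ((i.succ.castSucc : ℕ) + (j.succ : ℕ)) •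
          G.coef ((Fin.cons x y : Fin (q + 3) → I) i.succ.castSucc)
            ((Fin.cons x y : Fin (q + 3) → I) j.succ) •
          c (Fin.cons (G.mul ((Fin.cons x y : Fin (q + 3) → I) i.succ.castSucc)
            ((Fin.cons x y : Fin (q + 3) → I) j.succ))
            fun t => (Fin.cons x y : Fin (q + 3) → I)
              (i.succ.castSucc.succAbove (j.succAbove t)))) =
          -∑ i : Fin (q + 1), ∑ j ∈ Finset.Ici i, (-1 : R) ^ ((i.castSucc : ℕ) + (j.succ : ℕ)) •
            G.coef (y i.castSucc) (y j.succ) • contract (R := R) x c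
              (Fin.cons (G.mul (y i.castSucc) (y j.succ))
                fun t => y (i.castSucc.succAbove (j.succAbove t))) := by
        rw [← Finset.sum_neg_distrib]
        refine Finset.sum_congr rfl fun i _ => ?_
        rw [← Fin.map_succEmb_Ici, Finset.sum_map, ← Finset.sum_neg_distrib]
        refine Finset.sum_congr rfl fun j _ => ?_
        have e2 : (fun t => (Fin.cons x y : Fin (q + 3) → I)
            (i.succ.castSucc.succAbove (j.succ.succAbove t))) =
            Fin.cons x fun t => y (i.castSucc.succAbove (j.succAbove t)) := by
          funext t
          cases t using Fin.cases <;> simp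
        rw [Fin.coe_succEmb, e2, contract_apply, hc.1 _ x, ← Fin.succ_castSucc]
        simp only [Fin.cons_succ, Fin.val_succ, pow_succ, pow_add, smul_neg]
        simp
      rw [e1]
      simp only [diffSum, Fin.cons_succ, e, contract_apply, Fin.cons_zero, Fin.val_zero,
        pow_zero, one_smul, Fin.succAbove_zero, Fin.val_succ, pow_succ, mul_neg, mul_one, neg_smul,
        Finset.sum_neg_distrib]
      abel

end Calculus

end LetterAlgebra

/-! ### Evaluation of cochains of `W(0)` -/

section Evaluation

variable {F : Type u} [Field F]

/-- The generators `L` (for `true`) and `H` (for `false`). -/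
def gen (F : Type u) [Field F] (b : Bool) : WModule F := bif b then genL F else genH F

variable (F) in
/-- The bracket of the elements `L_t`, `H_t` (`t ∈ R`) of the annihilation algebra, acting on
`R ⊗ W(0)`. -/
def letters (R : Type*) [CommRing R] [Algebra F R] :
    LetterAlgebra R (Bool × R) (R ⊗[F] WModule F) where
  mul x y := (x.1 && y.1, x.2 + y.2)
  coef x y := (bif y.1 then x.2 else 0) - bif x.1 then y.2 else 0
  act x := act (wBracket (0 : F)) x.2 (gen F x.1)
  assoc x y z := by simp [Bool.and_assoc, add_assoc]
  left_comm x y z := by simp [Bool.and_left_comm, add_left_comm]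
  jacobi := by
    rintro ⟨x | x, r⟩ ⟨y | y, s⟩ ⟨z | z, t⟩ <;> simp <;> ring
  act_act := by
    have e' (s t : R ⊗[F] Polynomial F) (p : Polynomial F) :
        wSubst s (Polynomial.aeval t p) = Polynomial.aeval (wSubst s t) p :=
      (Polynomial.aeval_algHom_apply ((wSubst s).restrictScalars F) t p).symm
    have e'' (s t u : R ⊗[F] Polynomial F) : wSubst s (wSubst t u) = wSubst (wSubst s t) u := by
      induction u with
      | zero => simp
      | tmul r p => rw [wSubst_tmul, map_mul, wSubst_wPar, e', wSubst_tmul]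
      | add x y hx hy => rw [map_add, map_add, hx, hy, map_add]
    have a1 (s t : R) : wPar F (s + t) = wPar F s + wPar F t := TensorProduct.add_tmul _ _ _
    have a2 (s t : R) : wPar F (s - t) = wPar F s - wPar F t := TensorProduct.sub_tmul _ _ _
    have a3 (s : R) : wPar F (-s) = - wPar F s := TensorProduct.neg_tmul _ _
    have a4 : wPar F (0 : R) = 0 := TensorProduct.zero_tmul _ _
    -- The shifts `∂ ↦ ∂ + s + t` and `∂ ↦ ∂ + t + s` sit inside `wSubst`, out of reach of `ring`,
    -- and must be brought to one form beforehand.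
    have f2 (s t d : R ⊗[F] Polynomial F) : d + s + t = d + t + s := by ring
    rintro ⟨x | x, s⟩ ⟨y | y, t⟩ n <;> obtain ⟨u, v, rfl⟩ := wPair_surj n <;>
    simp only [gen, genL, genH, act_wPair, e'', wSubst_wPar, wSubst_wDel, map_zero, map_one,
      map_mul, map_add, map_ofNat, sub_zero, one_mul, zero_mul, mul_zero, zero_add, add_zero,
      neg_zero, cond_true, cond_false, Bool.and_true, Bool.and_false, zero_sub, wPair_smul,
      wPair_add, a1, a2, a3, a4, ← add_assoc, f2 (wPar F t) (wPar F s) (wDel F R)] <;>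
    congr 1 <;> ring

/-- An antilinear `g` sees `∂` as `-(s + t)`, for parameters `s`, `t` of the two letters. Under this
substitution `∂ + 2λ`, `∂ + λ`, `λ` at `λ = s` become `s - t`, `-t`, `s`: the structure constants of
`letters`. -/
theorem liftBaseChange_bracket_gen {R N : Type*} [CommRing R] [Algebra F R] [AddCommGroup N]
    [Module F N] [Module R N] [IsScalarTower F R N] (g : WModule F →ₗ[F] N) (x y : Bool × R)
    (hg : ∀ c, g (wDer F c) = -((x.2 + y.2) • g c)) :
    g.liftBaseChange R (chg _ (Polynomial.aeval x.2) (wBracket (0 : F) (gen F x.1) (gen F y.1))) =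
      (letters F R).coef x y • g (gen F ((letters F R).mul x y).1) := by
  have hLL := WAlgebra_bracket_LL (0 : F)
  have hLH := WAlgebra_bracket_LH (0 : F)
  have hHL := WAlgebra_bracket_HL (0 : F)
  have hHH := WAlgebra_bracket_HH (0 : F)
  simp only [WAlgebra] at hLL hLH hHL hHH
  obtain ⟨x | x, s⟩ := x <;> obtain ⟨y | y, t⟩ := y <;>
    simp only [gen, letters, cond_true, cond_false, Bool.and_true, Bool.and_false, hLL, hLH, hHL,
      hHH, map_add, map_zero, chg_tmul, LinearMap.liftBaseChange_tmul, map_one, hg, map_mul,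
      Polynomial.aeval_X, map_ofNat, sub_zero, one_smul, zero_smul, neg_zero, zero_add, zero_sub,
      ← neg_smul, ← add_smul] <;>
    congr 1 <;> ring

variable (F) in
/-- The values of a cochain on the elements `L_t`, `H_t`, where `t ∈ R`. -/
def evalAt (R : Type*) [CommRing R] [Algebra F R] {q : ℕ}
    (f : RawCochain F (WModule F) (WModule F) q) (y : Fin q → Bool × R) : R ⊗[F] WModule F :=
  chg _ (MvPolynomial.aeval fun i => (y i).2) (f fun i => gen F (y i).1)

variable {R : Type*} [CommRing R] [Algebra F R]

theorem chg_singleTerm {q : ℕ} (f : RawCochain F (WModule F) (WModule F) q)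
    (k : Fin (q + 1)) (y : Fin (q + 1) → Bool × R) :
    chg _ (MvPolynomial.aeval fun i => (y i).2)
      (act (wBracket (0 : F)) (MvPolynomial.X k : MvPolynomial (Fin (q + 1)) F) (gen F (y k).1)
        (chg _ (MvPolynomial.rename k.succAbove) (f fun i => gen F (y (k.succAbove i)).1))) =
      (letters F R).act (y k) (evalAt F R f fun i => y (k.succAbove i)) := by
  rw [chg_act, chg_chg, MvPolynomial.aeval_X]
  congr 2
  refine congrFun (congrArg _ ?_) _
  congr 1
  ext i
  simp

/-- The bracket is first evaluated with the variables `λ_k`, `λ_l` as parameters, where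
antilinearity of `f` applies, and then specialised to the parameters of `y`. -/
theorem chg_rawD₂Term {q : ℕ} (f : RawCochain F (WModule F) (WModule F) (q + 1))
    (hf : f ∈ basicCochain (wAdjoint (0 : F)) (q + 1)) (k : Fin (q + 2)) (j : Fin (q + 1))
    (y : Fin (q + 2) → Bool × R) :
    chg _ (MvPolynomial.aeval fun i => (y i).2)
      (rawD₂Term (wBracket (0 : F)) q k j f fun i => gen F (y i).1) =
      (letters F R).coef (y k) (y (k.succAbove j)) • evalAt F R f
        (Fin.cons ((letters F R).mul (y k) (y (k.succAbove j)))
          fun t => y (k.succAbove (j.succAbove t))) := by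
  have key := liftBaseChange_bracket_gen
    (insertFirst q k j f fun t => gen F (y (k.succAbove (j.succAbove t))).1)
    ((y k).1, MvPolynomial.X k) ((y (k.succAbove j)).1, MvPolynomial.X (k.succAbove j))
    (insertFirst_der (D := wDer F) q k j f hf.1 _)
  rw [rawD₂Term_apply, key, chg_smul, insertFirst_apply, chg_chg, evalAt]
  congr 1
  · cases h1 : (y k).1 <;> cases h2 : (y (k.succAbove j)).1 <;> simp [letters, h1, h2]
  · congr 1
    · congr 1
      ext i
      cases i using Fin.cases <;> simp [letters]
    · congr 1
      funext i
      cases i using Fin.cases <;> simp [letters]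

theorem isSkew_evalAt {q : ℕ} {f : RawCochain F (WModule F) (WModule F) q}
    (hf : f ∈ basicCochain (wAdjoint (0 : F)) q) : LetterAlgebra.IsSkew (evalAt F R f) := by
  refine LetterAlgebra.isSkew_of_perm fun σ y => ?_
  have := congrArg (chg (WModule F) (MvPolynomial.aeval fun i => (y i).2))
    (hf.2 σ fun i => gen F (y i).1)
  rw [chg_chg, LinearMap.map_smul, Int.cast_smul_eq_zsmul] at this
  rw [evalAt, evalAt, ← this]
  congr 1
  congr 1
  ext i
  simp

/-- The bridge to `LetterAlgebra`: antilinearity turns conformal brackets into brackets of letters,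
and skew-symmetry identifies the alternating sums with the recursive differential. -/
theorem evalAt_rawD {q : ℕ} {f : RawCochain F (WModule F) (WModule F) q}
    (hf : f ∈ basicCochain (wAdjoint (0 : F)) q) :
    evalAt F R (rawD (wAdjoint (0 : F)) q f) = (letters F R).diff q (evalAt F R f) := by
  rw [← LetterAlgebra.diffSum_eq_diff _ _ (isSkew_evalAt hf)]
  funext y
  have e1 (q : ℕ) (f : RawCochain F (WModule F) (WModule F) q) (y : Fin (q + 1) → Bool × R) :
      chg _ (MvPolynomial.aeval fun i => (y i).2)
        (rawD₁ (wBracket (0 : F)) q f fun i => gen F (y i).1) =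
      ∑ k : Fin (q + 1), (-1 : R) ^ (k : ℕ) •
        (letters F R).act (y k) (evalAt F R f fun i => y (k.succAbove i)) := by
    rw [rawD₁_apply, map_sum]
    refine Finset.sum_congr rfl fun k _ => ?_
    rw [LinearMap.map_smul, chg_singleTerm, ← algebraMap_smul R ((-1 : F) ^ (k : ℕ))]
    simp
  cases q with
  | zero =>
    refine (e1 0 f y).trans ?_
    simp [LetterAlgebra.diffSum]
  | succ q =>
    have e2 : evalAt F R (rawD (wAdjoint (0 : F)) (q + 1) f) y =
        chg _ (MvPolynomial.aeval fun i => (y i).2)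
          (rawD₁ (wBracket (0 : F)) (q + 1) f fun i => gen F (y i).1) +
        chg _ (MvPolynomial.aeval fun i => (y i).2)
          (rawD₂ (wBracket (0 : F)) q f fun i => gen F (y i).1) := map_add _ _ _
    rw [e2, e1, LetterAlgebra.diffSum]
    congr 1
    simp only [rawD₂, LinearMap.sum_apply, sum_apply, map_sum, LinearMap.smul_apply, smul_apply,
      LinearMap.map_smul, chg_rawD₂Term f hf]
    refine Finset.sum_congr rfl fun i _ => Finset.sum_congr rfl fun j hj => ?_
    have h : i.castSucc.succAbove j = j.succ :=
      Fin.succAbove_of_le_castSucc _ _ (by simpa using hj)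
    rw [h, ← algebraMap_smul R]
    simp

end Evaluation

/-! ### Cochains are determined by their values on generators -/

section Extensionality

variable {F : Type u} [Field F]

/-- The basis `∂ⁿ L` (indexed by `(true, n)`), `∂ⁿ H` (indexed by `(false, n)`) of `W(0)`. -/
def wBasis (F : Type u) [Field F] : Module.Basis (Bool × ℕ) F (WModule F) :=
  ((Polynomial.basisMonomials F).prod (Polynomial.basisMonomials F)).reindex
    ((Equiv.sumComm ℕ ℕ).trans (Equiv.boolProdEquivSum ℕ).symm)

theorem wBasis_apply (b : Bool) (n : ℕ) :
    wBasis F (b, n) = (Polynomial.X ^ n : Polynomial F) • gen F b := by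
  cases b <;>
    simp [wBasis, gen, genL, genH, Polynomial.X_pow_eq_monomial]

theorem wBasis_zero (b : Bool) : wBasis F (b, 0) = gen F b := by
  rw [wBasis_apply, pow_zero, one_smul]

theorem wBasis_succ (b : Bool) (n : ℕ) : wBasis F (b, n + 1) = wDer F (wBasis F (b, n)) := by
  rw [wBasis_apply, wBasis_apply, wDer_apply, smul_smul, pow_succ']

/-- A cochain is determined by its values on the generators. -/
theorem basicCochain_ext {q : ℕ} {f g : RawCochain F (WModule F) (WModule F) q}
    (hf : f ∈ basicCochain (wAdjoint (0 : F)) q) (hg : g ∈ basicCochain (wAdjoint (0 : F)) q)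
    (h : ∀ w : Fin q → Bool, f (fun i => gen F (w i)) = g fun i => gen F (w i)) : f = g := by
  refine Module.Basis.ext_multilinear (fun _ => wBasis F) fun v => ?_
  obtain ⟨N, hN⟩ : ∃ N, N = ∑ i, (v i).2 := ⟨_, rfl⟩
  induction N generalizing v with
  | zero =>
    have hv (i : Fin q) : (v i).2 = 0 := Finset.sum_eq_zero_iff.1 hN.symm i (Finset.mem_univ i)
    have e (i : Fin q) : wBasis F (v i) = gen F (v i).1 := by
      rw [← wBasis_zero, ← hv i]
    simp only [e, h]
  | succ N ih =>
    obtain ⟨i, -, hi⟩ : ∃ i ∈ Finset.univ, (v i).2 ≠ 0 :=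
      Finset.exists_ne_zero_of_sum_ne_zero (by rw [← hN]; exact N.succ_ne_zero)
    obtain ⟨n, hn⟩ := Nat.exists_eq_succ_of_ne_zero hi
    -- Remove one `∂` from the `i`-th argument. Antilinearity recovers the value at `v` from the
    -- value at `v'`, whose total exponent is one less.
    set v' : Fin q → Bool × ℕ := Function.update v i ((v i).1, n) with hv'
    have e : (fun j => wBasis F (v j)) = Function.update (fun j => wBasis F (v' j)) i
        (wDer F (wBasis F (v' i))) := by
      funext j
      by_cases hj : j = i
      · subst hj
        rw [Function.update_self, hv', Function.update_self, ← wBasis_succ]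
        exact congrArg _ (Prod.ext rfl hn)
      · rw [Function.update_of_ne hj, hv', Function.update_of_ne hj]
    have hs := ih v' (by
      have h1 := Finset.sum_update_of_mem (Finset.mem_univ i) (fun j => (v j).2) n
      have h2 := Finset.add_sum_erase Finset.univ (fun j => (v j).2) (Finset.mem_univ i)
      have h3 : ∑ j, (v' j).2 = ∑ j, Function.update (fun j => (v j).2) i n j := by
        refine Finset.sum_congr rfl fun j _ => ?_
        by_cases hj : j = i
        · subst hj; simp [hv']
        · simp [hv', hj]
      rw [h3, h1, ← Finset.erase_eq]
      simp only [hn] at h2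
      omega)
    rw [e]
    have h1 := hf.1 (fun j => wBasis F (v' j)) i
    rw [hs, ← hg.1 (fun j => wBasis F (v' j)) i] at h1
    exact h1

end Extensionality

/-! ### Cochains with prescribed values on generators -/

section Construction

variable {F : Type u} [Field F]

/-- The coefficient of `a ∈ W(0)` at the generator `b`, with `∂` replaced by `-λ_i`. -/
def genCoeff {q : ℕ} (b : Bool) (i : Fin q) : WModule F →ₗ[F] MvPolynomial (Fin q) F :=
  (Polynomial.aeval (-MvPolynomial.X i : MvPolynomial (Fin q) F)).toLinearMap ∘ₗ
    bif b then LinearMap.fst F _ _ else LinearMap.snd F _ _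

theorem genCoeff_der {q : ℕ} (b : Bool) (i : Fin q) (a : WModule F) :
    genCoeff b i (wDer F a) = -MvPolynomial.X i * genCoeff b i a := by
  cases b <;> simp [genCoeff, wDer_apply]

theorem genCoeff_gen {q : ℕ} (b c : Bool) (i : Fin q) :
    genCoeff b i (gen F c) = if b = c then 1 else 0 := by
  cases b <;> cases c <;> simp [genCoeff, gen, genL, genH]

theorem rename_genCoeff {q : ℕ} (b : Bool) (i : Fin q) (a : WModule F) (σ : Equiv.Perm (Fin q)) :
    MvPolynomial.rename σ (genCoeff b i a) = genCoeff b (σ i) a := by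
  cases b <;> simp [genCoeff, ← Polynomial.aeval_algHom_apply]

/-- The conformally antilinear map with prescribed values on the generators. -/
def ofValues {q : ℕ} (P : (Fin q → Bool) → MvPolynomial (Fin q) F ⊗[F] WModule F) :
    RawCochain F (WModule F) (WModule F) q :=
  ∑ w : Fin q → Bool,
    ((LinearMap.toSpanSingleton (MvPolynomial (Fin q) F) _ (P w)).restrictScalars
      F).compMultilinearMap
      ((MultilinearMap.mkPiAlgebra F (Fin q) (MvPolynomial (Fin q) F)).compLinearMap
        fun i => genCoeff (w i) i)

theorem ofValues_apply {q : ℕ} (P : (Fin q → Bool) → MvPolynomial (Fin q) F ⊗[F] WModule F)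
    (a : Fin q → WModule F) :
    ofValues P a = ∑ w, (∏ i, genCoeff (w i) i (a i)) • P w := by
  simp only [ofValues, sum_apply]
  rfl

theorem ofValues_gen {q : ℕ} (P : (Fin q → Bool) → MvPolynomial (Fin q) F ⊗[F] WModule F)
    (w : Fin q → Bool) : ofValues P (fun i => gen F (w i)) = P w := by
  rw [ofValues_apply, Finset.sum_eq_single w]
  · simp [genCoeff_gen]
  · intro v _ hv
    obtain ⟨i, hi⟩ := Function.ne_iff.1 hv
    rw [Finset.prod_eq_zero (Finset.mem_univ i) (by simp [genCoeff_gen, hi]), zero_smul]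
  · simp

/-- Since `P` is arbitrary off the symmetry condition, antilinearity has to come from the factors
`genCoeff`; skew-symmetry follows by reindexing the sum over words along `σ`. -/
theorem ofValues_mem {q : ℕ} {P : (Fin q → Bool) → MvPolynomial (Fin q) F ⊗[F] WModule F}
    (hP : ∀ (σ : Equiv.Perm (Fin q)) (w : Fin q → Bool),
      chg _ (MvPolynomial.rename σ) (P (w ∘ σ)) = ((Equiv.Perm.sign σ : ℤ) : F) • P w) :
    ofValues P ∈ basicCochain (wAdjoint (0 : F)) q := by
  refine ⟨fun a i => ?_, fun σ a => ?_⟩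
  · rw [ofValues_apply, ofValues_apply, Finset.smul_sum, ← Finset.sum_neg_distrib]
    refine Finset.sum_congr rfl fun w _ => ?_
    rw [smul_smul, ← neg_smul, ← Finset.mul_prod_erase _ _ (Finset.mem_univ i),
      ← Finset.mul_prod_erase Finset.univ (fun i => genCoeff (w i) i (a i)) (Finset.mem_univ i),
      Function.update_self]
    have : (WAlgebra (0 : F)).der = wDer F := rfl
    rw [this, genCoeff_der]
    have e : ∏ j ∈ Finset.univ.erase i, genCoeff (w j) j (Function.update a i (wDer F (a i)) j) =
        ∏ j ∈ Finset.univ.erase i, genCoeff (w j) j (a j) :=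
      Finset.prod_congr rfl fun j hj => by rw [Function.update_of_ne (Finset.ne_of_mem_erase hj)]
    rw [e]
    congr 1
    ring
  · rw [ofValues_apply, ofValues_apply, map_sum, Finset.smul_sum,
      ← Equiv.sum_comp (Equiv.arrowCongr σ (Equiv.refl Bool)).symm]
    refine Finset.sum_congr rfl fun w _ => ?_
    have e : (Equiv.arrowCongr σ (Equiv.refl Bool)).symm w = w ∘ σ := rfl
    rw [e, chg_smul, hP, map_prod, smul_comm]
    congr 2
    simp only [rename_genCoeff, Function.comp_apply]
    exact Equiv.prod_comp σ fun i => genCoeff (w i) i (a i)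

end Construction

/-! ### The differential squares to zero -/

section Square

variable {F : Type u} [Field F]

variable (F) in
/-- The letters `L`, `H` with the variables `λ_i` as parameters. -/
def genericLetters {q : ℕ} (w : Fin q → Bool) : Fin q → Bool × MvPolynomial (Fin q) F :=
  fun i => (w i, MvPolynomial.X i)

theorem evalAt_genericLetters {q : ℕ} (f : RawCochain F (WModule F) (WModule F) q)
    (w : Fin q → Bool) :
    evalAt F _ f (genericLetters F w) = f fun i => gen F (w i) := by
  have : (MvPolynomial.aeval fun i => (genericLetters F w i).2) =
      AlgHom.id F (MvPolynomial (Fin q) F) := by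
    ext i; simp [genericLetters]
  rw [evalAt, this]
  simp [chg, genericLetters]

/-- Evaluation at the letters with parameters `λ_1, …, λ_{q+2}` recovers the values on generators,
so `diff_diff` over this one ring suffices. -/
theorem basicD_basicD [CharZero F] (q : ℕ) (f : basicCochain (wAdjoint (0 : F)) q) :
    basicD (wAdjoint (0 : F)) (q + 1) (basicD (wAdjoint (0 : F)) q f) = 0 := by
  refine Subtype.ext (basicCochain_ext (Subtype.prop _) (Submodule.zero_mem _) fun w => ?_)
  have h := evalAt_rawD (R := MvPolynomial (Fin (q + 2)) F) (basicD (wAdjoint (0 : F)) q f).2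
  have h' := evalAt_rawD (R := MvPolynomial (Fin (q + 2)) F) f.2
  have e : (basicD (wAdjoint (0 : F)) q f).1 = rawD (wAdjoint (0 : F)) q f.1 := rfl
  rw [e, h', LetterAlgebra.diff_diff] at h
  have := congrFun h (genericLetters F w)
  rwa [evalAt_genericLetters] at this

end Square

/-! ### Naturality of the differential in the letters -/

namespace LetterAlgebra

section Naturality

variable {R I N R' I' N' : Type*} [CommRing R] [AddCommGroup N] [Module R N]
  [CommRing R'] [AddCommGroup N'] [Module R' N'] (G : LetterAlgebra R I N)
  (G' : LetterAlgebra R' I' N') (j : I → I') (e : N' →+ N)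

theorem map_lieDer (hmul : ∀ x y, G'.mul (j x) (j y) = j (G.mul x y))
    (hcoef : ∀ x y n, e (G'.coef (j x) (j y) • n) = G.coef x y • e n)
    (hact : ∀ x n, e (G'.act (j x) n) = G.act x (e n)) (x : I) (q : ℕ) (c' : (Fin q → I') → N')
    (c : (Fin q → I) → N) (h : ∀ y, e (c' (j ∘ y)) = c y) (y : Fin q → I) :
    e (G'.lieDer (j x) q c' (j ∘ y)) = G.lieDer x q c y := by
  have hu (l : Fin q) : Function.update (j ∘ y) l (G'.mul (j x) (j (y l))) =
      j ∘ Function.update y l (G.mul x (y l)) := by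
    rw [Function.comp_update, ← hmul]
  simp only [lieDer_apply, map_sub, map_sum, Function.comp_apply, hu, hcoef, hact, h]

/-- The map `e` is only additive, and compatible with coefficients and actions of letters in the
image of `j`. This is what extraction of a coefficient of `μ` satisfies: it is linear over constants
but not over polynomials in `μ`. -/
theorem map_diff (hmul : ∀ x y, G'.mul (j x) (j y) = j (G.mul x y))
    (hcoef : ∀ x y n, e (G'.coef (j x) (j y) • n) = G.coef x y • e n)
    (hact : ∀ x n, e (G'.act (j x) n) = G.act x (e n)) (q : ℕ) (c' : (Fin q → I') → N')
    (c : (Fin q → I) → N) (h : ∀ y, e (c' (j ∘ y)) = c y) (y : Fin (q + 1) → I) :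
    e (G'.diff q c' (j ∘ y)) = G.diff q c y := by
  induction q with
  | zero =>
    exact (hact _ _).trans (congrArg _ (h _))
  | succ q ih =>
    have e1 : G'.diff (q + 1) c' (j ∘ y) = G'.lieDer (j (y 0)) (q + 1) c' (j ∘ Fin.tail y) -
      G'.diff q (contract (R := R') (j (y 0)) c') (j ∘ Fin.tail y) := rfl
    have e2 : G.diff (q + 1) c y = G.lieDer (y 0) (q + 1) c (Fin.tail y) -
      G.diff q (contract (R := R) (y 0) c) (Fin.tail y) := rfl
    rw [e1, e2, map_sub, map_lieDer G G' j e hmul hcoef hact _ _ c' c h,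
      ih _ (contract (R := R) (y 0) c)]
    intro z
    rw [contract_apply, contract_apply, ← h]
    congr 2
    funext i
    cases i using Fin.cases <;> simp

end Naturality

end LetterAlgebra

/-! ### Coefficients with respect to an extra parameter -/

section CoeffTensor

variable {F : Type u} [Field F] {M : Type*} [AddCommGroup M] [Module F M]
variable {R : Type*} [CommRing R] [Algebra F R]

/-- The coefficient of `μⁿ` of an element of `R[μ] ⊗ M`. -/
def coeffTensor (F : Type u) [Field F] (M : Type*) [AddCommGroup M] [Module F M] (R : Type*)
    [CommRing R] [Algebra F R] (n : ℕ) : Polynomial R ⊗[F] M →ₗ[F] R ⊗[F] M :=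
  LinearMap.rTensor M ((Polynomial.lcoeff R n).restrictScalars F)

@[simp]
theorem coeffTensor_tmul (n : ℕ) (p : Polynomial R) (m : M) :
    coeffTensor F M R n (p ⊗ₜ m) = p.coeff n ⊗ₜ m := rfl

theorem coeffTensor_smul (n : ℕ) (r : R) (v : Polynomial R ⊗[F] M) :
    coeffTensor F M R n (Polynomial.C r • v) = r • coeffTensor F M R n v := by
  induction v with
  | zero => simp
  | tmul p m => simp [TensorProduct.smul_tmul']
  | add x y hx hy => rw [smul_add, map_add, hx, hy, map_add, smul_add]

theorem coeffTensor_chg {S : Type*} [CommRing S] [Algebra F S] (φ : R →ₐ[F] S) (n : ℕ)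
    (v : Polynomial R ⊗[F] M) :
    coeffTensor F M S n (chg M (Polynomial.mapAlgHom φ) v) = chg M φ (coeffTensor F M R n v) := by
  induction v with
  | zero => simp
  | tmul p m => simp
  | add x y hx hy => simp only [map_add, hx, hy]

theorem coeffTensor_act {A : Type*} [AddCommGroup A] [Module F A]
    (β : A →ₗ[F] M →ₗ[F] Polynomial F ⊗[F] M) (n : ℕ) (t : R) (a : A) (v : Polynomial R ⊗[F] M) :
    coeffTensor F M R n (act β (Polynomial.C t) a v) = act β t a (coeffTensor F M R n v) := by
  induction v with
  | zero => simp
  | tmul p m =>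
    simp only [act, LinearMap.liftBaseChange_tmul, coeffTensor_tmul, LinearMap.comp_apply]
    induction β a m with
    | zero => simp
    | tmul s m =>
      have : Polynomial.aeval (Polynomial.C t) s = Polynomial.C (Polynomial.aeval t s) := by
        have := Polynomial.aeval_algHom_apply (Polynomial.CAlgHom : R →ₐ[F] Polynomial R) t s
        simpa using this
      simp [this, TensorProduct.smul_tmul']
    | add x y hx hy => simp only [map_add, smul_add, hx, hy]
  | add x y hx hy => simp only [map_add, hx, hy]

end CoeffTensor

/-! ### Contraction with `L_μ` and Cartan's formula -/

section Contraction

variable {F : Type u} [Field F]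

/-- The elements `L_t`, `H_t` with `t` considered as a constant polynomial. -/
def constLetter {R : Type*} [CommRing R] (x : Bool × R) : Bool × Polynomial R :=
  (x.1, Polynomial.C x.2)

/-- Contraction with `L` at the parameter `μ`, coefficient of `μⁿ`. -/
def rawContract (F : Type u) [Field F] (n q : ℕ) :
    RawCochain F (WModule F) (WModule F) (q + 1) →ₗ[F]
      RawCochain F (WModule F) (WModule F) q where
  toFun f := (coeffTensor F (WModule F) (MvPolynomial (Fin q) F) n ∘ₗ
    chg _ (MvPolynomial.finSuccEquiv F q).toAlgHom).compMultilinearMap (f.curryLeft (genL F))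
  map_add' f g := by ext; simp
  map_smul' c f := by ext; simp

theorem rawContract_apply (n q : ℕ) (f : RawCochain F (WModule F) (WModule F) (q + 1))
    (a : Fin q → WModule F) :
    rawContract F n q f a = coeffTensor F (WModule F) (MvPolynomial (Fin q) F) n
      (chg _ (MvPolynomial.finSuccEquiv F q).toAlgHom (f (Fin.cons (genL F) a))) := rfl

/-- Both properties are inherited from the last `q` arguments; for skew-symmetry, use the
permutations fixing the inserted first place. -/
theorem rawContract_mem (n q : ℕ) {f : RawCochain F (WModule F) (WModule F) (q + 1)}
    (hf : f ∈ basicCochain (wAdjoint (0 : F)) (q + 1)) :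
    rawContract F n q f ∈ basicCochain (wAdjoint (0 : F)) q := by
  refine ⟨fun a i => ?_, fun σ a => ?_⟩
  · have := hf.1 (Fin.cons (genL F) a) i.succ
    rw [Fin.cons_succ, ← Fin.cons_update] at this
    rw [rawContract_apply, this, map_neg, map_neg, chg_smul, rawContract_apply]
    simp [MvPolynomial.finSuccEquiv_X_succ, coeffTensor_smul]
  · have := hf.2 (succPerm q σ) (Fin.cons (genL F) a)
    have e : (Fin.cons (genL F) a : Fin (q + 1) → WModule F) ∘ succPerm q σ =
        Fin.cons (genL F) (a ∘ σ) := by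
      funext i
      cases i using Fin.cases <;> simp [succPerm_zero, succPerm_succ]
    rw [e, sign_succPerm] at this
    rw [rawContract_apply, rawContract_apply, ← LinearMap.map_smul, ← LinearMap.map_smul, ← this,
      ← coeffTensor_chg, chg_chg, chg_chg]
    congr 1
    refine congrFun (congrArg DFunLike.coe (congrArg (chg _)
      (MvPolynomial.algHom_ext fun i => ?_))) _
    cases i using Fin.cases <;>
      simp [succPerm_zero, succPerm_succ, MvPolynomial.finSuccEquiv_X_zero,
        MvPolynomial.finSuccEquiv_X_succ]

theorem evalAt_rawContract {R : Type*} [CommRing R] [Algebra F R] (n : ℕ) {q : ℕ}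
    (f : RawCochain F (WModule F) (WModule F) (q + 1)) (y : Fin q → Bool × R) :
    evalAt F R (rawContract F n q f) y = coeffTensor F (WModule F) R n
      (evalAt F (Polynomial R) f (Fin.cons (true, Polynomial.X) (constLetter ∘ y))) := by
  rw [evalAt, rawContract_apply, ← coeffTensor_chg, chg_chg, evalAt]
  congr 1
  have e : (fun i => gen F ((Fin.cons (true, Polynomial.X) (constLetter ∘ y) :
      Fin (q + 1) → Bool × Polynomial R) i).1) =
      Fin.cons (genL F) fun i => gen F (y i).1 := by
    funext i
    cases i using Fin.cases <;> simp [gen, constLetter]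
  rw [e]
  congr 2
  ext i
  cases i using Fin.cases <;>
    simp [MvPolynomial.finSuccEquiv_X_zero, MvPolynomial.finSuccEquiv_X_succ, constLetter]

/-- The remaining letters do not involve `μ`, so taking a coefficient of `μ` commutes with the
differential by `map_diff`. -/
theorem coeffTensor_diff {R : Type*} [CommRing R] [Algebra F R] (n q : ℕ)
    (f : RawCochain F (WModule F) (WModule F) (q + 1)) (y : Fin (q + 1) → Bool × R) :
    coeffTensor F (WModule F) R n ((letters F (Polynomial R)).diff q
      (LetterAlgebra.contract (R := Polynomial R) (true, Polynomial.X)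
        (evalAt F (Polynomial R) f)) (constLetter ∘ y)) =
      (letters F R).diff q (evalAt F R (rawContract F n q f)) y := by
  refine LetterAlgebra.map_diff (letters F R) (letters F (Polynomial R)) constLetter
    (coeffTensor F (WModule F) R n).toAddMonoidHom ?_ ?_ ?_ q _ _ ?_ y
  · intro x y
    simp [letters, constLetter]
  · intro x y v
    refine Eq.trans (congrArg _ (congrArg (· • v) ?_)) (coeffTensor_smul n _ v)
    obtain ⟨_ | _, s⟩ := x <;> obtain ⟨_ | _, t⟩ := y <;> simp [letters, constLetter]
  · intro x v
    exact coeffTensor_act _ _ _ _ _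
  · intro y
    exact (evalAt_rawContract n f y).symm

theorem cartan_zero (n : ℕ) {f : RawCochain F (WModule F) (WModule F) 0}
    (hf : f ∈ basicCochain (wAdjoint (0 : F)) 0) (w : Fin 0 → Bool) :
    rawContract F n 0 (rawD (wAdjoint (0 : F)) 0 f) (fun i => gen F (w i)) =
      coeffTensor F (WModule F) (MvPolynomial (Fin 0) F) n
        ((letters F (Polynomial (MvPolynomial (Fin 0) F))).lieDer (true, Polynomial.X) 0
          (evalAt F _ f) (constLetter ∘ genericLetters F w)) := by
  rw [← evalAt_genericLetters, evalAt_rawContract, evalAt_rawD hf]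
  rfl

/-- Cartan's formula for the letter `L_μ` over polynomials in `μ`, followed by extraction of the
coefficient of `μⁿ`. -/
theorem cartan_succ (n q : ℕ) {f : RawCochain F (WModule F) (WModule F) (q + 1)}
    (hf : f ∈ basicCochain (wAdjoint (0 : F)) (q + 1)) (w : Fin (q + 1) → Bool) :
    rawContract F n (q + 1) (rawD (wAdjoint (0 : F)) (q + 1) f) (fun i => gen F (w i)) +
      rawD (wAdjoint (0 : F)) q (rawContract F n q f) (fun i => gen F (w i)) =
      coeffTensor F (WModule F) (MvPolynomial (Fin (q + 1)) F) n
        ((letters F (Polynomial (MvPolynomial (Fin (q + 1)) F))).lieDer (true, Polynomial.X)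
          (q + 1) (evalAt F _ f) (constLetter ∘ genericLetters F w)) := by
  rw [← evalAt_genericLetters, ← evalAt_genericLetters, evalAt_rawContract, evalAt_rawD hf,
    evalAt_rawD (rawContract_mem n q hf), ← coeffTensor_diff, ← map_add]
  congr 1
  have := congrFun ((letters F (Polynomial (MvPolynomial (Fin (q + 1)) F))).contract_diff
    (true, Polynomial.X) q (evalAt F _ f)) (constLetter ∘ genericLetters F w)
  rw [LetterAlgebra.contract_apply, Pi.sub_apply] at this
  rw [this, sub_add_cancel]

end Contraction

/-! ### First Taylor coefficients of a shift in one variable -/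

section Translation

variable {F : Type u} [Field F] {q : ℕ}

/-- The substitution `λ_l ↦ μ + λ_l`. -/
def translate (F : Type u) [Field F] {q : ℕ} (l : Fin q) :
    MvPolynomial (Fin q) F →ₐ[F] Polynomial (MvPolynomial (Fin q) F) :=
  MvPolynomial.aeval (Function.update (fun i => Polynomial.C (MvPolynomial.X i)) l
    (Polynomial.X + Polynomial.C (MvPolynomial.X l)))

theorem coeff_zero_translate (l : Fin q) (p : MvPolynomial (Fin q) F) :
    (translate F l p).coeff 0 = p := by
  induction p using MvPolynomial.induction_on with
  | C a => simp [translate, MvPolynomial.algebraMap_eq]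
  | add p r hp hr => rw [map_add, Polynomial.coeff_add, hp, hr]
  | mul_X p i hp =>
    rw [map_mul, Polynomial.mul_coeff_zero, hp]
    by_cases h : i = l
    · subst h; simp [translate]
    · simp [translate, h]

theorem coeff_one_translate (l : Fin q) (p : MvPolynomial (Fin q) F) :
    (translate F l p).coeff 1 = MvPolynomial.pderiv l p := by
  induction p using MvPolynomial.induction_on with
  | C a => simp [translate, MvPolynomial.algebraMap_eq]
  | add p r hp hr => rw [map_add, Polynomial.coeff_add, hp, hr, map_add]
  | mul_X p i hp =>
    rw [map_mul, Polynomial.mul_coeff_one, hp, coeff_zero_translate, Derivation.leibniz,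
      MvPolynomial.pderiv_X]
    by_cases h : i = l
    · subst h; simp [translate]; ring
    · simp [translate, h, Polynomial.coeff_C]; ring

end Translation

/-! ### The Lie derivative along `L_μ` to first order in `μ` -/

section LieDerivatives

variable {F : Type u} [Field F]

theorem coeffTensor_baseChange {M : Type*} [AddCommGroup M] [Module F M] {R : Type*} [CommRing R]
    [Algebra F R] (D : M →ₗ[F] M) (n : ℕ) (v : Polynomial R ⊗[F] M) :
    coeffTensor F M R n (D.baseChange (Polynomial R) v) =
      D.baseChange R (coeffTensor F M R n v) := by
  induction v with
  | zero => simp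
  | tmul p m => simp
  | add x y hx hy => simp only [map_add, hx, hy]

theorem coeffTensor_sub_C_smul {M : Type*} [AddCommGroup M] [Module F M] {R : Type*} [CommRing R]
    [Algebra F R] (n : ℕ) (p : Polynomial R) (r : R) (v : Polynomial R ⊗[F] M) :
    coeffTensor F M R n ((p - Polynomial.C r) • v) =
      coeffTensor F M R n (p • v) - r • coeffTensor F M R n v := by
  have h : (p - Polynomial.C r) • v + Polynomial.C r • v = p • v := by
    rw [← add_smul, sub_add_cancel]
  rw [eq_sub_iff_add_eq, ← coeffTensor_smul, ← map_add, h]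

theorem coeffTensor_zero_X_smul {M : Type*} [AddCommGroup M] [Module F M] {R : Type*} [CommRing R]
    [Algebra F R] (v : Polynomial R ⊗[F] M) :
    coeffTensor F M R 0 ((Polynomial.X : Polynomial R) • v) = 0 := by
  induction v with
  | zero => simp
  | tmul p m => simp [TensorProduct.smul_tmul']
  | add x y hx hy => rw [smul_add, map_add, hx, hy, add_zero]

theorem coeffTensor_succ_X_smul {M : Type*} [AddCommGroup M] [Module F M] {R : Type*} [CommRing R]
    [Algebra F R] (n : ℕ) (v : Polynomial R ⊗[F] M) :
    coeffTensor F M R (n + 1) ((Polynomial.X : Polynomial R) • v) = coeffTensor F M R n v := by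
  induction v with
  | zero => simp
  | tmul p m => simp [TensorProduct.smul_tmul']
  | add x y hx hy => rw [smul_add, map_add, hx, hy, map_add]

/-- Checked on `∂ⁿL` and `∂ⁿH`: sesquilinearity makes each further `∂` act on the bracket as `∂ +
λ`, that is, as `∂` at `λ = 0`. -/
theorem coeffTensor_zero_bracket (x : WModule F) :
    coeffTensor F (WModule F) F 0 (wBracket (0 : F) (genL F) x) = 1 ⊗ₜ wDer F x := by
  have h : coeffTensor F (WModule F) F 0 ∘ₗ wBracket (0 : F) (genL F) =
      TensorProduct.mk F F (WModule F) 1 ∘ₗ wDer F := by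
    refine (wBasis F).ext fun ⟨b, n⟩ => ?_
    simp only [LinearMap.comp_apply, TensorProduct.mk_apply]
    induction n with
    | zero =>
      have h1 := WAlgebra_bracket_LL (0 : F)
      have h2 := WAlgebra_bracket_LH (0 : F)
      simp only [WAlgebra] at h1 h2
      cases b <;> simp [wBasis_zero, gen, h1, h2]
    | succ n ih =>
      have := (WAlgebra (0 : F)).bracket_der_right (genL F) (wBasis F (b, n))
      simp only [WAlgebra] at this
      rw [wBasis_succ, this, map_add, coeffTensor_zero_X_smul, coeffTensor_baseChange, ih, add_zero,
        LinearMap.baseChange_tmul]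
  exact LinearMap.congr_fun h x

/-- The linear coefficient measures conformal weight: `1` for `H`, `2` for `L`. Each `∂` adds one,
because the `λ` in `∂ + λ` picks up the constant coefficient, which is `∂` applied to the element.
-/
theorem coeffTensor_one_bracket (b : Bool) (n : ℕ) :
    coeffTensor F (WModule F) F 1 (wBracket (0 : F) (genL F) (wBasis F (b, n))) =
      (1 : F) ⊗ₜ ((n + 1 + (bif b then 1 else 0) : F) • wBasis F (b, n)) := by
  induction n with
  | zero =>
    have h1 := WAlgebra_bracket_LL (0 : F)
    have h2 := WAlgebra_bracket_LH (0 : F)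
    simp only [WAlgebra] at h1 h2
    cases b
    · simp [wBasis_zero, gen, h2, Polynomial.coeff_one]
    · simp [wBasis_zero, gen, h1, Polynomial.coeff_one, one_add_one_eq_two, TensorProduct.smul_tmul',
        ← Polynomial.C_ofNat]
  | succ n ih =>
    have := (WAlgebra (0 : F)).bracket_der_right (genL F) (wBasis F (b, n))
    simp only [WAlgebra] at this
    rw [wBasis_succ, this, map_add, coeffTensor_succ_X_smul, coeffTensor_baseChange, ih,
      coeffTensor_zero_bracket, LinearMap.baseChange_tmul, map_smul, ← TensorProduct.tmul_add]
    congr 1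
    nth_rw 2 [← one_smul F (wDer F _)]
    rw [← add_smul]
    congr 1
    push_cast
    ring

theorem coeffTensor_act_genL {R : Type*} [CommRing R] [Algebra F R] (n : ℕ) (r : R)
    (x : WModule F) :
    coeffTensor F (WModule F) R n (act (wBracket (0 : F)) Polynomial.X (genL F)
      (chg _ Polynomial.CAlgHom (r ⊗ₜ x))) =
      r • chg _ (Algebra.ofId F R) (coeffTensor F (WModule F) F n
        (wBracket (0 : F) (genL F) x)) := by
  simp only [act, chg_tmul, Polynomial.CAlgHom_apply, LinearMap.liftBaseChange_tmul,
    coeffTensor_smul, LinearMap.comp_apply]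
  congr 1
  rw [← coeffTensor_chg]
  congr 1

/-- The coefficient at `μⁿ` of the Lie derivative of a cochain along `L_μ`. -/
theorem coeffTensor_lieDer (n : ℕ) {q : ℕ} (f : RawCochain F (WModule F) (WModule F) q)
    (w : Fin q → Bool) :
    coeffTensor F (WModule F) (MvPolynomial (Fin q) F) n
        ((letters F (Polynomial (MvPolynomial (Fin q) F))).lieDer (true, Polynomial.X) q
          (evalAt F _ f) (constLetter ∘ genericLetters F w)) =
      coeffTensor F (WModule F) (MvPolynomial (Fin q) F) n
        (act (wBracket (0 : F)) Polynomial.X (genL F)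
          (chg _ Polynomial.CAlgHom (f fun i => gen F (w i)))) -
      ∑ l, coeffTensor F (WModule F) (MvPolynomial (Fin q) F) n
        (((bif w l then Polynomial.X else 0) - Polynomial.C (MvPolynomial.X l) :
          Polynomial (MvPolynomial (Fin q) F)) •
          chg _ (translate F l) (f fun i => gen F (w i))) := by
  rw [LetterAlgebra.lieDer_apply, map_sub, map_sum]
  refine congrArg₂ (· - ·) (congrArg _ ?_) (Finset.sum_congr rfl fun l _ => congrArg _ ?_)
  · refine congrArg (act (wBracket (0 : F)) Polynomial.X (genL F)) ?_
    refine congrFun (congrArg DFunLike.coe (congrArg (chg _) (MvPolynomial.algHom_ext fun i => ?_)))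
      _
    simp [constLetter, genericLetters]
  · refine congrArg₂ (· • ·) (by simp [letters, constLetter, genericLetters]) ?_
    have e : (fun i => gen F (Function.update (constLetter ∘ genericLetters F w) l
        ((letters F (Polynomial (MvPolynomial (Fin q) F))).mul (true, Polynomial.X)
          ((constLetter ∘ genericLetters F w) l)) i).1) = fun i => gen F (w i) := by
      funext i
      by_cases h : i = l
      · subst h; simp [letters, constLetter, genericLetters]
      · simp [h, constLetter, genericLetters]
    rw [evalAt, e]
    refine congrFun (congrArg DFunLike.coe (congrArg (chg _) (MvPolynomial.algHom_ext fun i => ?_)))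
      _
    by_cases h : i = l
    · subst h; simp [letters, constLetter, genericLetters, translate]
    · simp [h, constLetter, genericLetters, translate]

/-- At `μ = 0` the bracket coefficient with the `l`-th letter is `-λ_l` and no variable is shifted,
so the Lie derivative is `∂ + ∑ λ_l`. This makes `∂` null-homotopic on the basic complex. -/
theorem coeffTensor_zero_lieDer {q : ℕ} (f : RawCochain F (WModule F) (WModule F) q)
    (w : Fin q → Bool) :
    coeffTensor F (WModule F) (MvPolynomial (Fin q) F) 0
        ((letters F (Polynomial (MvPolynomial (Fin q) F))).lieDer (true, Polynomial.X) q
          (evalAt F _ f) (constLetter ∘ genericLetters F w)) =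
      totalDer (wDer F) q (f fun i => gen F (w i)) := by
  rw [coeffTensor_lieDer, totalDer_apply, Finset.sum_smul]
  generalize (f fun i => gen F (w i)) = v
  rw [sub_eq_add_neg, ← Finset.sum_neg_distrib]
  congr 1
  · induction v with
    | zero => simp
    | tmul r x => rw [coeffTensor_act_genL, coeffTensor_zero_bracket]; simp [TensorProduct.smul_tmul']
    | add x y hx hy => simp only [map_add, hx, hy]
  · refine Finset.sum_congr rfl fun l _ => ?_
    induction v with
    | zero => simp
    | tmul r x =>
      cases w l <;>
        simp [TensorProduct.smul_tmul', sub_mul, coeff_zero_translate, TensorProduct.neg_tmul]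
    | add x y hx hy => simp only [map_add, smul_add, neg_add, hx, hy]

/-- The monomial basis of `F[λ_1, …, λ_q] ⊗ W(0)`. -/
def valueBasis (F : Type u) [Field F] (q : ℕ) :
    Module.Basis ((Fin q →₀ ℕ) × (Bool × ℕ)) F (MvPolynomial (Fin q) F ⊗[F] WModule F) :=
  (MvPolynomial.basisMonomials (Fin q) F).tensorProduct (wBasis F)

theorem valueBasis_apply {q : ℕ} (m : Fin q →₀ ℕ) (x : Bool × ℕ) :
    valueBasis F q (m, x) = MvPolynomial.monomial m 1 ⊗ₜ wBasis F x := by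
  simp [valueBasis]

/-- The weight of the monomial `m ⊗ x` as a value on the generators `w`. -/
def valueWeight {q : ℕ} (w : Fin q → Bool) (m : (Fin q →₀ ℕ) × (Bool × ℕ)) : ℤ :=
  ∑ i, (m.1 i : ℤ) + m.2.2 + 1 + (bif m.2.1 then 1 else 0) - ∑ i, bif w i then 1 else 0

theorem coord_apply_of_eigenbasis {V ι : Type*} [AddCommGroup V] [Module F V]
    (b : Module.Basis ι F V) (T : V →ₗ[F] V) (c : ι → F) (h : ∀ i, T (b i) = c i • b i) (i : ι)
    (v : V) : b.coord i (T v) = c i * b.coord i v := by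
  have : b.coord i ∘ₗ T = c i • b.coord i := by
    refine b.ext fun j => ?_
    by_cases hij : j = i
    · subst hij; simp [h]
    · simp [h, hij]
  exact LinearMap.congr_fun this v

theorem coord_act_genL {q : ℕ} (v : MvPolynomial (Fin q) F ⊗[F] WModule F)
    (m : (Fin q →₀ ℕ) × (Bool × ℕ)) :
    (valueBasis F q).coord m (coeffTensor F (WModule F) (MvPolynomial (Fin q) F) 1
      (act (wBracket (0 : F)) Polynomial.X (genL F) (chg _ Polynomial.CAlgHom v))) =
      (m.2.2 + 1 + (bif m.2.1 then 1 else 0)) * (valueBasis F q).coord m v := by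
  refine coord_apply_of_eigenbasis (valueBasis F q)
    (coeffTensor F (WModule F) (MvPolynomial (Fin q) F) 1 ∘ₗ
      (act (wBracket (0 : F)) Polynomial.X (genL F)).restrictScalars F ∘ₗ
        chg _ Polynomial.CAlgHom) (fun m => m.2.2 + 1 + (bif m.2.1 then 1 else 0)) ?_ m v
  rintro ⟨m, b, n⟩
  simp only [LinearMap.comp_apply, LinearMap.restrictScalars_apply, valueBasis_apply,
    coeffTensor_act_genL, coeffTensor_one_bracket]
  rw [TensorProduct.tmul_smul, LinearMap.map_smul, chg_tmul, map_one (Algebra.ofId F _), smul_comm,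
    TensorProduct.smul_tmul', smul_eq_mul, mul_one]

theorem coord_X_smul_pderiv {q : ℕ} (v : MvPolynomial (Fin q) F ⊗[F] WModule F)
    (m : (Fin q →₀ ℕ) × (Bool × ℕ)) (l : Fin q) :
    (valueBasis F q).coord m ((MvPolynomial.X l : MvPolynomial (Fin q) F) •
      LinearMap.rTensor (WModule F) (MvPolynomial.pderiv l).toLinearMap v) =
      m.1 l * (valueBasis F q).coord m v := by
  refine coord_apply_of_eigenbasis (valueBasis F q)
    (LinearMap.restrictScalars F (LinearMap.lsmul (MvPolynomial (Fin q) F) _ (MvPolynomial.X l)) ∘ₗ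
      LinearMap.rTensor (WModule F) (MvPolynomial.pderiv l).toLinearMap) (fun m => m.1 l) ?_ m v
  rintro ⟨m, x⟩
  have := MvPolynomial.X_mul_pderiv_monomial (i := l) (m := m) (r := (1 : F))
  simp only [LinearMap.comp_apply, LinearMap.restrictScalars_apply, valueBasis_apply,
    LinearMap.lsmul_apply, LinearMap.rTensor_tmul, TensorProduct.smul_tmul', smul_eq_mul]
  erw [this]
  rw [← Nat.cast_smul_eq_nsmul F]

/-- First order of `([w_l = L] μ - λ_l) v(…, μ + λ_l, …)`: either `μ` comes from the prefactor,
leaving `v`, or from the shift, leaving the derivative in `λ_l`. -/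
theorem coeffTensor_one_translate {q : ℕ} (w : Fin q → Bool) (l : Fin q)
    (v : MvPolynomial (Fin q) F ⊗[F] WModule F) :
    coeffTensor F (WModule F) (MvPolynomial (Fin q) F) 1
        (((bif w l then Polynomial.X else 0) - Polynomial.C (MvPolynomial.X l) :
          Polynomial (MvPolynomial (Fin q) F)) • chg _ (translate F l) v) =
      (bif w l then 1 else 0 : F) • v - (MvPolynomial.X l : MvPolynomial (Fin q) F) •
        LinearMap.rTensor (WModule F) (MvPolynomial.pderiv l).toLinearMap v := by
  induction v with
  | zero => simp
  | tmul r x =>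
    refine (coeffTensor_sub_C_smul _ _ _ _).trans ?_
    rw [chg_tmul, coeffTensor_tmul, coeff_one_translate]
    cases w l <;> simp [TensorProduct.smul_tmul', coeff_zero_translate]
  | add x y hx hy =>
    simp only [map_add, smul_add, hx, hy]
    abel

/-- The operators `λ_l ∂/∂λ_l` count degrees, the action on the value counts conformal weight, and
each argument `L` subtracts one: together they make the operator diagonal on monomials. -/
theorem coeffTensor_one_lieDer {q : ℕ} (f : RawCochain F (WModule F) (WModule F) q)
    (w : Fin q → Bool) (m : (Fin q →₀ ℕ) × (Bool × ℕ)) :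
    (valueBasis F q).coord m (coeffTensor F (WModule F) (MvPolynomial (Fin q) F) 1
        ((letters F (Polynomial (MvPolynomial (Fin q) F))).lieDer (true, Polynomial.X) q
          (evalAt F _ f) (constLetter ∘ genericLetters F w))) =
      (valueWeight w m : F) * (valueBasis F q).coord m (f fun i => gen F (w i)) := by
  simp only [coeffTensor_lieDer, map_sub, map_sum, coord_act_genL, coeffTensor_one_translate,
    coord_X_smul_pderiv, map_smul, smul_eq_mul, valueWeight, Finset.sum_sub_distrib,
    ← Finset.sum_mul]
  have e (b : Bool) : (((bif b then 1 else 0 : ℤ)) : F) = bif b then 1 else 0 := by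
    cases b <;> simp
  push_cast [e]
  ring

end LieDerivatives

/-! ### A criterion for bases of cohomology -/

section CohomologyBasis

variable {F : Type u} [Field F] {C : ℕ → Type v} [∀ q, AddCommGroup (C q)] [∀ q, Module F (C q)]

theorem isCohomologyBasis_of_span_of_indep {d : ∀ q, C q →ₗ[F] C (q + 1)} {q n : ℕ}
    {f : Fin n → C q} (h : ∀ i, d q (f i) = 0)
    (hspan : ∀ z, d q z = 0 → ∃ c : Fin n → F, z - ∑ i, c i • f i ∈ coboundaries d q)
    (hindep : ∀ c : Fin n → F, ∑ i, c i • f i ∈ coboundaries d q → c = 0) :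
    IsCohomologyBasis d q f := by
  set g : Fin n → Cohomology d q := fun i => Submodule.Quotient.mk ⟨f i, h i⟩ with hg
  have hsum (c : Fin n → F) (z : LinearMap.ker (d q)) :
      (Submodule.Quotient.mk z : Cohomology d q) = ∑ i, c i • g i ↔
        z.1 - ∑ i, c i • f i ∈ coboundaries d q := by
    have : ∑ i, c i • g i = Submodule.Quotient.mk (∑ i, c i • ⟨f i, h i⟩) := by
      simp only [hg, ← Submodule.mkQ_apply, map_sum, map_smul]
    rw [this, Submodule.Quotient.eq]
    refine Iff.trans Submodule.mem_comap ?_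
    simp
  refine ⟨h, Module.Basis.mk (v := g) ?_ ?_, fun i => Module.Basis.mk_apply _ _ i⟩
  · refine Fintype.linearIndependent_iff.2 fun c hc => congrFun (hindep c ?_)
    have := (hsum c 0).1 (by rw [hc]; rfl)
    rwa [ZeroMemClass.coe_zero, zero_sub, Submodule.neg_mem_iff] at this
  · rintro z -
    obtain ⟨z, rfl⟩ := Submodule.Quotient.mk_surjective _ z
    obtain ⟨c, hc⟩ := hspan z z.2
    rw [(hsum c z).2 hc]
    exact Submodule.sum_mem _ fun i _ => Submodule.smul_mem _ _ (Submodule.subset_span ⟨i, rfl⟩)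

theorem IsCohomologyBasis.rank_eq {d : ∀ q, C q →ₗ[F] C (q + 1)} {q n : ℕ}
    {f : Fin n → C q} (h : IsCohomologyBasis d q f) : Module.rank F (Cohomology d q) = n := by
  obtain ⟨_, b, _⟩ := h
  rw [rank_eq_card_basis b, Fintype.card_fin]

end CohomologyBasis

/-! ### Cohomology as the kernel of a semisimple null-homotopic operator -/

section Homotopy

variable {F : Type u} [Field F] {C : ℕ → Type v} [∀ q, AddCommGroup (C q)] [∀ q, Module F (C q)]

/-- A complex with a homotopy `h` such that `K = d h + h d` has zero as a semisimple eigenvalue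
and `d` vanishes on the kernel of `K`. -/
structure SemisimpleHomotopy (d : ∀ q, C q →ₗ[F] C (q + 1)) where
  h : ∀ q, C (q + 1) →ₗ[F] C q
  K : ∀ q, Module.End F (C q)
  d_d : ∀ q c, d (q + 1) (d q c) = 0
  cartan_zero : ∀ c, h 0 (d 0 c) = K 0 c
  cartan_succ : ∀ q c, h (q + 1) (d (q + 1) c) + d q (h q c) = K (q + 1) c
  algebraic : ∀ q c, ∃ Q : Polynomial F, Q.coeff 0 = 1 ∧ K q (Polynomial.aeval (K q) Q c) = 0
  d_ker : ∀ q c, K q c = 0 → d q c = 0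

namespace SemisimpleHomotopy

variable {d : ∀ q, C q →ₗ[F] C (q + 1)} (S : SemisimpleHomotopy d)

theorem d_K (q : ℕ) (c : C q) : d q (S.K q c) = S.K (q + 1) (d q c) := by
  rw [← S.cartan_succ, S.d_d, map_zero, zero_add]
  cases q with
  | zero => rw [S.cartan_zero]
  | succ q => rw [← S.cartan_succ, map_add, S.d_d, add_zero]

theorem d_aeval (Q : Polynomial F) (q : ℕ) (c : C q) :
    d q (Polynomial.aeval (S.K q) Q c) = Polynomial.aeval (S.K (q + 1)) Q (d q c) := by
  induction Q using Polynomial.induction_on with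
  | C a => simp [Polynomial.aeval_C, Module.algebraMap_end_apply]
  | add p r hp hr => simp only [map_add, LinearMap.add_apply, hp, hr]
  | monomial n a h =>
    have e (q : ℕ) : Polynomial.aeval (S.K q) (Polynomial.C a * Polynomial.X ^ (n + 1)) =
        S.K q * Polynomial.aeval (S.K q) (Polynomial.C a * Polynomial.X ^ n) := by
      rw [pow_succ', mul_left_comm, map_mul, Polynomial.aeval_X]
    rw [e, e, Module.End.mul_apply, Module.End.mul_apply, S.d_K, h]

theorem aeval_eq (q : ℕ) (Q : Polynomial F) (hQ : Q.coeff 0 = 1) (c : C q) :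
    Polynomial.aeval (S.K q) Q c = Polynomial.aeval (S.K q) Q.divX (S.K q c) + c := by
  conv_lhs => rw [← Polynomial.divX_mul_X_add Q, hQ]
  simp

/-- With `Q(0) = 1`, the cocycle `c` and its projection `Q(K)c ∈ ker K` differ by a polynomial in
`K` applied to `Kc = dhc`, and such polynomials commute with `d`. -/
theorem exists_ker_sub_mem (q : ℕ) (c : C q) (hc : d q c = 0) :
    ∃ v, S.K q v = 0 ∧ c - v ∈ coboundaries d q := by
  obtain ⟨Q, hQ, hv⟩ := S.algebraic q c
  refine ⟨_, hv, ?_⟩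
  rw [S.aeval_eq q Q hQ, sub_add_cancel_right, Submodule.neg_mem_iff]
  cases q with
  | zero => rw [← S.cartan_zero, hc, map_zero, map_zero]; exact Submodule.zero_mem _
  | succ q =>
    rw [← S.cartan_succ, hc, map_zero, zero_add, ← S.d_aeval]
    exact ⟨_, rfl⟩

/-- Let `v = dg` with `Kv = 0`, and choose `Q` for `g`. Then `Q(K)g` is in `ker K`, so `d` kills it;
but `dQ(K)g = Q(K)v = v`. -/
theorem eq_zero_of_mem_coboundaries (q : ℕ) (v : C q) (hv : S.K q v = 0)
    (h : v ∈ coboundaries d q) : v = 0 := by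
  cases q with
  | zero => exact h
  | succ q =>
    obtain ⟨g, rfl⟩ := h
    obtain ⟨Q, hQ, hg⟩ := S.algebraic q g
    have := S.d_ker q _ hg
    rw [S.d_aeval, S.aeval_eq _ _ hQ, hv, map_zero, zero_add] at this
    exact this

/-- A family which is a basis of the kernel of `K`. -/
def IsKerBasis (q : ℕ) {n : ℕ} (f : Fin n → C q) : Prop :=
  (∀ i, S.K q (f i) = 0) ∧ (∀ v, S.K q v = 0 → ∃ c : Fin n → F, v = ∑ i, c i • f i) ∧
    ∀ c : Fin n → F, ∑ i, c i • f i = 0 → c = 0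

variable {S}

theorem IsKerBasis.sum_mem {q n : ℕ} {f : Fin n → C q} (hf : S.IsKerBasis q f) (c : Fin n → F) :
    S.K q (∑ i, c i • f i) = 0 := by
  simp [map_sum, hf.1]

theorem IsKerBasis.isCohomologyBasis {q n : ℕ} {f : Fin n → C q} (hf : S.IsKerBasis q f) :
    IsCohomologyBasis d q f := by
  refine isCohomologyBasis_of_span_of_indep (fun i => S.d_ker q _ (hf.1 i)) (fun z hz => ?_)
    fun c hc => hf.2.2 c (S.eq_zero_of_mem_coboundaries q _ (hf.sum_mem c) hc)
  obtain ⟨v, hv, hzv⟩ := S.exists_ker_sub_mem q z hz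
  obtain ⟨c, rfl⟩ := hf.2.1 v hv
  exact ⟨c, hzv⟩

end SemisimpleHomotopy

end Homotopy

/-! ### From basic to reduced cohomology -/

section Reduced

variable {F : Type u} [Field F] [CharZero F] {A : Type*} [AddCommGroup A] [Module F A]
  {M : Type*} [AddCommGroup M] [Module F M] {𝒜 : LieConformalAlgebra F A}
  {ℳ : LieConformalModule 𝒜 M}

theorem mem_coboundaries_reducedD_iff (q : ℕ) (f : basicCochain ℳ q) :
    toReduced ℳ q f ∈ coboundaries (C := ReducedCochain ℳ) (reducedD ℳ) q ↔
      ∃ k ∈ coboundaries (C := fun q => basicCochain ℳ q) (basicD ℳ) q, ∃ g,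
        f = k + basicDer ℳ q g := by
  have h0 (x y : basicCochain ℳ q) : toReduced ℳ q x = toReduced ℳ q y ↔
      ∃ g, basicDer ℳ q g = x - y := Submodule.Quotient.eq _
  cases q with
  | zero =>
    have := h0 f 0
    rw [map_zero, sub_zero] at this
    refine Iff.trans this ⟨fun ⟨g, hg⟩ => ⟨0, Submodule.zero_mem _, g, by rw [hg, zero_add]⟩, ?_⟩
    rintro ⟨k, hk, g, rfl⟩
    obtain rfl : k = 0 := hk
    exact ⟨g, (zero_add _).symm⟩
  | succ q =>
    constructor
    · rintro ⟨z, hz⟩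
      obtain ⟨z, rfl⟩ := Submodule.Quotient.mk_surjective _ z
      obtain ⟨g, hg⟩ := (h0 f (basicD ℳ q z)).1 hz.symm
      exact ⟨basicD ℳ q z, ⟨z, rfl⟩, g, by rw [hg]; abel⟩
    · rintro ⟨_, ⟨z, rfl⟩, g, rfl⟩
      exact ⟨toReduced ℳ q z, ((h0 _ _).2 ⟨g, by abel⟩).symm⟩

/-- A basic cocycle `g` satisfies `d(sg) = ∂g`, so `sg` is a reduced cocycle: `s` inverts the
connecting map `H^q → H̃^{q+1}` of the long exact sequence, which is onto because `∂` is
null-homotopic. -/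
theorem SemisimpleHomotopy.IsKerBasis.isCohomologyBasis_reduced
    {S : SemisimpleHomotopy (C := fun q => basicCochain ℳ q) (basicD ℳ)}
    (s : ∀ q, basicCochain ℳ (q + 1) →ₗ[F] basicCochain ℳ q)
    (hinj : ∀ q f, basicDer ℳ q f = 0 → f = 0)
    (hs0 : ∀ f, s 0 (basicD ℳ 0 f) = basicDer ℳ 0 f)
    (hs : ∀ q f, s (q + 1) (basicD ℳ (q + 1) f) + basicD ℳ q (s q f) = basicDer ℳ (q + 1) f)
    {q n m : ℕ} {f : Fin n → basicCochain ℳ q} {g : Fin m → basicCochain ℳ (q + 1)}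
    (hf : S.IsKerBasis q f) (hg : S.IsKerBasis (q + 1) g) :
    IsCohomologyBasis (reducedD ℳ) q
      (Fin.append (fun i => toReduced ℳ q (f i)) fun i => toReduced ℳ q (s q (g i))) := by
  have hdg (c : Fin m → F) : basicD ℳ (q + 1) (∑ i, c i • g i) = 0 :=
    S.d_ker _ _ (hg.sum_mem c)
  have hdf (c : Fin n → F) : basicD ℳ q (∑ i, c i • f i) = 0 :=
    S.d_ker _ _ (hf.sum_mem c)
  have hds (x : basicCochain ℳ (q + 1)) (hx : basicD ℳ (q + 1) x = 0) :
      basicD ℳ q (s q x) = basicDer ℳ (q + 1) x := by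
    rw [← hs, hx, map_zero, zero_add]
  have hsum (c : Fin (n + m) → F) : ∑ i, c i • (Fin.append (fun i => toReduced ℳ q (f i))
      fun i => toReduced ℳ q (s q (g i))) i = toReduced ℳ q
        (∑ i, c (Fin.castAdd m i) • f i + s q (∑ i, c (Fin.natAdd n i) • g i)) := by
    rw [Fin.sum_univ_add]
    simp only [Fin.append_left, Fin.append_right, map_add, map_sum, map_smul]
  have hred (x : basicCochain ℳ q) : reducedD ℳ q (toReduced ℳ q x) =
      toReduced ℳ (q + 1) (basicD ℳ q x) := rfl
  have hzero (q : ℕ) (x : basicCochain ℳ q) : toReduced ℳ q x = 0 ↔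
      ∃ y, basicDer ℳ q y = x := Submodule.Quotient.mk_eq_zero _
  refine isCohomologyBasis_of_span_of_indep (C := ReducedCochain ℳ) (fun i => ?_)
    (fun z hz => ?_) fun c hc => ?_
  · refine Fin.addCases (fun i => ?_) (fun i => ?_) i
    · rw [Fin.append_left, hred, S.d_ker q _ (hf.1 i), map_zero]
    · rw [Fin.append_right, hred, hds _ (S.d_ker _ _ (hg.1 i)), hzero]
      exact ⟨_, rfl⟩
  · obtain ⟨z, rfl⟩ := Submodule.Quotient.mk_surjective _ z
    obtain ⟨x, hx⟩ := (hzero _ _).1 hz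
    -- `dz = ∂x` represents the connecting map, and injectivity of `∂` makes `x` a cocycle.
    have hdx : basicD ℳ (q + 1) x = 0 := by
      apply hinj
      rw [← basicD_basicDer, hx]
      exact S.d_d q z
    obtain ⟨v, hv, k, hk⟩ := S.exists_ker_sub_mem (q + 1) x hdx
    obtain ⟨c', rfl⟩ := hg.2.1 v hv
    -- Writing `x = ∑ c'ᵢ gᵢ + dk`, the correction of `z` by `s(∑ c'ᵢ gᵢ)` and `∂k` has differential
    -- `∂x - ∂(∑ c'ᵢ gᵢ) - ∂dk = 0`.
    have hz' : basicD ℳ q (z - s q (∑ i, c' i • g i) - basicDer ℳ q k) = 0 := by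
      rw [map_sub, map_sub, hds _ (hdg c'), basicD_basicDer, hk, map_sub, ← hx]
      abel
    obtain ⟨v, hv, hzv⟩ := S.exists_ker_sub_mem q _ hz'
    obtain ⟨c, rfl⟩ := hf.2.1 v hv
    refine ⟨Fin.append c c', ?_⟩
    rw [hsum]
    simp only [Fin.append_left, Fin.append_right]
    refine (mem_coboundaries_reducedD_iff q (z - (∑ i, c i • f i + s q (∑ i, c' i • g i)))).2
      ⟨_, hzv, k, by abel⟩
  · rw [hsum, mem_coboundaries_reducedD_iff] at hc
    obtain ⟨k, hk, x, hx⟩ := hc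
    set v := ∑ i, c (Fin.castAdd m i) • f i with hv
    set y := ∑ i, c (Fin.natAdd n i) • g i with hy
    have hdk : basicD ℳ q k = 0 := by
      cases q with
      | zero =>
        obtain rfl : k = 0 := hk
        exact map_zero _
      | succ q =>
        obtain ⟨z, rfl⟩ := hk
        exact S.d_d q z
    -- Applying `d` to `v + sy = k + ∂x` gives `∂y = ∂dx`, and `∂` can be cancelled.
    have hyx : y = basicD ℳ q x := by
      rw [← sub_eq_zero]
      apply hinj
      rw [map_sub, ← basicD_basicDer, ← hds y (hdg _), ← zero_add (basicD ℳ q (s q y)),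
        ← hdf fun i => c (Fin.castAdd m i), ← map_add, ← hv, hx, map_add, hdk, zero_add, hv, hdf,
        sub_self]
    have hy0 : y = 0 := S.eq_zero_of_mem_coboundaries (q + 1) y (hg.sum_mem _) ⟨x, hyx.symm⟩
    have hdx : basicD ℳ q x = 0 := by rw [← hyx, hy0]
    -- Now `x` is a cocycle, so `∂x = d(sx)`, or `0` in degree `0`. Hence `v` is a coboundary in
    -- `ker K`.
    have hv0 : v = 0 := by
      refine S.eq_zero_of_mem_coboundaries q v (hf.sum_mem _) ?_
      rw [hy0, map_zero, add_zero] at hx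
      rw [hx]
      refine Submodule.add_mem _ hk ?_
      cases q with
      | zero => rw [← hs0, hdx, map_zero]; exact Submodule.zero_mem _
      | succ q => rw [← hs, hdx, map_zero, zero_add]; exact ⟨_, rfl⟩
    have h1 := hf.2.2 _ hv0
    have h2 := hg.2.2 _ hy0
    funext i
    exact Fin.addCases (fun i => congrFun h1 i) (fun i => congrFun h2 i) i

end Reduced

/-! ### Lower bound for a sum of distinct natural numbers -/

/-- Remove the maximum: it is at least the number of remaining elements, since these all lie below
it. -/
theorem _root_.Finset.card_mul_pred_le_two_mul_sum (t : Finset ℕ) :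
    (t.card : ℤ) * (t.card - 1) ≤ 2 * ∑ x ∈ t, (x : ℤ) := by
  induction t using Finset.induction_on_max with
  | empty => simp
  | insert a t h ih =>
    have ha : a ∉ t := fun h' => lt_irrefl _ (h a h')
    have hc : t.card ≤ a := by
      simpa using Finset.card_le_card fun x hx => Finset.mem_range.2 (h x hx)
    rw [Finset.card_insert_of_notMem ha, Finset.sum_insert ha]
    have hc' : (t.card : ℤ) ≤ a := by exact_mod_cast hc
    push_cast
    linarith

theorem _root_.Finset.card_mul_pred_le_two_mul_sum_of_injOn {ι : Type*} (s : Finset ι) (m : ι → ℕ)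
    (h : Set.InjOn m s) : (s.card : ℤ) * (s.card - 1) ≤ 2 * ∑ i ∈ s, (m i : ℤ) := by
  have := (s.image m).card_mul_pred_le_two_mul_sum
  rwa [Finset.card_image_of_injOn h, Finset.sum_image h] at this

/-! ### The Euler operator on basic cochains -/

section Operators

variable {F : Type u} [Field F]

/-- Contraction with `L` at the parameter `μ`, coefficient of `μⁿ`, on cochains. -/
def contractL (F : Type u) [Field F] (n q : ℕ) :
    basicCochain (wAdjoint (0 : F)) (q + 1) →ₗ[F] basicCochain (wAdjoint (0 : F)) q :=
  (rawContract F n q).restrict fun _ hf => rawContract_mem n q hf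

/-- The Lie derivative along the Euler element. -/
def eulerOp (F : Type u) [Field F] [CharZero F] :
    ∀ q, Module.End F (basicCochain (wAdjoint (0 : F)) q)
  | 0 => contractL F 1 0 ∘ₗ basicD (wAdjoint (0 : F)) 0
  | q + 1 => contractL F 1 (q + 1) ∘ₗ basicD (wAdjoint (0 : F)) (q + 1) +
      basicD (wAdjoint (0 : F)) q ∘ₗ contractL F 1 q

/-- The coefficient at `m` of the value of a cochain on the generators `w`. -/
def cochainCoeff {q : ℕ} (w : Fin q → Bool) (m : (Fin q →₀ ℕ) × (Bool × ℕ)) :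
    basicCochain (wAdjoint (0 : F)) q →ₗ[F] F where
  toFun f := (valueBasis F q).coord m (f.1 fun i => gen F (w i))
  map_add' _ _ := map_add _ _ _
  map_smul' _ _ := map_smul _ _ _

theorem cochainCoeff_apply {q : ℕ} (w : Fin q → Bool) (m : (Fin q →₀ ℕ) × (Bool × ℕ))
    (f : basicCochain (wAdjoint (0 : F)) q) :
    cochainCoeff w m f = (valueBasis F q).coord m (f.1 fun i => gen F (w i)) := rfl

theorem cochain_ext {q : ℕ} {f g : basicCochain (wAdjoint (0 : F)) q}
    (h : ∀ w m, cochainCoeff w m f = cochainCoeff w m g) : f = g :=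
  Subtype.ext <| basicCochain_ext f.2 g.2 fun w => (valueBasis F q).ext_elem fun m => h w m

theorem contractL_zero_basicD_zero [CharZero F] (f : basicCochain (wAdjoint (0 : F)) 0) :
    contractL F 0 0 (basicD (wAdjoint (0 : F)) 0 f) = basicDer (wAdjoint (0 : F)) 0 f := by
  refine Subtype.ext (basicCochain_ext (Subtype.prop _) (Subtype.prop _) fun w => ?_)
  exact (cartan_zero 0 f.2 w).trans (coeffTensor_zero_lieDer _ _)

theorem contractL_zero_basicD [CharZero F] (q : ℕ) (f : basicCochain (wAdjoint (0 : F)) (q + 1)) :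
    contractL F 0 (q + 1) (basicD (wAdjoint (0 : F)) (q + 1) f) +
      basicD (wAdjoint (0 : F)) q (contractL F 0 q f) =
      basicDer (wAdjoint (0 : F)) (q + 1) f := by
  refine Subtype.ext (basicCochain_ext (Subtype.prop _) (Subtype.prop _) fun w => ?_)
  exact (cartan_succ 0 q f.2 w).trans (coeffTensor_zero_lieDer _ _)

theorem cochainCoeff_eulerOp [CharZero F] {q : ℕ} (w : Fin q → Bool)
    (m : (Fin q →₀ ℕ) × (Bool × ℕ)) (f : basicCochain (wAdjoint (0 : F)) q) :
    cochainCoeff w m (eulerOp F q f) = valueWeight w m * cochainCoeff w m f := by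
  rw [cochainCoeff_apply, cochainCoeff_apply, ← coeffTensor_one_lieDer]
  cases q with
  | zero => exact congrArg _ (cartan_zero 1 f.2 w)
  | succ q => exact congrArg _ (cartan_succ 1 q f.2 w)

/-- Weights are integers, so in characteristic `0` an eigenvalue vanishes in `F` only if the weight
is `0`. -/
theorem eulerOp_eq_zero_iff [CharZero F] {q : ℕ} (f : basicCochain (wAdjoint (0 : F)) q) :
    eulerOp F q f = 0 ↔ ∀ w m, cochainCoeff w m f ≠ 0 → valueWeight w m = 0 := by
  constructor
  · intro h w m hm
    have := cochainCoeff_eulerOp w m f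
    rw [h, map_zero, eq_comm, mul_eq_zero] at this
    exact_mod_cast this.resolve_right hm
  · intro h
    refine cochain_ext fun w m => ?_
    rw [cochainCoeff_eulerOp, map_zero]
    by_cases hm : cochainCoeff w m f = 0
    · rw [hm, mul_zero]
    · rw [h w m hm, Int.cast_zero, zero_mul]

theorem cochainCoeff_aeval_eulerOp [CharZero F] {q : ℕ} (w : Fin q → Bool)
    (m : (Fin q →₀ ℕ) × (Bool × ℕ)) (f : basicCochain (wAdjoint (0 : F)) q) (Q : Polynomial F) :
    cochainCoeff w m (Polynomial.aeval (eulerOp F q) Q f) =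
      Q.eval (valueWeight w m : F) * cochainCoeff w m f := by
  induction Q using Polynomial.induction_on with
  | C a => simp [Polynomial.aeval_C, Module.algebraMap_end_apply]
  | add p r hp hr => simp only [map_add, LinearMap.add_apply, hp, hr, Polynomial.eval_add, add_mul]
  | monomial n a h =>
    rw [pow_succ', mul_left_comm, map_mul, Polynomial.aeval_X, Module.End.mul_apply,
      cochainCoeff_eulerOp, h, Polynomial.eval_mul (p := Polynomial.X), Polynomial.eval_X, mul_assoc]

theorem exists_eulerOp_aeval_eq_zero [CharZero F] {q : ℕ}
    (f : basicCochain (wAdjoint (0 : F)) q) :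
    ∃ Q : Polynomial F, Q.coeff 0 = 1 ∧ eulerOp F q (Polynomial.aeval (eulerOp F q) Q f) = 0 := by
  -- The nonzero weights occurring in `f`, finite in number. The polynomial `∏ (X - s)`, normalised
  -- to have constant term `1`, annihilates all of them and leaves only weight zero.
  set T : Finset ℤ := ((Finset.univ : Finset (Fin q → Bool)).biUnion fun w =>
    ((valueBasis F q).repr (f.1 fun i => gen F (w i))).support.image (valueWeight w)).erase 0
    with hT
  set P : Polynomial F := ∏ s ∈ T, (Polynomial.X - Polynomial.C (s : F)) with hP
  have hP0 : P.eval 0 ≠ 0 := by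
    rw [hP, Polynomial.eval_prod, Finset.prod_ne_zero_iff]
    intro s hs
    have : s ≠ 0 := Finset.ne_of_mem_erase hs
    simpa using this
  refine ⟨Polynomial.C (P.eval 0)⁻¹ * P, ?_, ?_⟩
  · rw [Polynomial.coeff_C_mul, Polynomial.coeff_zero_eq_eval_zero, inv_mul_cancel₀ hP0]
  · rw [eulerOp_eq_zero_iff]
    intro w m hm
    rw [cochainCoeff_aeval_eulerOp] at hm
    by_contra hw
    have hmem : valueWeight w m ∈ T := by
      refine Finset.mem_erase.2 ⟨hw, Finset.mem_biUnion.2 ⟨w, Finset.mem_univ _,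
        Finset.mem_image.2 ⟨m, Finsupp.mem_support_iff.2 (right_ne_zero_of_mul hm), rfl⟩⟩⟩
    refine left_ne_zero_of_mul hm ?_
    have : P.eval (valueWeight w m : F) = 0 := by
      rw [hP, Polynomial.eval_prod]
      exact Finset.prod_eq_zero hmem (by simp)
    rw [Polynomial.eval_mul, this, mul_zero]

end Operators

/-! ### Monomials allowed by skew-symmetry and weight zero -/

section Skewness

variable {F : Type u} [Field F]

theorem coord_chg_rename {q : ℕ} (σ : Equiv.Perm (Fin q)) (m m' : Fin q →₀ ℕ)
    (h : ∀ i, m' i = m (σ i)) (x : Bool × ℕ) (v : MvPolynomial (Fin q) F ⊗[F] WModule F) :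
    (valueBasis F q).coord (m, x) (chg _ (MvPolynomial.rename σ) v) =
      (valueBasis F q).coord (m', x) v := by
  have hm : m = Finsupp.mapDomain σ m' := by
    ext i
    obtain ⟨i, rfl⟩ := σ.surjective i
    rw [Finsupp.mapDomain_apply σ.injective, h]
  have : (valueBasis F q).coord (m, x) ∘ₗ chg _ (MvPolynomial.rename σ) =
      (valueBasis F q).coord (m', x) := by
    refine TensorProduct.ext' fun p y => ?_
    have e (m : Fin q →₀ ℕ) (p : MvPolynomial (Fin q) F) :
        (MvPolynomial.basisMonomials (Fin q) F).repr p m = MvPolynomial.coeff m p := rfl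
    simp [valueBasis, hm, e, MvPolynomial.coeff_rename_mapDomain σ σ.injective]
  exact LinearMap.congr_fun this v

theorem cochainCoeff_perm {q : ℕ} (σ : Equiv.Perm (Fin q)) (w w' : Fin q → Bool)
    (hw : ∀ i, w' i = w (σ i)) (m m' : Fin q →₀ ℕ) (hm : ∀ i, m' i = m (σ i)) (x : Bool × ℕ)
    (f : basicCochain (wAdjoint (0 : F)) q) :
    cochainCoeff w' (m', x) f = ((Equiv.Perm.sign σ : ℤ) : F) * cochainCoeff w (m, x) f := by
  have := congrArg ((valueBasis F q).coord (m, x)) (f.2.2 σ fun i => gen F (w i))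
  rw [coord_chg_rename σ m m' hm, map_smul, smul_eq_mul] at this
  have e : (fun i => gen F (w i)) ∘ σ = fun i => gen F (w' i) := by
    funext i; rw [hw]; rfl
  rwa [e] at this

theorem cochainCoeff_perm_ne_zero {q : ℕ} (σ : Equiv.Perm (Fin q)) {w w' : Fin q → Bool}
    (hw : ∀ i, w' i = w (σ i)) {m m' : Fin q →₀ ℕ} (hm : ∀ i, m' i = m (σ i)) {x : Bool × ℕ}
    {f : basicCochain (wAdjoint (0 : F)) q} (h : cochainCoeff w (m, x) f ≠ 0) :
    cochainCoeff w' (m', x) f ≠ 0 := by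
  rw [cochainCoeff_perm σ w w' hw m m' hm x f]
  rcases Int.units_eq_one_or (Equiv.Perm.sign σ) with h' | h' <;> simpa [h'] using h

/-- If generators and exponents agree at `i` and `j`, the transposition of `i` and `j` fixes the
coefficient and also negates it. -/
theorem exponents_ne [CharZero F] {q : ℕ} {w : Fin q → Bool} {m : (Fin q →₀ ℕ) × (Bool × ℕ)}
    {f : basicCochain (wAdjoint (0 : F)) q} (h : cochainCoeff w m f ≠ 0) {i j : Fin q}
    (hij : i ≠ j) (hw : w i = w j) : m.1 i ≠ m.1 j := by
  intro hm
  obtain ⟨m, x⟩ := m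
  have e {α : Type} (g : Fin q → α) (hg : g i = g j) (k : Fin q) : g k = g (Equiv.swap i j k) := by
    by_cases h1 : k = i
    · rw [h1, Equiv.swap_apply_left, hg]
    · by_cases h2 : k = j
      · rw [h2, Equiv.swap_apply_right, hg]
      · rw [Equiv.swap_apply_of_ne_of_ne h1 h2]
  have := cochainCoeff_perm (Equiv.swap i j) w w (e w hw) m m (e m hm) x f
  rw [Equiv.Perm.sign_swap hij] at this
  refine h (self_eq_neg.1 ?_)
  simpa using this

/-- The possible monomials of cochains of weight zero. -/
theorem weight_zero_constraints [CharZero F] {q : ℕ} {w : Fin q → Bool}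
    {m : (Fin q →₀ ℕ) × (Bool × ℕ)} {f : basicCochain (wAdjoint (0 : F)) q}
    (hf : eulerOp F q f = 0) (h : cochainCoeff w m f ≠ 0) :
    m.2 = (false, 0) ∧ ∑ i, m.1 i + 1 = (Finset.univ.filter fun i => w i = true).card ∧
      (Finset.univ.filter fun i => w i = true).card ≤ 2 ∧
      (Finset.univ.filter fun i => ¬ w i = true).card ≤ 1 := by
  have hw := (eulerOp_eq_zero_iff f).1 hf w m h
  have h1 := (Finset.univ.filter fun i => w i = true).card_mul_pred_le_two_mul_sum_of_injOn m.1
    fun i hi j hj hij => by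
      by_contra hne
      exact exponents_ne h hne (by simp_all) hij
  have h2 := (Finset.univ.filter fun i => ¬ w i = true).card_mul_pred_le_two_mul_sum_of_injOn m.1
    fun i hi j hj hij => by
      by_contra hne
      exact exponents_ne h hne (by simp_all) hij
  have h3 := Finset.sum_filter_add_sum_filter_not Finset.univ (fun i => w i = true)
    fun i => (m.1 i : ℤ)
  have h4 : ∑ i, (bif w i then 1 else 0 : ℤ) = (Finset.univ.filter fun i => w i = true).card := by
    simp [Bool.cond_eq_ite]
  rw [valueWeight, h4] at hw
  set a := (Finset.univ.filter fun i => w i = true).card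
  set c := (Finset.univ.filter fun i => ¬ w i = true).card
  set l : ℤ := bif m.2.1 then 1 else 0 with hl
  have hl0 : 0 ≤ l := by rw [hl]; cases m.2.1 <;> simp
  -- Weight zero says that the exponents sum to `a - 1 - m.2.2 - l`. Distinctness bounds twice this
  -- sum below by `a(a-1) + c(c-1)`.
  have h5 : ((a : ℤ) - 1) * (a - 2) + c * (c - 1) + 2 * m.2.2 + 2 * l ≤ 0 := by
    linarith
  have h6 : 0 ≤ ((a : ℤ) - 1) * (a - 2) := by
    -- Products of consecutive integers are nonnegative, so all four terms of `h5` vanish.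
    rcases le_or_gt (a : ℤ) 1 with h | h <;> nlinarith
  have h7 : 0 ≤ (c : ℤ) * (c - 1) := by
    rcases le_or_gt (c : ℤ) 0 with h | h <;> nlinarith
  have h8 : m.2.2 = 0 := by omega
  have h9 : l = 0 := by omega
  refine ⟨?_, ?_, ?_, ?_⟩
  · refine Prod.ext ?_ h8
    rw [hl] at h9
    revert h9
    cases m.2.1 <;> simp
  · have : ((∑ i, m.1 i + 1 : ℕ) : ℤ) = a := by
      push_cast
      omega
    exact_mod_cast this
  · by_contra h
    nlinarith
  · by_contra h
    nlinarith

end Skewness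

/-! ### Injectivity of `∂` on cochains -/

section Injectivity

variable {F : Type u} [Field F]

/-- The coefficient of `v` at `∂ⁿ` is `-s` times the one at `∂ⁿ⁺¹`. High coefficients vanish, hence
by descent all of them do. -/
theorem wDer_baseChange_add_smul_eq_zero {R : Type*} [CommRing R] [Algebra F R] (s : R)
    (v : R ⊗[F] WModule F) (h : (wDer F).baseChange R v + s • v = 0) : v = 0 := by
  set B := (wBasis F).baseChange R
  have h1 (b : Bool) (n : ℕ) : B.coord (b, n) v = -(s * B.coord (b, n + 1) v) := by
    have e : B.coord (b, n + 1) ∘ₗ (wDer F).baseChange R = B.coord (b, n) := by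
      refine B.ext fun ⟨b', n'⟩ => ?_
      have : (wDer F).baseChange R (B (b', n')) = B (b', n' + 1) := by
        simp [B, wBasis_succ]
      rw [LinearMap.comp_apply, this]
      simp [Finsupp.single_apply]
    have := congrArg (B.coord (b, n + 1)) h
    rw [map_add, map_smul, map_zero, ← LinearMap.comp_apply, e, smul_eq_mul] at this
    exact eq_neg_of_add_eq_zero_left this
  obtain ⟨N, hN⟩ : ∃ N, ∀ b n, N ≤ n → B.coord (b, n) v = 0 := by
    refine ⟨(B.repr v).support.sup (fun x => x.2) + 1, fun b n hn => ?_⟩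
    by_contra hne
    have := Finset.le_sup (f := fun x : Bool × ℕ => x.2) (Finsupp.mem_support_iff (f := B.repr v).2 hne)
    simp at this hn
    omega
  have h2 (k : ℕ) : ∀ b n, N ≤ n + k → B.coord (b, n) v = 0 := by
    induction k with
    | zero => exact fun b n => hN b n
    | succ k ih =>
      intro b n hn
      rw [h1, ih b (n + 1) (by omega), mul_zero, neg_zero]
  exact B.ext_elem fun ⟨b, n⟩ => by simpa using h2 N b n (by omega)

theorem basicDer_injective (q : ℕ) (f : basicCochain (wAdjoint (0 : F)) q)
    (h : basicDer (wAdjoint (0 : F)) q f = 0) : f = 0 := by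
  refine Subtype.ext (MultilinearMap.ext fun a => ?_)
  exact wDer_baseChange_add_smul_eq_zero _ _
    (congrArg (fun g : basicCochain (wAdjoint (0 : F)) q => g.1 a) h)

end Injectivity

/-! ### Cochains given by determinants -/

section Determinants

variable {F : Type u} [Field F]

/-- The matrix with entries `c_j(w_i)`, where the variable is replaced by `λ_i`. -/
def letterMatrix {q : ℕ} (c : Fin q → Bool → Polynomial F) (w : Fin q → Bool) :
    Matrix (Fin q) (Fin q) (MvPolynomial (Fin q) F) :=
  Matrix.of fun i j => Polynomial.aeval (MvPolynomial.X i) (c j (w i))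

/-- The cochain with values `det (c_j(w_i)) H`. -/
def detCochain {q : ℕ} (c : Fin q → Bool → Polynomial F) :
    basicCochain (wAdjoint (0 : F)) q :=
  ⟨ofValues fun w => (letterMatrix c w).det ⊗ₜ genH F, ofValues_mem fun σ w => by
    have : (MvPolynomial.rename σ : MvPolynomial (Fin q) F →ₐ[F] _).mapMatrix
        (letterMatrix c (w ∘ σ)) = (letterMatrix c w).submatrix σ id := by
      refine Matrix.ext fun i j => ?_
      simp [letterMatrix, ← Polynomial.aeval_algHom_apply]
    rw [chg_tmul, AlgHom.map_det, this, Matrix.det_permute, TensorProduct.smul_tmul',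
      Algebra.smul_def]
    simp⟩

theorem detCochain_gen {q : ℕ} (c : Fin q → Bool → Polynomial F) (w : Fin q → Bool) :
    (detCochain c).1 (fun i => gen F (w i)) = (letterMatrix c w).det ⊗ₜ genH F :=
  ofValues_gen _ w

theorem evalAt_detCochain {R : Type*} [CommRing R] [Algebra F R] {q : ℕ}
    (c : Fin q → Bool → Polynomial F) (y : Fin q → Bool × R) :
    evalAt F R (detCochain c).1 y =
      (Matrix.of fun i j => Polynomial.aeval (y i).2 (c j (y i).1)).det ⊗ₜ genH F := by
  rw [evalAt, detCochain_gen c fun i => (y i).1, chg_tmul, AlgHom.map_det]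
  congr 2
  refine Matrix.ext fun i j => ?_
  simp [letterMatrix, ← Polynomial.aeval_algHom_apply]

theorem coord_tmul_genH {q : ℕ} (p : MvPolynomial (Fin q) F) (m : Fin q →₀ ℕ) (b : Bool) (n : ℕ) :
    (valueBasis F q).coord (m, (b, n)) (p ⊗ₜ genH F) =
      if b = false ∧ n = 0 then p.coeff m else 0 := by
  have e : (MvPolynomial.basisMonomials (Fin q) F).repr p m = MvPolynomial.coeff m p := rfl
  have h : genH F = wBasis F (false, 0) := (wBasis_zero false).symm
  rw [h]
  simp [valueBasis, e, Finsupp.single_apply, eq_comm]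

theorem cochainCoeff_detCochain {q : ℕ} (c : Fin q → Bool → Polynomial F) (w : Fin q → Bool)
    (m : Fin q →₀ ℕ) :
    cochainCoeff w (m, (false, 0)) (detCochain c) = (letterMatrix c w).det.coeff m := by
  rw [cochainCoeff_apply, detCochain_gen, coord_tmul_genH]
  simp

/-- An output `H` without `∂` has conformal weight `1`, so weight zero means polynomial degree one
less than the number of arguments `L`. -/
theorem eulerOp_detCochain [CharZero F] {q : ℕ} (c : Fin q → Bool → Polynomial F)
    (h : ∀ w : Fin q → Bool, (letterMatrix c w).det = 0 ∨
      ∃ d, (letterMatrix c w).det.IsHomogeneous d ∧ (d + 1 : ℤ) = ∑ i, bif w i then 1 else 0) :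
    eulerOp F q (detCochain c) = 0 := by
  rw [eulerOp_eq_zero_iff]
  rintro w ⟨m, b, n⟩ hm
  rw [cochainCoeff_apply, detCochain_gen, coord_tmul_genH] at hm
  split_ifs at hm with hbn
  · obtain ⟨rfl, rfl⟩ := hbn
    obtain h0 | ⟨d, hd, hw⟩ := h w
    · rw [h0, MvPolynomial.coeff_zero] at hm
      exact absurd rfl hm
    · have := hd hm
      replace this : m.degree = d :=
        (DFunLike.congr_fun Finsupp.degree_eq_weight_one m).trans this
      rw [Finsupp.degree_eq_sum] at this
      rw [valueWeight, ← hw, ← this]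
      simp
  · exact absurd rfl hm

end Determinants

/-! ### The four cochains of weight zero -/

section Cochains

variable {F : Type u} [Field F]

/-- The indicator of `L`. -/
def colL (F : Type u) [Field F] (b : Bool) : Polynomial F := bif b then 1 else 0

/-- The indicator of `L`, times `λ`. -/
def colX (F : Type u) [Field F] (b : Bool) : Polynomial F := bif b then Polynomial.X else 0

variable (F) in
/-- The cochain `L ↦ H`. -/
def cochain₁ : basicCochain (wAdjoint (0 : F)) 1 := detCochain ![colL F]

variable (F) in
/-- The cochain `L ⊗ H ↦ H`. -/
def cochain₂ : basicCochain (wAdjoint (0 : F)) 2 := detCochain ![colL F, fun _ => 1]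

variable (F) in
/-- The cochain `L ⊗ L ↦ (λ₁ - λ₂) H`. -/
def cochain₂' : basicCochain (wAdjoint (0 : F)) 2 := detCochain ![colX F, colL F]

variable (F) in
/-- The cochain `L ⊗ L ⊗ H ↦ (λ₁ - λ₂) H`. -/
def cochain₃ : basicCochain (wAdjoint (0 : F)) 3 := detCochain ![fun _ => 1, colX F, colL F]

theorem eulerOp_cochain₁ [CharZero F] : eulerOp F 1 (cochain₁ F) = 0 := by
  refine eulerOp_detCochain _ fun w => ?_
  obtain ⟨a, rfl⟩ : ∃ a, w = ![a] := ⟨w 0, by ext i; fin_cases i; rfl⟩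
  cases a
  · left; simp [letterMatrix, colL]
  · right
    refine ⟨0, ?_, by simp⟩
    simpa [letterMatrix, colL] using MvPolynomial.isHomogeneous_one (Fin 1) F

theorem eulerOp_cochain₂ [CharZero F] : eulerOp F 2 (cochain₂ F) = 0 := by
  refine eulerOp_detCochain _ fun w => ?_
  obtain ⟨a, b, rfl⟩ : ∃ a b, w = ![a, b] := ⟨w 0, w 1, by ext i; fin_cases i <;> rfl⟩
  cases a <;> cases b
  · left; simp [letterMatrix, colL, Matrix.det_fin_two]
  · right
    refine ⟨0, ?_, by simp⟩
    simpa [letterMatrix, colL, Matrix.det_fin_two] using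
      (MvPolynomial.isHomogeneous_one (Fin 2) F).neg
  · right
    refine ⟨0, ?_, by simp⟩
    simpa [letterMatrix, colL, Matrix.det_fin_two] using MvPolynomial.isHomogeneous_one (Fin 2) F
  · left; simp [letterMatrix, colL, Matrix.det_fin_two]

theorem isHomogeneous_X_sub_X {σ : Type*} (i j : σ) :
    (MvPolynomial.X i - MvPolynomial.X j : MvPolynomial σ F).IsHomogeneous 1 :=
  (MvPolynomial.isHomogeneous_X F i).sub (MvPolynomial.isHomogeneous_X F j)

theorem eulerOp_cochain₂' [CharZero F] : eulerOp F 2 (cochain₂' F) = 0 := by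
  refine eulerOp_detCochain _ fun w => ?_
  obtain ⟨a, b, rfl⟩ : ∃ a b, w = ![a, b] := ⟨w 0, w 1, by ext i; fin_cases i <;> rfl⟩
  cases a <;> cases b
  · left; simp [letterMatrix, colL, colX, Matrix.det_fin_two]
  · left; simp [letterMatrix, colL, colX, Matrix.det_fin_two]
  · left; simp [letterMatrix, colL, colX, Matrix.det_fin_two]
  · right
    refine ⟨1, ?_, by simp⟩
    simpa [letterMatrix, colL, colX, Matrix.det_fin_two] using
      isHomogeneous_X_sub_X (F := F) (0 : Fin 2) 1

theorem eulerOp_cochain₃ [CharZero F] : eulerOp F 3 (cochain₃ F) = 0 := by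
  refine eulerOp_detCochain _ fun w => ?_
  obtain ⟨a, b, c, rfl⟩ : ∃ a b c, w = ![a, b, c] :=
    ⟨w 0, w 1, w 2, by ext i; fin_cases i <;> rfl⟩
  cases a <;> cases b <;> cases c
  case true.true.false =>
    right
    refine ⟨1, ?_, by simp [Fin.sum_univ_three]⟩
    convert isHomogeneous_X_sub_X (F := F) (0 : Fin 3) 1 using 1
    simp [letterMatrix, colL, colX, Matrix.det_fin_three]
  case true.false.true =>
    right
    refine ⟨1, ?_, by simp [Fin.sum_univ_three]⟩
    convert isHomogeneous_X_sub_X (F := F) (2 : Fin 3) 0 using 1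
    simp [letterMatrix, colL, colX, Matrix.det_fin_three]
    ring
  case false.true.true =>
    right
    refine ⟨1, ?_, by simp [Fin.sum_univ_three]⟩
    convert isHomogeneous_X_sub_X (F := F) (1 : Fin 3) 2 using 1
    simp [letterMatrix, colL, colX, Matrix.det_fin_three]
  all_goals left; simp [letterMatrix, colL, colX, Matrix.det_fin_three]

/-! ### Cochains of weight zero -/

theorem card_filter_add (q : ℕ) (w : Fin q → Bool) :
    (Finset.univ.filter fun i => w i = true).card +
      (Finset.univ.filter fun i => ¬ w i = true).card = q := by
  rw [Finset.card_filter_add_card_filter_not, Finset.card_univ, Fintype.card_fin]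

/-- A nonzero coefficient needs one or two arguments `L` and at most one `H`, so its degree is
between 1 and 3. -/
theorem eq_zero_of_eulerOp_eq_zero [CharZero F] {q : ℕ} (hq : q = 0 ∨ 4 ≤ q)
    {f : basicCochain (wAdjoint (0 : F)) q} (hf : eulerOp F q f = 0) : f = 0 := by
  refine cochain_ext fun w m => ?_
  rw [map_zero]
  by_contra h
  obtain ⟨-, h1, h2, h3⟩ := weight_zero_constraints hf h
  have := card_filter_add q w
  omega

theorem eq_zero_of_sum_eq_zero {q : ℕ} {m : Fin q →₀ ℕ} (h : ∑ i, m i = 0) : m = 0 := by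
  ext i
  exact Finset.sum_eq_zero_iff.1 h i (Finset.mem_univ i)

theorem exists_eq_single_of_sum_eq_one {q : ℕ} {m : Fin q →₀ ℕ} (h : ∑ i, m i = 1) :
    ∃ i, m = Finsupp.single i 1 := by
  obtain ⟨i, -, hi⟩ : ∃ i ∈ Finset.univ, m i ≠ 0 :=
    Finset.exists_ne_zero_of_sum_ne_zero (by rw [h]; exact one_ne_zero)
  have h1 := Finset.add_sum_erase Finset.univ (fun i => m i) (Finset.mem_univ i)
  have h2 : ∑ j ∈ Finset.univ.erase i, m j = 0 := by
    omega
  refine ⟨i, Finsupp.ext fun j => ?_⟩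
  by_cases hj : j = i
  · subst hj
    rw [Finsupp.single_eq_same]
    omega
  · rw [Finsupp.single_eq_of_ne hj]
    exact Finset.sum_eq_zero_iff.1 h2 j (Finset.mem_erase.2 ⟨hj, Finset.mem_univ _⟩)

theorem eq_zero_of_coeff₁ [CharZero F] {f : basicCochain (wAdjoint (0 : F)) 1}
    (hf : eulerOp F 1 f = 0) (h : cochainCoeff ![true] (0, (false, 0)) f = 0) : f = 0 := by
  refine cochain_ext fun w m => ?_
  rw [map_zero]
  by_contra hm
  obtain ⟨h0, h1, h2, h3⟩ := weight_zero_constraints hf hm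
  obtain ⟨m, x⟩ := m
  obtain rfl : x = (false, 0) := h0
  obtain ⟨a, rfl⟩ : ∃ a, w = ![a] := ⟨w 0, by ext i; fin_cases i; rfl⟩
  cases a
  · simp at h1
  · obtain rfl := eq_zero_of_sum_eq_zero (m := m) (by simpa using h1)
    exact hm h

/-- With two arguments, the surviving cases are one `L` and one `H` with constant value, or two
`L`'s with a linear value. A permutation brings any of them to one of the two coefficients tested.
-/
theorem eq_zero_of_coeff₂ [CharZero F] {f : basicCochain (wAdjoint (0 : F)) 2}
    (hf : eulerOp F 2 f = 0) (h : cochainCoeff ![true, false] (0, (false, 0)) f = 0)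
    (h' : cochainCoeff ![true, true] (Finsupp.single 0 1, (false, 0)) f = 0) : f = 0 := by
  refine cochain_ext fun w m => ?_
  rw [map_zero]
  by_contra hm
  obtain ⟨h0, h1, h2, h3⟩ := weight_zero_constraints hf hm
  obtain ⟨m, x⟩ := m
  obtain rfl : x = (false, 0) := h0
  dsimp only at h1
  have key : (∃ σ : Equiv.Perm (Fin 2), (∀ i, (![true, false] : Fin 2 → Bool) i = w (σ i)) ∧
      ∀ i, (0 : Fin 2 →₀ ℕ) i = m (σ i)) ∨
      (∃ σ : Equiv.Perm (Fin 2), (∀ i, (![true, true] : Fin 2 → Bool) i = w (σ i)) ∧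
      ∀ i, (Finsupp.single 0 1 : Fin 2 →₀ ℕ) i = m (σ i)) := by
    -- The total exponent is one less than the number of `L`'s; after this split only finitely many
    -- words and positions are left, and `decide` finds the permutation.
    have h4 := card_filter_add 2 w
    rcases (by omega : ∑ i, m i = 0 ∨ ∑ i, m i = 1) with hs | hs
    · left
      obtain rfl := eq_zero_of_sum_eq_zero hs
      simp only [Finsupp.coe_zero, Pi.zero_apply, Finset.sum_const_zero] at h1
      simp only [Finsupp.coe_zero, Pi.zero_apply, implies_true, and_true]
      revert h1
      clear * -
      revert w
      decide
    · right
      obtain ⟨i, rfl⟩ := exists_eq_single_of_sum_eq_one hs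
      rw [hs] at h1
      simp only [Finsupp.single_apply]
      revert h1
      clear * -
      revert w i
      decide
  rcases key with ⟨σ, hw, hms⟩ | ⟨σ, hw, hms⟩
  · exact cochainCoeff_perm_ne_zero σ hw hms hm h
  · exact cochainCoeff_perm_ne_zero σ hw hms hm h'

theorem eq_zero_of_coeff₃ [CharZero F] {f : basicCochain (wAdjoint (0 : F)) 3}
    (hf : eulerOp F 3 f = 0)
    (h : cochainCoeff ![true, true, false] (Finsupp.single 0 1, (false, 0)) f = 0) : f = 0 := by
  refine cochain_ext fun w m => ?_
  rw [map_zero]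
  by_contra hm
  obtain ⟨h0, h1, h2, h3⟩ := weight_zero_constraints hf hm
  have hne := fun i j => exponents_ne hm (i := i) (j := j)
  obtain ⟨m, x⟩ := m
  obtain rfl : x = (false, 0) := h0
  dsimp only at h1
  have key : ∃ σ : Equiv.Perm (Fin 3), (∀ i, (![true, true, false] : Fin 3 → Bool) i = w (σ i)) ∧
      ∀ i, (Finsupp.single 0 1 : Fin 3 →₀ ℕ) i = m (σ i) := by
    have h4 := card_filter_add 3 w
    have hs : ∑ i, m i = 1 := by omega
    obtain ⟨i, rfl⟩ := exists_eq_single_of_sum_eq_one hs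
    rw [hs] at h1
    -- If the variable belonged to `H`, both arguments `L` would have exponent `0`, against
    -- `exponents_ne`.
    have hi : w i = true := by
      by_contra hi
      obtain ⟨a, b, hab, hw, ha, hb⟩ : ∃ a b, a ≠ b ∧ w a = w b ∧ a ≠ i ∧ b ≠ i := by
        revert h1 hi
        clear * -
        revert w i
        decide
      refine hne a b hab hw ?_
      simp [ha, hb]
    simp only [Finsupp.single_apply]
    revert h1 hi
    clear * -
    revert w i
    decide
  obtain ⟨σ, hw, hms⟩ := key
  exact cochainCoeff_perm_ne_zero σ hw hms hm h

end Cochains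

/-! ### The differential in degrees one and two -/

namespace LetterAlgebra

variable {R I N : Type*} [CommRing R] [AddCommGroup N] [Module R N] (G : LetterAlgebra R I N)

theorem lieDer_one_apply (c : (Fin 1 → I) → N) (x y : I) :
    G.lieDer x 1 c ![y] = G.act x (c ![y]) - G.coef x y • c ![G.mul x y] := by
  rw [lieDer_apply]
  have e (a : I) : Function.update ![y] 0 a = ![a] := by
    ext i; fin_cases i; simp
  simp [e]

theorem diff_one_apply (c : (Fin 1 → I) → N) (x y : I) :
    G.diff 1 c ![x, y] =
      G.act x (c ![y]) - G.coef x y • c ![G.mul x y] - G.act y (c ![x]) := by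
  have h : G.diff 1 c ![x, y] = G.lieDer x 1 c ![y] - G.act y (c ![x]) := by
    refine (congrFun (G.contract_diff x 0 c) ![y]).trans ?_
    refine congrArg (fun v => G.lieDer x 1 c ![y] - G.act y (c v)) ?_
    ext i; fin_cases i; rfl
  rw [h, lieDer_one_apply]

theorem diff_two_apply (c : (Fin 2 → I) → N) (x y z : I) :
    G.diff 2 c ![x, y, z] =
      G.act x (c ![y, z]) - G.coef x y • c ![G.mul x y, z] - G.coef x z • c ![y, G.mul x z] -
      (G.act y (c ![x, z]) - G.coef y z • c ![x, G.mul y z] - G.act z (c ![x, y])) := by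
  have h : G.diff 2 c ![x, y, z] =
      G.lieDer x 2 c ![y, z] - G.diff 1 (contract (R := R) x c) ![y, z] := rfl
  rw [h, diff_one_apply, lieDer_apply]
  have e1 (a : I) : Function.update ![y, z] 0 a = ![a, z] := by
    ext i; fin_cases i <;> simp
  have e2 (a : I) : Function.update ![y, z] 1 a = ![y, a] := by
    ext i; fin_cases i <;> simp
  simp only [Fin.sum_univ_two, e1, e2]
  simp only [contract_apply]
  simp only [Matrix.cons_val_zero, Matrix.cons_val_one, sub_sub]
  rfl

end LetterAlgebra

/-! ### The weight-zero cochains are cocycles -/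

section Differentials

variable {F : Type u} [Field F]

theorem letters_act_L {R : Type*} [CommRing R] [Algebra F R] (t r : R) :
    (letters F R).act (true, t) (r ⊗ₜ genH F) = r ⊗ₜ wDer F (genH F) + (r * t) ⊗ₜ genH F := by
  have h := WAlgebra_bracket_LH (0 : F)
  simp only [WAlgebra] at h
  change act _ _ _ _ = _
  rw [act, LinearMap.liftBaseChange_tmul, LinearMap.comp_apply]
  simp [gen, h, TensorProduct.smul_tmul']

theorem letters_act_H {R : Type*} [CommRing R] [Algebra F R] (t r : R) :
    (letters F R).act (false, t) (r ⊗ₜ genH F) = 0 := by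
  have h := WAlgebra_bracket_HH (0 : F)
  simp only [WAlgebra] at h
  change act _ _ _ _ = _
  rw [act, LinearMap.liftBaseChange_tmul, LinearMap.comp_apply]
  simp [gen, h]

theorem letters_coef {R : Type*} [CommRing R] [Algebra F R] (x y : Bool × R) :
    (letters F R).coef x y = (bif y.1 then x.2 else 0) - bif x.1 then y.2 else 0 := rfl

theorem letters_mul {R : Type*} [CommRing R] [Algebra F R] (x y : Bool × R) :
    (letters F R).mul x y = (x.1 && y.1, x.2 + y.2) := rfl

/-- With `d² = 0`, both sides equal `d ι₁ d`. -/
theorem eulerOp_basicD [CharZero F] (q : ℕ) (f : basicCochain (wAdjoint (0 : F)) q) :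
    eulerOp F (q + 1) (basicD (wAdjoint (0 : F)) q f) =
      basicD (wAdjoint (0 : F)) q (eulerOp F q f) := by
  have h : eulerOp F (q + 1) (basicD (wAdjoint (0 : F)) q f) =
      contractL F 1 (q + 1) (basicD (wAdjoint (0 : F)) (q + 1) (basicD (wAdjoint (0 : F)) q f)) +
        basicD (wAdjoint (0 : F)) q (contractL F 1 q (basicD (wAdjoint (0 : F)) q f)) := rfl
  rw [h, basicD_basicD, map_zero, zero_add]
  cases q with
  | zero => rfl
  | succ q =>
    have h : eulerOp F (q + 1) f = contractL F 1 (q + 1) (basicD (wAdjoint (0 : F)) (q + 1) f) +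
      basicD (wAdjoint (0 : F)) q (contractL F 1 q f) := rfl
    rw [h, map_add, basicD_basicD, add_zero]

theorem cochainCoeff_basicD [CharZero F] {q : ℕ} (f : basicCochain (wAdjoint (0 : F)) q)
    (w : Fin (q + 1) → Bool) (m : (Fin (q + 1) →₀ ℕ) × (Bool × ℕ))
    (h : (letters F _).diff q (evalAt F (MvPolynomial (Fin (q + 1)) F) f.1)
      (genericLetters F w) = 0) :
    cochainCoeff w m (basicD (wAdjoint (0 : F)) q f) = 0 := by
  have e : (basicD (wAdjoint (0 : F)) q f).1 = rawD (wAdjoint (0 : F)) q f.1 := rfl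
  rw [cochainCoeff_apply, e, ← evalAt_genericLetters, evalAt_rawD f.2, h, map_zero]

theorem genericLetters_two (a b : Bool) : genericLetters F ![a, b] =
    ![(a, MvPolynomial.X 0), (b, MvPolynomial.X 1)] := by
  ext1 i; fin_cases i <;> rfl

theorem genericLetters_three (a b c : Bool) : genericLetters F ![a, b, c] =
    ![(a, MvPolynomial.X 0), (b, MvPolynomial.X 1), (c, MvPolynomial.X 2)] := by
  ext1 i; fin_cases i <;> rfl

/-- The differential again has weight zero, so two coefficients decide. On `L ⊗ L` the value is `(∂
+ λ₁) - (λ₁ - λ₂) - (∂ + λ₂) = 0` times `H`; on `L ⊗ H` every term vanishes. -/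
theorem basicD_cochain₁ [CharZero F] : basicD (wAdjoint (0 : F)) 1 (cochain₁ F) = 0 := by
  refine eq_zero_of_coeff₂ (by rw [eulerOp_basicD, eulerOp_cochain₁, map_zero]) ?_ ?_ <;>
    refine cochainCoeff_basicD _ _ _ ?_ <;>
    rw [genericLetters_two, LetterAlgebra.diff_one_apply] <;>
    simp only [cochain₁, evalAt_detCochain] <;>
    simp [letters_coef, letters_mul, letters_act_L, letters_act_H, colL]
  rw [TensorProduct.smul_tmul', smul_eq_mul, mul_one, TensorProduct.sub_tmul]
  abel

/-- By weight only `L ⊗ L ⊗ H` matters, with value `(∂ + λ₁) - (λ₁ - λ₂) + λ₃ - (∂ + λ₂) - λ₃ = 0`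
times `H`. -/
theorem basicD_cochain₂ [CharZero F] : basicD (wAdjoint (0 : F)) 2 (cochain₂ F) = 0 := by
  refine eq_zero_of_coeff₃ (by rw [eulerOp_basicD, eulerOp_cochain₂, map_zero]) ?_
  refine cochainCoeff_basicD _ _ _ ?_
  rw [genericLetters_three, LetterAlgebra.diff_two_apply]
  simp only [cochain₂, evalAt_detCochain]
  simp [letters_coef, letters_mul, letters_act_L, colL, Matrix.det_fin_two]
  rw [TensorProduct.smul_tmul', smul_eq_mul, mul_one, TensorProduct.sub_tmul]
  abel

/-- On `L ⊗ L ⊗ H` each term is either a value at a pair containing `H` or the action of `H` on a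
multiple of `H`, and all of these are zero. -/
theorem basicD_cochain₂' [CharZero F] : basicD (wAdjoint (0 : F)) 2 (cochain₂' F) = 0 := by
  refine eq_zero_of_coeff₃ (by rw [eulerOp_basicD, eulerOp_cochain₂', map_zero]) ?_
  refine cochainCoeff_basicD _ _ _ ?_
  rw [genericLetters_three, LetterAlgebra.diff_two_apply]
  simp only [cochain₂', evalAt_detCochain]
  simp [letters_coef, letters_mul, letters_act_H, colL, colX, Matrix.det_fin_two]

end Differentials

/-! ### Bases of the weight-zero spaces and dimensions -/

section KerBases

variable {F : Type u} [Field F]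

/-- Contraction prepends to the determinant a row for `L` in the variable `μ`, so contracted values
are coefficients of a one-variable expansion. -/
theorem contractL_detCochain_gen {q : ℕ} (n : ℕ) (c : Fin (q + 1) → Bool → Polynomial F)
    (w : Fin q → Bool) :
    (contractL F n q (detCochain c)).1 (fun i => gen F (w i)) =
      (Matrix.of fun i j => Polynomial.aeval
        ((Fin.cons (true, Polynomial.X) (constLetter ∘ genericLetters F w) :
          Fin (q + 1) → Bool × Polynomial (MvPolynomial (Fin q) F)) i).2
        (c j ((Fin.cons (true, Polynomial.X) (constLetter ∘ genericLetters F w) :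
          Fin (q + 1) → Bool × Polynomial (MvPolynomial (Fin q) F)) i).1)).det.coeff n ⊗ₜ
        genH F := by
  rw [← evalAt_genericLetters]
  refine (evalAt_rawContract n (detCochain c).1 _).trans ?_
  rw [evalAt_detCochain, coeffTensor_tmul]

theorem basicDer_apply {q : ℕ} (f : basicCochain (wAdjoint (0 : F)) q)
    (a : Fin q → WModule F) : (basicDer (wAdjoint (0 : F)) q f).1 a =
      (wDer F).baseChange (MvPolynomial (Fin q) F) (f.1 a) +
        (∑ k, MvPolynomial.X k : MvPolynomial (Fin q) F) • f.1 a := rfl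

/-- Used to replace a contracted cochain by a representative with simpler values. -/
theorem toReduced_add_basicDer (q : ℕ) (f g : basicCochain (wAdjoint (0 : F)) q) :
    toReduced (wAdjoint (0 : F)) q (f + basicDer (wAdjoint (0 : F)) q g) =
      toReduced (wAdjoint (0 : F)) q f :=
  (Submodule.Quotient.eq _).2 ⟨g, by abel⟩

theorem gen_comp_one (a : Bool) : ![gen F a] = fun i => gen F (![a] i) := by
  ext1 i; fin_cases i; rfl

theorem gen_comp_two (a b : Bool) : ![gen F a, gen F b] = fun i => gen F (![a, b] i) := by
  ext1 i; fin_cases i <;> rfl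

theorem gen_comp_three (a b c : Bool) :
    ![gen F a, gen F b, gen F c] = fun i => gen F (![a, b, c] i) := by
  ext1 i; fin_cases i <;> rfl

theorem genericLetters_one (a : Bool) : genericLetters F ![a] = ![(a, MvPolynomial.X 0)] := by
  ext1 i; fin_cases i; rfl

/-! ### The cochains of weight zero -/

theorem cochainCoeff_cochain₁ : cochainCoeff ![true] (0, (false, 0)) (cochain₁ F) = 1 := by
  rw [cochain₁, cochainCoeff_detCochain]
  simp [letterMatrix, colL]

theorem cochainCoeff_cochain₂ :
    cochainCoeff ![true, false] (0, (false, 0)) (cochain₂ F) = 1 := by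
  rw [cochain₂, cochainCoeff_detCochain]
  simp [letterMatrix, colL, Matrix.det_fin_two]

theorem cochainCoeff_cochain₂_LL :
    cochainCoeff ![true, true] (Finsupp.single 0 1, (false, 0)) (cochain₂ F) = 0 := by
  rw [cochain₂, cochainCoeff_detCochain]
  simp [letterMatrix, colL, Matrix.det_fin_two]

theorem cochainCoeff_cochain₂'_LH :
    cochainCoeff ![true, false] (0, (false, 0)) (cochain₂' F) = 0 := by
  rw [cochain₂', cochainCoeff_detCochain]
  simp [letterMatrix, colL, colX, Matrix.det_fin_two]

theorem cochainCoeff_cochain₂' :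
    cochainCoeff ![true, true] (Finsupp.single 0 1, (false, 0)) (cochain₂' F) = 1 := by
  rw [cochain₂', cochainCoeff_detCochain]
  simp [letterMatrix, colL, colX, Matrix.det_fin_two, MvPolynomial.coeff_X, Finsupp.single_left_inj]

theorem cochainCoeff_cochain₃ :
    cochainCoeff ![true, true, false] (Finsupp.single 0 1, (false, 0)) (cochain₃ F) = 1 := by
  rw [cochain₃, cochainCoeff_detCochain]
  simp [letterMatrix, colL, colX, Matrix.det_fin_three, MvPolynomial.coeff_X,
    Finsupp.single_left_inj]

variable [CharZero F]

theorem eq_smul_cochain₁ {f : basicCochain (wAdjoint (0 : F)) 1} (hf : eulerOp F 1 f = 0) :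
    f = cochainCoeff ![true] (0, (false, 0)) f • cochain₁ F := by
  rw [← sub_eq_zero]
  refine eq_zero_of_coeff₁ ?_ ?_
  · rw [map_sub, map_smul, hf, eulerOp_cochain₁, smul_zero, sub_zero]
  · rw [map_sub, map_smul, cochainCoeff_cochain₁, smul_eq_mul, mul_one, sub_self]

theorem eq_smul_cochain₂ {f : basicCochain (wAdjoint (0 : F)) 2} (hf : eulerOp F 2 f = 0) :
    f = cochainCoeff ![true, false] (0, (false, 0)) f • cochain₂ F +
      cochainCoeff ![true, true] (Finsupp.single 0 1, (false, 0)) f • cochain₂' F := by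
  rw [← sub_eq_zero]
  refine eq_zero_of_coeff₂ ?_ ?_ ?_
  · rw [map_sub, map_add, map_smul, map_smul, hf, eulerOp_cochain₂, eulerOp_cochain₂', smul_zero,
      smul_zero, add_zero, sub_zero]
  · rw [map_sub, map_add, map_smul, map_smul, cochainCoeff_cochain₂, cochainCoeff_cochain₂'_LH,
      smul_eq_mul, mul_one, smul_zero, add_zero, sub_self]
  · rw [map_sub, map_add, map_smul, map_smul, cochainCoeff_cochain₂_LL, cochainCoeff_cochain₂',
      smul_eq_mul, smul_eq_mul, mul_one, mul_zero, zero_add, sub_self]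

theorem eq_smul_cochain₃ {f : basicCochain (wAdjoint (0 : F)) 3} (hf : eulerOp F 3 f = 0) :
    f = cochainCoeff ![true, true, false] (Finsupp.single 0 1, (false, 0)) f • cochain₃ F := by
  rw [← sub_eq_zero]
  refine eq_zero_of_coeff₃ ?_ ?_
  · rw [map_sub, map_smul, hf, eulerOp_cochain₃, smul_zero, sub_zero]
  · rw [map_sub, map_smul, cochainCoeff_cochain₃, smul_eq_mul, mul_one, sub_self]

theorem basicD_eq_zero_of_eulerOp_eq_zero (q : ℕ) (f : basicCochain (wAdjoint (0 : F)) q)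
    (hf : eulerOp F q f = 0) : basicD (wAdjoint (0 : F)) q f = 0 := by
  match q with
  | 0 => rw [eq_zero_of_eulerOp_eq_zero (Or.inl rfl) hf, map_zero]
  | 1 => rw [eq_smul_cochain₁ hf, map_smul, basicD_cochain₁, smul_zero]
  | 2 => rw [eq_smul_cochain₂ hf, map_add, map_smul, map_smul, basicD_cochain₂, basicD_cochain₂',
      smul_zero, smul_zero, add_zero]
  | q + 3 =>
    -- The differential of `f` has weight zero in degree at least 4, where nothing nonzero does.
    refine eq_zero_of_eulerOp_eq_zero (Or.inr (by omega)) ?_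
    rw [eulerOp_basicD, hf, map_zero]

variable (F) in
/-- The homotopy given by contraction with `L`. -/
def eulerHomotopy : SemisimpleHomotopy (C := fun q => basicCochain (wAdjoint (0 : F)) q)
    (basicD (wAdjoint (0 : F))) where
  h := contractL F 1
  K := eulerOp F
  d_d := basicD_basicD
  cartan_zero _ := rfl
  cartan_succ _ _ := rfl
  algebraic _ := exists_eulerOp_aeval_eq_zero
  d_ker := basicD_eq_zero_of_eulerOp_eq_zero

theorem isKerBasis_empty {q : ℕ} (hq : q = 0 ∨ 4 ≤ q) : (eulerHomotopy F).IsKerBasis q ![] :=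
  ⟨fun i => i.elim0, fun v hv => ⟨0, by simpa using eq_zero_of_eulerOp_eq_zero hq hv⟩,
    fun c _ => Subsingleton.elim _ _⟩

theorem isKerBasis_one : (eulerHomotopy F).IsKerBasis 1 ![cochain₁ F] := by
  refine ⟨fun i => ?_, fun v hv =>
    ⟨![cochainCoeff ![true] (0, (false, 0)) v], ?_⟩, fun c hc => ?_⟩
  · fin_cases i
    exact eulerOp_cochain₁
  · simpa using eq_smul_cochain₁ hv
  · have := congrArg (cochainCoeff ![true] (0, (false, 0))) hc
    ext i; fin_cases i
    simpa [cochainCoeff_cochain₁] using this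

theorem isKerBasis_two : (eulerHomotopy F).IsKerBasis 2 ![cochain₂ F, cochain₂' F] := by
  refine ⟨fun i => ?_, fun v hv => ⟨![cochainCoeff ![true, false] (0, (false, 0)) v,
    cochainCoeff ![true, true] (Finsupp.single 0 1, (false, 0)) v], ?_⟩, fun c hc => ?_⟩
  · fin_cases i
    · exact eulerOp_cochain₂
    · exact eulerOp_cochain₂'
  · simpa using eq_smul_cochain₂ hv
  · have h := congrArg (cochainCoeff ![true, false] (0, (false, 0))) hc
    have h' := congrArg (cochainCoeff ![true, true] (Finsupp.single 0 1, (false, 0))) hc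
    ext i; fin_cases i
    · simpa [cochainCoeff_cochain₂, cochainCoeff_cochain₂'_LH] using h
    · simpa [cochainCoeff_cochain₂_LL, cochainCoeff_cochain₂'] using h'

theorem isKerBasis_three : (eulerHomotopy F).IsKerBasis 3 ![cochain₃ F] := by
  refine ⟨fun i => ?_, fun v hv =>
    ⟨![cochainCoeff ![true, true, false] (Finsupp.single 0 1, (false, 0)) v], ?_⟩, fun c hc => ?_⟩
  · fin_cases i
    exact eulerOp_cochain₃
  · simpa using eq_smul_cochain₃ hv
  · have := congrArg (cochainCoeff ![true, true, false] (Finsupp.single 0 1, (false, 0))) hc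
    ext i; fin_cases i
    simpa [cochainCoeff_cochain₃] using this

/-- The transfer lemma with `s = ι₀`, whose homotopy relation is Cartan's formula at `μ⁰`. -/
theorem isCohomologyBasis_reducedD {q n m : ℕ} {f : Fin n → basicCochain (wAdjoint (0 : F)) q}
    {g : Fin m → basicCochain (wAdjoint (0 : F)) (q + 1)}
    (hf : (eulerHomotopy F).IsKerBasis q f) (hg : (eulerHomotopy F).IsKerBasis (q + 1) g) :
    IsCohomologyBasis (reducedD (wAdjoint (0 : F))) q
      (Fin.append (fun i => toReduced (wAdjoint (0 : F)) q (f i))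
        fun i => toReduced (wAdjoint (0 : F)) q (contractL F 0 q (g i))) :=
  hf.isCohomologyBasis_reduced (contractL F 0) basicDer_injective contractL_zero_basicD_zero
    contractL_zero_basicD hg

theorem rank_basicCohomology (q : ℕ) : Module.rank F (BasicCohomology (wAdjoint (0 : F)) q) =
    if q = 1 ∨ q = 3 then 1 else if q = 2 then 2 else 0 := by
  match q with
  | 0 => simpa using (isKerBasis_empty (F := F) (Or.inl rfl)).isCohomologyBasis.rank_eq
  | 1 => simpa using (isKerBasis_one (F := F)).isCohomologyBasis.rank_eq
  | 2 => simpa using (isKerBasis_two (F := F)).isCohomologyBasis.rank_eq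
  | 3 => simpa using (isKerBasis_three (F := F)).isCohomologyBasis.rank_eq
  | q + 4 =>
    simpa using (isKerBasis_empty (F := F) (q := q + 4)
      (Or.inr (by omega))).isCohomologyBasis.rank_eq

theorem rank_reducedCohomology (q : ℕ) : Module.rank F (ReducedCohomology (wAdjoint (0 : F)) q) =
    if q = 1 ∨ q = 2 then 3 else if q = 0 ∨ q = 3 then 1 else 0 := by
  match q with
  | 0 =>
    simpa using (isCohomologyBasis_reducedD (F := F) (isKerBasis_empty (Or.inl rfl))
      isKerBasis_one).rank_eq
  | 1 =>
    simpa using (isCohomologyBasis_reducedD (F := F) isKerBasis_one isKerBasis_two).rank_eq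
  | 2 =>
    simpa using (isCohomologyBasis_reducedD (F := F) isKerBasis_two isKerBasis_three).rank_eq
  | 3 =>
    simpa using (isCohomologyBasis_reducedD (F := F) isKerBasis_three
      (isKerBasis_empty (Or.inr le_rfl))).rank_eq
  | q + 4 =>
    simpa using (isCohomologyBasis_reducedD (F := F)
      (isKerBasis_empty (q := q + 4) (Or.inr (by omega)))
      (isKerBasis_empty (Or.inr (by omega)))).rank_eq

end KerBases

/-! ### Values of the representatives on generators -/

section Values

variable {F : Type u} [Field F]

variable (F) in
/-- The cochain `L ↦ ∂H`. -/
def cochain₁Der : basicCochain (wAdjoint (0 : F)) 1 :=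
  contractL F 0 1 (cochain₂' F) + basicDer (wAdjoint (0 : F)) 1 (cochain₁ F)

variable (F) in
/-- The cochain `L ⊗ H ↦ (∂ + λ₂) H`. -/
def cochain₂Der : basicCochain (wAdjoint (0 : F)) 2 :=
  contractL F 0 2 (cochain₃ F) + basicDer (wAdjoint (0 : F)) 2 (cochain₂ F)

theorem contractL_cochain₁ : (contractL F 0 0 (cochain₁ F)).1 ![] = 1 ⊗ₜ genH F := by
  rw [show (![] : Fin 0 → WModule F) = fun i => gen F ((![] : Fin 0 → Bool) i) from
    Subsingleton.elim _ _, cochain₁, contractL_detCochain_gen]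
  simp [colL]

theorem cochain₁_gen (a : Bool) :
    (cochain₁ F).1 ![gen F a] = (bif a then 1 else 0) ⊗ₜ genH F := by
  rw [gen_comp_one, cochain₁, detCochain_gen]
  cases a <;> simp [letterMatrix, colL]

theorem contractL_cochain₂_gen (a : Bool) :
    (contractL F 0 1 (cochain₂ F)).1 ![gen F a] = (bif a then 0 else 1) ⊗ₜ genH F := by
  rw [gen_comp_one, cochain₂, contractL_detCochain_gen, genericLetters_one]
  cases a <;> simp [Matrix.det_fin_two, colL, constLetter]

/-- Contracting `(λ₁ - λ₂)H` at `μ = 0` gives `-λ₁H` on `L`; adding `∂` of `L ↦ H`, which is `(∂ +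
λ₁)H`, leaves `∂H`. -/
theorem cochain₁Der_gen (a : Bool) : (cochain₁Der F).1 ![gen F a] =
    (bif a then 1 else 0) ⊗ₜ wDer F (genH F) := by
  have h : (contractL F 0 1 (cochain₂' F)).1 ![gen F a] =
      (bif a then -MvPolynomial.X 0 else 0) ⊗ₜ genH F := by
    rw [gen_comp_one, cochain₂', contractL_detCochain_gen, genericLetters_one]
    cases a <;> simp [Matrix.det_fin_two, colL, colX, constLetter]
  have e : (cochain₁Der F).1 ![gen F a] = (contractL F 0 1 (cochain₂' F)).1 ![gen F a] +
      (basicDer (wAdjoint (0 : F)) 1 (cochain₁ F)).1 ![gen F a] := rfl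
  rw [e, h, basicDer_apply, cochain₁_gen]
  cases a <;> simp [TensorProduct.smul_tmul', TensorProduct.neg_tmul]

theorem cochain₂_gen (a b : Bool) : (cochain₂ F).1 ![gen F a, gen F b] =
    ((bif a then 1 else 0) - bif b then 1 else 0) ⊗ₜ genH F := by
  rw [gen_comp_two, cochain₂, detCochain_gen]
  cases a <;> cases b <;> simp [letterMatrix, colL, Matrix.det_fin_two]

theorem cochain₂'_gen (a b : Bool) : (cochain₂' F).1 ![gen F a, gen F b] =
    (bif a && b then MvPolynomial.X 0 - MvPolynomial.X 1 else 0) ⊗ₜ genH F := by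
  rw [gen_comp_two, cochain₂', detCochain_gen]
  cases a <;> cases b <;> simp [letterMatrix, colL, colX, Matrix.det_fin_two]

/-- On `L ⊗ H` the contraction gives `-λ₁H` and the added `∂`-image gives `(∂ + λ₁ + λ₂)H`, hence
the sum `(∂ + λ₂)H`. -/
theorem cochain₂Der_gen (a b : Bool) : (cochain₂Der F).1 ![gen F a, gen F b] =
    ((bif a then 1 else 0) - bif b then 1 else 0) ⊗ₜ wDer F (genH F) +
      (((bif a then 1 else 0) - bif b then 1 else 0) *
        bif a then MvPolynomial.X 1 else MvPolynomial.X 0) ⊗ₜ genH F := by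
  have h : (contractL F 0 2 (cochain₃ F)).1 ![gen F a, gen F b] =
      (-(((bif a then 1 else 0) - bif b then 1 else 0) *
        bif a then MvPolynomial.X 0 else MvPolynomial.X 1)) ⊗ₜ genH F := by
    rw [gen_comp_two, cochain₃, contractL_detCochain_gen, genericLetters_two]
    have e (x y z : Bool × Polynomial (MvPolynomial (Fin 2) F)) :
        (Fin.cons x ![y, z] : Fin 3 → _) = ![x, y, z] := rfl
    have e' (x y : Bool × MvPolynomial (Fin 2) F) :
        constLetter ∘ ![x, y] = ![constLetter x, constLetter y] := by
      ext1 i; fin_cases i <;> rfl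
    rw [e', e]
    cases a <;> cases b <;> simp [Matrix.det_fin_three, colL, colX, constLetter]
  have e : (cochain₂Der F).1 ![gen F a, gen F b] =
      (contractL F 0 2 (cochain₃ F)).1 ![gen F a, gen F b] +
      (basicDer (wAdjoint (0 : F)) 2 (cochain₂ F)).1 ![gen F a, gen F b] := rfl
  rw [e, h, basicDer_apply, cochain₂_gen, LinearMap.baseChange_tmul, TensorProduct.smul_tmul',
    add_left_comm, ← TensorProduct.add_tmul, smul_eq_mul, Fin.sum_univ_two]
  congr 2
  cases a <;> cases b <;> simp

theorem cochain₃_gen (a b c : Bool) : (cochain₃ F).1 ![gen F a, gen F b, gen F c] =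
    ((bif b && c then MvPolynomial.X 1 - MvPolynomial.X 2 else 0) -
      (bif a && c then MvPolynomial.X 0 - MvPolynomial.X 2 else 0) +
      bif a && b then MvPolynomial.X 0 - MvPolynomial.X 1 else 0) ⊗ₜ genH F := by
  rw [gen_comp_three, cochain₃, detCochain_gen]
  congr 1
  cases a <;> cases b <;> cases c <;> simp [letterMatrix, colL, colX, Matrix.det_fin_three]
  ring

end Values

end

end LieConformal

/-! ### Assembly of the bases -/

theorem mainTheorem4 (F : Type*) [Field F] [CharZero F] :
    (∀ q : ℕ, Module.rank F (BasicCohomology (wAdjoint (0 : F)) q) =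
      if q = 1 ∨ q = 3 then 1 else if q = 2 then 2 else 0) ∧
    (∀ q : ℕ, Module.rank F (ReducedCohomology (wAdjoint (0 : F)) q) =
      if q = 1 ∨ q = 2 then 3 else if q = 0 ∨ q = 3 then 1 else 0) ∧
    ∃ (f01 : basicCochain (wAdjoint (0 : F)) 0)
      (f11 f12 f13 : basicCochain (wAdjoint (0 : F)) 1)
      (f21 f22 f23 : basicCochain (wAdjoint (0 : F)) 2)
      (f31 : basicCochain (wAdjoint (0 : F)) 3),
      -- the zero-cochain `H`
      f01.1 ![] = 1 ⊗ₜ genH F ∧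
      -- `f11 : L ↦ H`
      (f11.1 ![genL F] = 1 ⊗ₜ genH F ∧ f11.1 ![genH F] = 0) ∧
      -- `f12 : H ↦ H`
      (f12.1 ![genL F] = 0 ∧ f12.1 ![genH F] = 1 ⊗ₜ genH F) ∧
      -- `f13 : L ↦ ∂H`
      (f13.1 ![genL F] = 1 ⊗ₜ (WAlgebra (0 : F)).der (genH F) ∧ f13.1 ![genH F] = 0) ∧
      -- `f21 : L ⊗ H ↦ H`
      (f21.1 ![genL F, genL F] = 0 ∧ f21.1 ![genL F, genH F] = 1 ⊗ₜ genH F ∧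
        f21.1 ![genH F, genH F] = 0) ∧
      -- `f22 : L ⊗ L ↦ H (λ₁ - λ₂)`
      (f22.1 ![genL F, genL F] = (MvPolynomial.X 0 - MvPolynomial.X 1) ⊗ₜ genH F ∧
        f22.1 ![genL F, genH F] = 0 ∧ f22.1 ![genH F, genH F] = 0) ∧
      -- `f23 : L ⊗ H ↦ H (∂ + λ₂)`
      (f23.1 ![genL F, genL F] = 0 ∧
        f23.1 ![genL F, genH F] =
          1 ⊗ₜ (WAlgebra (0 : F)).der (genH F) + MvPolynomial.X 1 ⊗ₜ genH F ∧
        f23.1 ![genH F, genH F] = 0) ∧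
      -- `f31 : L ⊗ L ⊗ H ↦ H (λ₁ - λ₂)`
      (f31.1 ![genL F, genL F, genL F] = 0 ∧
        f31.1 ![genL F, genL F, genH F] = (MvPolynomial.X 0 - MvPolynomial.X 1) ⊗ₜ genH F ∧
        f31.1 ![genL F, genH F, genH F] = 0 ∧ f31.1 ![genH F, genH F, genH F] = 0) ∧
      IsCohomologyBasis (basicD (wAdjoint (0 : F))) 1 ![f11] ∧
      IsCohomologyBasis (basicD (wAdjoint (0 : F))) 2 ![f21, f22] ∧
      IsCohomologyBasis (basicD (wAdjoint (0 : F))) 3 ![f31] ∧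
      IsCohomologyBasis (reducedD (wAdjoint (0 : F))) 0 ![toReduced (wAdjoint (0 : F)) 0 f01] ∧
      IsCohomologyBasis (reducedD (wAdjoint (0 : F))) 1
        ![toReduced (wAdjoint (0 : F)) 1 f11, toReduced (wAdjoint (0 : F)) 1 f12,
          toReduced (wAdjoint (0 : F)) 1 f13] ∧
      IsCohomologyBasis (reducedD (wAdjoint (0 : F))) 2
        ![toReduced (wAdjoint (0 : F)) 2 f21, toReduced (wAdjoint (0 : F)) 2 f22,
          toReduced (wAdjoint (0 : F)) 2 f23] ∧
      IsCohomologyBasis (reducedD (wAdjoint (0 : F))) 3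
        ![toReduced (wAdjoint (0 : F)) 3 f31] := by
  refine ⟨rank_basicCohomology, rank_reducedCohomology, contractL F 0 0 (cochain₁ F), cochain₁ F,
    contractL F 0 1 (cochain₂ F), cochain₁Der F, cochain₂ F, cochain₂' F, cochain₂Der F,
    cochain₃ F, contractL_cochain₁, ⟨?_, ?_⟩, ⟨?_, ?_⟩, ⟨?_, ?_⟩, ⟨?_, ?_, ?_⟩, ⟨?_, ?_, ?_⟩,
    ⟨?_, ?_, ?_⟩, ⟨?_, ?_, ?_, ?_⟩, isKerBasis_one.isCohomologyBasis,
    isKerBasis_two.isCohomologyBasis, isKerBasis_three.isCohomologyBasis, ?_, ?_, ?_, ?_⟩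
  · exact cochain₁_gen true
  · exact (cochain₁_gen false).trans (TensorProduct.zero_tmul _ _)
  · exact (contractL_cochain₂_gen true).trans (TensorProduct.zero_tmul _ _)
  · exact contractL_cochain₂_gen false
  · exact cochain₁Der_gen true
  · exact (cochain₁Der_gen false).trans (TensorProduct.zero_tmul _ _)
  · exact (cochain₂_gen true true).trans (by simp)
  · exact (cochain₂_gen true false).trans (by simp)
  · exact (cochain₂_gen false false).trans (by simp)
  · exact cochain₂'_gen true true
  · exact (cochain₂'_gen true false).trans (TensorProduct.zero_tmul _ _)
  · exact (cochain₂'_gen false false).trans (TensorProduct.zero_tmul _ _)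
  · exact (cochain₂Der_gen true true).trans (by simp)
  · exact (cochain₂Der_gen true false).trans (by simp; rfl)
  · exact (cochain₂Der_gen false false).trans (by simp)
  · exact (cochain₃_gen true true true).trans (by simp)
  · exact (cochain₃_gen true true false).trans (by simp)
  · exact (cochain₃_gen true false false).trans (by simp)
  · exact (cochain₃_gen false false false).trans (by simp)
  · convert isCohomologyBasis_reducedD (isKerBasis_empty (F := F) (Or.inl rfl)) isKerBasis_one
      using 1
    ext1 i; fin_cases i; rfl
  · convert isCohomologyBasis_reducedD (isKerBasis_one (F := F)) isKerBasis_two using 1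
    ext1 i; fin_cases i
    · rfl
    · rfl
    -- The chosen representative and the contraction supplied by the transfer lemma differ by an
    -- element of `∂C̃¹`.
    · exact toReduced_add_basicDer 1 _ _
  · convert isCohomologyBasis_reducedD (isKerBasis_two (F := F)) isKerBasis_three using 1
    ext1 i; fin_cases i
    · rfl
    · rfl
    · exact toReduced_add_basicDer 2 _ _
  · convert isCohomologyBasis_reducedD (isKerBasis_three (F := F))
      (isKerBasis_empty (Or.inr le_rfl)) using 1
    ext1 i; fin_cases i; rfl
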